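/- Let $F$ be a number field with absolute Galois group $\Gamma=\mathrm{Gal}(\overline F/F)$, let $\ell$ be a prime and let $n\ge 0$ be an integer. Let $V=\overline{\mathbb Q}_\ell^{\,2n+1}$ with the quadratic form $Q(x)=x_1x_{2n+1}+x_2x_{2n}+\dots+x_{2n+1}x_1$, let $C=C^+\oplus C^-$ be its Clifford algebra, and let $\mathrm{GSpin}_{2n+1}(\overline{\mathbb Q}_\ell)=\{x\in (C^+)^\times : xVx^{-1}=V\}$. Let $\mathrm{std}\colon \mathrm{GSpin}_{2n+1}\to \mathrm{SO}_{2n+1}\subset \mathrm{GL}_{2n+1}$ be the representation on $V$ given by $v\mapsto xvx^{-1}$. Galois representations $r\colon\Gamma\to \mathrm{GSpin}_{2n+1}(\overline{\mathbb Q}_\ell)$ are continuous homomorphisms; $r$ is called semisimple if $f\circ r$ is semisimple for some faithful algebraic representation $f$ of $\mathrm{GSpin}_{2n+1}$. Two Galois representations $r_1,r_2$ are called locally conjugate if both are semisimple and, for every $\sigma\in\Gamma$, the semisimple parts $r_1(\sigma)_{\mathrm{ss}}$ and $r_2(\sigma)_{\mathrm{ss}}$ (Jordan decomposition) are conjugate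 in $\mathrm{GSpin}_{2n+1}(\overline{\mathbb Q}_\ell)$. For a quadratic extension $E/F$ inside $\overline F$, put $\Gamma_E=\mathrm{Gal}(\overline F/E)$, let $\eta_{E/F}\colon\Gamma\to\{\pm1\}$ be the quadratic character with kernel $\Gamma_E$, and say that $r$ is in bad position with respect to $E/F$ if for every $\sigma\in\Gamma\setminus\Gamma_E$ the element $\mathrm{std}(r(\sigma))$ has at least one eigenvalue equal to $-1$. Let $r_1,r_2\colon\Gamma\to\mathrm{GSpin}_{2n+1}(\overline{\mathbb Q}_\ell)$ be Galois representations with $r_1$ semisimple. Then $r_1$ and $r_2$ are locally conjugate if and only if there exist an element $g\in\mathrm{GSpin}_{2n+1}(\overline{\mathbb Q}_\ell)$ and a continuous character $\eta\colon\Gamma\to\{\pm1\}$ such that $r_2=\eta\cdot g r_1 g^{-1}$ and, if $\eta$ is non-trivial, then $r_1$ is in bad position with respect to the quadratic extension $E/F$ corresponding to $\eta$ (i.e. with $\eta=\eta_{E/F}$). Moreover, if $\mathrm{std}\circ r_1$ is irreducible, then for every quadratic extension $E/F$ the representation $r_1$ is not $\mathrm{GSpin}_{2n+1}(\overline{\mathbb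 Q}_\ell)$-conjugate to $r_1\cdot\eta_{E/F}$. -/

import Mathlib

/-! ### The split odd general spin group over a field of characteristic zero -/

namespace OddGSpin

section Group

variable (k : Type*) [Field k] (n : ℕ)

/-- The symmetric matrix with ones on the antidiagonal and zeros elsewhere. -/
def antidiagonal : Matrix (Fin (2 * n + 1)) (Fin (2 * n + 1)) k :=
  Matrix.of fun i j => if j = i.rev then 1 else 0

/-- The quadratic form `Q(x) = x₁ x_{2n+1} + x₂ x_{2n} + ⋯ + x_{2n+1} x₁` on `k^{2n+1}`. -/
noncomputable def form : QuadraticForm k (Fin (2 * n + 1) → k) :=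
  LinearMap.BilinMap.toQuadraticMap (Matrix.toLinearMap₂' k (antidiagonal k n))

theorem form_apply (x : Fin (2 * n + 1) → k) : form k n x = ∑ i, x i * x i.rev := by
  simp [form, antidiagonal, Matrix.toLinearMap₂'_apply, LinearMap.BilinMap.toQuadraticMap_apply]

/-- The Clifford algebra `C`, in which `v ^ 2 = Q(v)` for every vector `v`. -/
abbrev Cliff : Type _ := CliffordAlgebra (form k n)

/-- The even part `C⁺` of the Clifford algebra. -/
abbrev CliffEven : Type _ := CliffordAlgebra.even (form k n)

/-- `GSpin_{2n+1}(k)`: the units `x` of the even Clifford algebra with `x V x⁻¹ = V`, where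
`V = k^{2n+1}` is embedded in the Clifford algebra. -/
noncomputable def GSpin : Subgroup (CliffEven k n)ˣ where
  carrier := {x | ∀ v : Cliff k n, v ∈ LinearMap.range (CliffordAlgebra.ι (form k n)) ↔
    ((x : CliffEven k n) : Cliff k n) * v * ((↑x⁻¹ : CliffEven k n) : Cliff k n) ∈
      LinearMap.range (CliffordAlgebra.ι (form k n))}
  one_mem' := by intro v; simp
  mul_mem' := by
    intro x y hx hy v
    rw [hy v, hx]
    simp [mul_assoc]
  inv_mem' := by
    intro x hx v
    rw [hx (_ * v * _)]
    have h : ((x : CliffEven k n) : Cliff k n) * ((↑x⁻¹ : CliffEven k n) : Cliff k n) = 1 := by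
      rw [← MulMemClass.coe_mul, Units.mul_inv]; rfl
    have e : ((x : CliffEven k n) : Cliff k n) *
        (((↑x⁻¹ : CliffEven k n) : Cliff k n) * v * ((↑(x⁻¹)⁻¹ : CliffEven k n) : Cliff k n)) *
        ((↑x⁻¹ : CliffEven k n) : Cliff k n) = v := by
      rw [inv_inv, ← mul_assoc, ← mul_assoc, h, one_mul, mul_assoc, h, mul_one]
    rw [e]

variable {k n}

/-- An element of `GSpin_{2n+1}(k)` as an element of the even Clifford algebra. -/
noncomputable def toEven (x : GSpin k n) : CliffEven k n := ((x : (CliffEven k n)ˣ) : CliffEven k n)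

variable (k n)

/-- The scalars `±1` as elements of `GSpin_{2n+1}(k)`. -/
noncomputable def signs : ℤˣ →* GSpin k n :=
  (Units.map (Int.castRingHom (CliffEven k n) : ℤ →* CliffEven k n)).codRestrict (GSpin k n) (by
    intro e v
    rcases Int.units_eq_one_or e with rfl | rfl <;> simp)

theorem toEven_signs (e : ℤˣ) : toEven (signs k n e) = ((e : ℤ) : CliffEven k n) := rfl

/-- The topology on `GSpin_{2n+1}(k)`: the subspace topology from the finite-dimensional
`k`-vector space `C⁺` with its canonical (product) topology. -/
noncomputable instance gspinTopology [TopologicalSpace k] : TopologicalSpace (GSpin k n) :=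
  TopologicalSpace.induced toEven (moduleTopology k (CliffEven k n))

/-- The ring of regular functions on the algebraic group `GSpin_{2n+1}`, as functions on its
`k`-points: it is generated by the coordinates of `x` and of `x⁻¹`. -/
noncomputable def regularFunctions : Subalgebra k (GSpin k n → k) :=
  Algebra.adjoin k
    ({φ | ∃ c : CliffEven k n →ₗ[k] k, φ = fun x => c (toEven x)} ∪
      {φ | ∃ c : CliffEven k n →ₗ[k] k, φ = fun x => c (toEven x⁻¹)})

variable {k n}

/-- A representation of `GSpin_{2n+1}(k)` on `k^N` is algebraic if its matrix coefficients are
regular functions. -/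
def IsAlgebraicRep {N : ℕ} (f : Representation k (GSpin k n) (Fin N → k)) : Prop :=
  ∀ i j : Fin N, (fun x => f x (Pi.single j 1) i) ∈ regularFunctions k n

/-- A semisimple element: it acts semisimply in the (faithful) representation of
`GSpin_{2n+1}` on `C⁺` by left multiplication. -/
def IsSemisimpleElt (x : GSpin k n) : Prop :=
  Module.End.IsSemisimple (LinearMap.mulLeft k (toEven x))

/-- A unipotent element. -/
def IsUnipotentElt (x : GSpin k n) : Prop :=
  IsNilpotent (toEven x - 1)

/-- `s` is the semisimple part `x_ss` of `x` in the (multiplicative) Jordan decomposition. -/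
def IsSemisimplePart (x s : GSpin k n) : Prop :=
  IsSemisimpleElt s ∧ ∃ u : GSpin k n, IsUnipotentElt u ∧ Commute s u ∧ x = s * u

end Group

section Std

variable (k : Type*) [Field k] [CharZero k] (n : ℕ)

theorem ι_injective : Function.Injective (CliffordAlgebra.ι (form k n)) := by
  let _ : Invertible (2 : k) := invertibleOfNonzero two_ne_zero
  intro v w h
  have h' := congrArg (CliffordAlgebra.equivExterior (form k n)) h
  rw [CliffordAlgebra.equivExterior, CliffordAlgebra.changeFormEquiv_apply,
    CliffordAlgebra.changeFormEquiv_apply, CliffordAlgebra.changeForm_ι,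
    CliffordAlgebra.changeForm_ι] at h'
  exact ExteriorAlgebra.ι_leftInverse.injective h'

/-- The identification of `k^{2n+1}` with its image in the Clifford algebra. -/
noncomputable def vectorEquiv :
    (Fin (2 * n + 1) → k) ≃ₗ[k] LinearMap.range (CliffordAlgebra.ι (form k n)) :=
  LinearEquiv.ofInjective _ (ι_injective k n)

/-- The linear map `v ↦ x v x⁻¹` of `k^{2n+1}`, computed in the Clifford algebra. -/
noncomputable def stdLin (x : GSpin k n) : Module.End k (Fin (2 * n + 1) → k) :=
  (vectorEquiv k n).symm.toLinearMap ∘ₗ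
    (LinearMap.restrict
      (LinearMap.mulLeftRight k
        (((toEven x : CliffEven k n) : Cliff k n), ((toEven x⁻¹ : CliffEven k n) : Cliff k n)))
      (fun v hv => (x.2 v).1 hv)) ∘ₗ (vectorEquiv k n).toLinearMap

theorem ι_stdLin (x : GSpin k n) (v : Fin (2 * n + 1) → k) :
    CliffordAlgebra.ι (form k n) (stdLin k n x v) =
      (toEven x : Cliff k n) * CliffordAlgebra.ι (form k n) v * (toEven x⁻¹ : Cliff k n) := by
  have h : ∀ w, CliffordAlgebra.ι (form k n) ((vectorEquiv k n).symm w) = w := fun w =>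
    congrArg Subtype.val ((vectorEquiv k n).apply_symm_apply w)
  rw [stdLin, LinearMap.comp_apply, LinearEquiv.coe_coe, h]
  rfl

/-- The standard representation `GSpin_{2n+1} → SO_{2n+1} → GL_{2n+1}`, `v ↦ x v x⁻¹`. -/
noncomputable def std : Representation k (GSpin k n) (Fin (2 * n + 1) → k) where
  toFun := stdLin k n
  map_one' := by
    refine LinearMap.ext fun v => ι_injective k n ?_
    rw [ι_stdLin]
    simp [toEven]
  map_mul' x y := by
    refine LinearMap.ext fun v => ι_injective k n ?_
    rw [Module.End.mul_apply, ι_stdLin, ι_stdLin, ι_stdLin]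
    simp [toEven, mul_assoc]

end Std

end OddGSpin

/-! ### Galois representations with values in the odd general spin group -/

namespace OddGSpin

section Galois

variable (F : Type*) [Field F] (ℓ : ℕ) [Fact ℓ.Prime] (n : ℕ)

/-- The absolute Galois group of `F`. -/
abbrev AbsGal : Type _ := Gal(AlgebraicClosure F/F)

/-- A `GSpin_{2n+1}`-valued `ℓ`-adic Galois representation: a continuous homomorphism. -/
abbrev GaloisRep : Type _ := AbsGal F →ₜ* GSpin (PadicAlgCl ℓ) n

variable {F ℓ n}

/-- `r` is semisimple: `f ∘ r` is semisimple for some faithful algebraic representation `f`. -/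
def GaloisRep.IsSemisimple (r : GaloisRep F ℓ n) : Prop :=
  ∃ (N : ℕ) (f : Representation (PadicAlgCl ℓ) (GSpin (PadicAlgCl ℓ) n) (Fin N → PadicAlgCl ℓ)),
    IsAlgebraicRep f ∧ Function.Injective f ∧
      Representation.IsSemisimpleRepresentation
        (f.comp (r : AbsGal F →* GSpin (PadicAlgCl ℓ) n))

/-- Two semisimple representations are locally conjugate if `r₁(σ)_ss` and `r₂(σ)_ss` are conjugate
in `GSpin_{2n+1}` for every `σ`. -/
def GaloisRep.LocallyConjugate (r₁ r₂ : GaloisRep F ℓ n) : Prop :=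
  r₁.IsSemisimple ∧ r₂.IsSemisimple ∧
    ∀ σ : AbsGal F, ∃ s₁ s₂ : GSpin (PadicAlgCl ℓ) n,
      IsSemisimplePart (r₁ σ) s₁ ∧ IsSemisimplePart (r₂ σ) s₂ ∧ IsConj s₁ s₂

/-- `r` is in bad position with respect to `E`: for every `σ` outside `Gal(F̄/E)`, the standard
representation maps `r σ` to an element with eigenvalue `-1`. -/
def GaloisRep.BadPosition (r : GaloisRep F ℓ n)
    (E : IntermediateField F (AlgebraicClosure F)) : Prop :=
  ∀ σ : AbsGal F, σ ∉ E.fixingSubgroup →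
    Module.End.HasEigenvalue (std (PadicAlgCl ℓ) n (r σ)) (-1)

open Classical in
/-- The quadratic character `η_{E/F}` of a quadratic extension `E/F`, with kernel `Gal(F̄/E)`. -/
noncomputable def quadraticCharacter (E : IntermediateField F (AlgebraicClosure F))
    (σ : AbsGal F) : ℤˣ :=
  if σ ∈ E.fixingSubgroup then 1 else -1

end Galois

end OddGSpin

open OddGSpin

/-!
Write `V` for the split quadratic space of dimension `2n+1`, `std` for the action of the general
spin group on it, and `ρᵢ = std ∘ rᵢ`.

**Local conjugacy implies a global twist.** The plan is to compare `ρ₁` and `ρ₂` by their traces.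
For this they have to be semisimple, whereas the hypothesis only says that `f ∘ rᵢ` is semisimple
for some faithful algebraic representation `f`. Let `U ⊆ V` be a minimal stable subspace; it is
either nondegenerate, and then splits off, or totally isotropic. In the second case `U` has a
basis that is half of a hyperbolic family, and scaling `U` by `t ^ 2` lifts to a cocharacter of the
general spin group. The stabiliser of `U` is the associated parabolic subgroup: under `f` it never
lowers the weights of the cocharacter (`IsHyperbolic.proj_mul_mul_proj_eq_zero`). Complete
reducibility of `f ∘ rᵢ` therefore makes the sum of the weight spaces for an upward closed set of
weights the image of an equivariant projection `T`. Pairing `T` with the differential of `f` by the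
trace gives an invariant skew-symmetric form on `V` that vanishes on `U^⊥` but, for a suitable set of
weights, not on `U × V`; a stable complement of `U` is the kernel of a polynomial in the
corresponding endomorphism (`exists_stable_complement_of_form`). Hence `ρᵢ` is semisimple
(`isSemisimple_std_comp`).

Conjugate semisimple parts give equal characteristic polynomials, so `ρ₁` and `ρ₂` have equal traces
and are isomorphic by the density theorem (`exists_intertwiner_of_trace_eq`). An isomorphism of two
orthogonal representations can be corrected to an isometry by a square root of `A^* A` that is a
polynomial in it (`exists_isometry_intertwiner`). As the dimension is odd, every isometry is,
up to sign, a product of reflections and so lifts to the general spin group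
(`liftsUpToSign_of_isometry`). Therefore `r₂` and `g r₁ g⁻¹` differ by scalars; semisimple parts are
conjugate, so the spinor norms agree and the scalars are signs (`exists_eq_signs_mul`). The
resulting character is continuous because both of its fibres are closed, and if it is non-trivial it
cuts out a quadratic extension.

**Bad position.** If the semisimple parts of `x` and of a conjugate of `-x` are conjugate, left
multiplication by `x` on the Clifford algebra has trace zero. If `-1` were not an eigenvalue of
`std x`, every vector `w` could be moved through `x` in the sense that `w x = v x + x v`, the trace of
`y x` would vanish for all even `y`, and `y = x⁻¹` gives a contradiction
(`hasEigenvalue_neg_one_of_cliffTrace_eq_zero`). Conversely, if `x` is semisimple and `-1` is an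
eigenvalue of `std x`, the eigenspace contains an anisotropic vector; it anticommutes with `x`, so
`x` and `-x` are conjugate (`IsSemisimpleElt.isConj_neg`).

**Irreducible standard representation.** If `g` conjugates `r₁` to its twist, `std g` commutes with
`ρ₁` and is scalar by Schur's lemma. A scalar in the odd special orthogonal group is `1`
(`std_ne_neg_one` excludes `-1`), so `g` is central and the quadratic character is trivial.
-/

set_option linter.unusedSectionVars false

namespace OddGSpin

/-! ### The Clifford algebra of an odd-dimensional quadratic space -/

section Clifford

variable {k : Type*} [Field k] {n : ℕ}

local notation "ιV" => CliffordAlgebra.ι (form k n)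

variable (k n) in
/-- The polar form `Q(v + w) - Q(v) - Q(w)` of the quadratic form, that is, twice the symmetric
bilinear form of the antidiagonal matrix. -/
noncomputable def bil : LinearMap.BilinForm k (Fin (2 * n + 1) → k) := (form k n).polarBilin

theorem bil_apply (v w : Fin (2 * n + 1) → k) : bil k n v w = 2 * ∑ i, v i * w i.rev := by
  have h : ∑ i, w i * v i.rev = ∑ i, v i * w i.rev := by
    rw [← Equiv.sum_comp Fin.revPerm]
    exact Finset.sum_congr rfl fun i _ => by simp [mul_comm]
  rw [bil, QuadraticMap.polarBilin_apply_apply, QuadraticMap.polar, form_apply, form_apply,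
    form_apply]
  simp only [Pi.add_apply, add_mul, mul_add, Finset.sum_add_distrib]
  rw [h]; ring

theorem bil_comm (v w : Fin (2 * n + 1) → k) : bil k n v w = bil k n w v :=
  QuadraticMap.polar_comm _ _ _

theorem bil_self (v : Fin (2 * n + 1) → k) : bil k n v v = 2 * form k n v := by
  rw [bil, QuadraticMap.polarBilin_apply_apply, QuadraticMap.polar_self, two_nsmul]
  ring

theorem form_add (v w : Fin (2 * n + 1) → k) :
    form k n (v + w) = form k n v + form k n w + bil k n v w := by
  rw [bil, QuadraticMap.polarBilin_apply_apply, QuadraticMap.polar]; ring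

theorem ι_mul_self (v : Fin (2 * n + 1) → k) :
    ιV v * ιV v = algebraMap k (Cliff k n) (form k n v) := CliffordAlgebra.ι_sq_scalar _ _

theorem ι_mul_add_swap (v w : Fin (2 * n + 1) → k) :
    ιV v * ιV w + ιV w * ιV v = algebraMap k (Cliff k n) (bil k n v w) :=
  CliffordAlgebra.ι_mul_ι_add_swap _ _

theorem ι_anticomm {v w : Fin (2 * n + 1) → k} (h : bil k n v w = 0) :
    ιV v * ιV w = -(ιV w * ιV v) := by
  rw [eq_neg_iff_add_eq_zero, ι_mul_add_swap, h, map_zero]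

variable [CharZero k]

theorem form_eq_zero_iff (v : Fin (2 * n + 1) → k) : form k n v = 0 ↔ bil k n v v = 0 := by
  rw [bil_self]; simp

theorem eq_zero_of_bil_eq_zero {v : Fin (2 * n + 1) → k} (h : ∀ w, bil k n v w = 0) : v = 0 := by
  ext i
  have := h (Pi.single i.rev 1)
  rw [bil_apply, Finset.sum_eq_single i] at this
  · simpa using this
  · intro j _ hj
    rw [Pi.single_eq_of_ne, mul_zero]
    exact fun e => hj (Fin.rev_injective e)
  · simp

theorem bil_nondegenerate : (bil k n).Nondegenerate :=
  ⟨fun _ h => eq_zero_of_bil_eq_zero h,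
    fun _ h => eq_zero_of_bil_eq_zero fun w => by rw [bil_comm]; exact h w⟩

variable (k n) in
/-- There is an orthogonal basis of anisotropic vectors. -/
theorem exists_orthogonal_basis : ∃ b : Module.Basis (Fin (2 * n + 1)) k (Fin (2 * n + 1) → k),
    (∀ i j, i ≠ j → bil k n (b i) (b j) = 0) ∧ ∀ i, form k n (b i) ≠ 0 := by
  let _ : Invertible (2 : k) := invertibleOfNonzero two_ne_zero
  obtain ⟨b, hb⟩ := LinearMap.BilinForm.exists_orthogonal_basis
    (B := bil k n) ⟨fun v w => by simpa using bil_comm v w⟩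
  have hd : Module.finrank k (Fin (2 * n + 1) → k) = 2 * n + 1 := by simp
  refine ⟨b.reindex (finCongr hd), fun i j hij => ?_, fun i => ?_⟩
  · rw [Module.Basis.reindex_apply, Module.Basis.reindex_apply]
    exact hb (by simpa using hij)
  · rw [Ne, form_eq_zero_iff, Module.Basis.reindex_apply]
    exact LinearMap.BilinForm.iIsOrtho.not_isOrtho_basis_self_of_nondegenerate hb
      bil_nondegenerate _

/-- Every vector is a sum of anisotropic ones. -/
theorem span_anisotropic : Submodule.span k {v | form k n v ≠ 0} = ⊤ := by
  obtain ⟨b, -, hb⟩ := exists_orthogonal_basis k n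
  rw [eq_top_iff, ← b.span_eq, Submodule.span_le]
  rintro _ ⟨i, rfl⟩
  exact Submodule.subset_span (hb i)

/-- The product in the Clifford algebra of a list of basis vectors. -/
noncomputable def monomial (b : Module.Basis (Fin (2 * n + 1)) k (Fin (2 * n + 1) → k))
    (L : List (Fin (2 * n + 1))) : Cliff k n := (L.map fun i => ιV (b i)).prod

@[simp] theorem monomial_nil (b : Module.Basis (Fin (2 * n + 1)) k (Fin (2 * n + 1) → k)) :
    monomial b [] = 1 := rfl

@[simp] theorem monomial_cons (b : Module.Basis (Fin (2 * n + 1)) k (Fin (2 * n + 1) → k))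
    (i : Fin (2 * n + 1)) (L : List (Fin (2 * n + 1))) :
    monomial b (i :: L) = ιV (b i) * monomial b L := by simp [monomial]

@[simp] theorem monomial_append (b : Module.Basis (Fin (2 * n + 1)) k (Fin (2 * n + 1) → k))
    (L M : List (Fin (2 * n + 1))) :
    monomial b (L ++ M) = monomial b L * monomial b M := by simp [monomial]

theorem span_monomial (b : Module.Basis (Fin (2 * n + 1)) k (Fin (2 * n + 1) → k)) :
    Submodule.span k (Set.range (monomial b)) = ⊤ := by
  rw [eq_top_iff]
  rintro c -
  induction c using CliffordAlgebra.induction with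
  | algebraMap r =>
    rw [Algebra.algebraMap_eq_smul_one]
    exact Submodule.smul_mem _ _ (Submodule.subset_span ⟨[], rfl⟩)
  | ι v =>
    rw [← b.sum_repr v, map_sum]
    refine Submodule.sum_mem _ fun i _ => ?_
    rw [map_smul]
    exact Submodule.smul_mem _ _ (Submodule.subset_span ⟨[i], by simp⟩)
  | add a b ha hb => exact Submodule.add_mem _ ha hb
  | mul x y hx hy =>
    have := Submodule.mul_mem_mul hx hy
    rw [Submodule.span_mul_span] at this
    refine Submodule.span_mono ?_ this
    rintro _ ⟨_, ⟨L, rfl⟩, _, ⟨M, rfl⟩, rfl⟩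
    exact ⟨L ++ M, by simp⟩

variable {b : Module.Basis (Fin (2 * n + 1)) k (Fin (2 * n + 1) → k)}

/-- An orthogonal basis vector commutes with a monomial up to sign. -/
theorem ι_mul_monomial (hb : ∀ i j, i ≠ j → bil k n (b i) (b j) = 0) (i : Fin (2 * n + 1))
    (L : List (Fin (2 * n + 1))) :
    ιV (b i) * monomial b L = ((-1) ^ (L.length + L.count i) : k) • (monomial b L * ιV (b i)) := by
  induction L with
  | nil => simp
  | cons j L ih =>
    rw [monomial_cons]
    by_cases h : j = i
    · subst h
      rw [mul_assoc, List.count_cons_self, List.length_cons]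
      nth_rewrite 1 [ih]
      rw [mul_smul_comm]
      congr 1; ring
    · rw [List.count_cons_of_ne h, List.length_cons, ← mul_assoc,
        ι_anticomm (hb i j (Ne.symm h)), neg_mul, mul_assoc, ih, mul_smul_comm, mul_assoc,
        ← neg_smul]
      congr 1; ring

/-- A monomial in which each basis vector occurs an even number of times is a scalar. -/
theorem monomial_eq_algebraMap (hb : ∀ i j, i ≠ j → bil k n (b i) (b j) = 0) :
    ∀ (m : ℕ) (L : List (Fin (2 * n + 1))), L.length = m → (∀ i, Even (L.count i)) →
      ∃ r : k, monomial b L = algebraMap k _ r := by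
  intro m
  induction m using Nat.strong_induction_on with
  | _ m ih =>
    rintro (_ | ⟨a, T⟩) hm hL
    · exact ⟨1, by simp⟩
    · have ha : a ∈ T := by
        have := hL a
        rw [List.count_cons_self, Nat.even_add_one, Nat.not_even_iff_odd] at this
        exact List.count_pos_iff.1 this.pos
      obtain ⟨T₁, T₂, rfl⟩ := List.append_of_mem ha
      simp only [List.length_cons, List.length_append] at hm
      obtain ⟨r, hr⟩ := ih (T₁.length + T₂.length) (by omega) (T₁ ++ T₂) (by simp) (by
        intro i
        have := hL i
        by_cases h : a = i
        · subst h
          simp only [List.count_cons_self, List.count_append] at this ⊢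
          rw [Nat.even_iff] at this ⊢; omega
        · simpa [List.count_cons_of_ne h, List.count_append] using this)
      refine ⟨(-1) ^ (T₁.length + T₁.count a) * (form k n (b a) * r), ?_⟩
      rw [monomial_cons, monomial_append, monomial_cons, ← mul_assoc, ι_mul_monomial hb,
        smul_mul_assoc, mul_assoc, ← mul_assoc (ιV _), ι_mul_self, ← mul_assoc,
        ← Algebra.commutes, mul_assoc, ← monomial_append, hr, Algebra.smul_def, map_mul, map_mul]

/-- The twisted conjugation by `b i`: it multiplies a monomial by `-1` for each factor `b i`. -/
noncomputable def twist (b : Module.Basis (Fin (2 * n + 1)) k (Fin (2 * n + 1) → k))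
    (i : Fin (2 * n + 1)) : Cliff k n →ₗ[k] Cliff k n :=
  (form k n (b i))⁻¹ • (CliffordAlgebra.involute.toLinearMap ∘ₗ
    LinearMap.mulLeftRight k (ιV (b i), ιV (b i)))

theorem twist_apply (i : Fin (2 * n + 1)) (x : Cliff k n) :
    twist b i x = (form k n (b i))⁻¹ •
      CliffordAlgebra.involute (ιV (b i) * x * ιV (b i)) := by
  simp [twist]

theorem twist_monomial (hb : ∀ i j, i ≠ j → bil k n (b i) (b j) = 0)
    (hb' : ∀ i, form k n (b i) ≠ 0) (i : Fin (2 * n + 1)) (L : List (Fin (2 * n + 1))) :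
    twist b i (monomial b L) = ((-1) ^ L.count i : k) • monomial b L := by
  have hinv : CliffordAlgebra.involute (monomial b L) = ((-1) ^ L.length : k) • monomial b L := by
    have := CliffordAlgebra.involute_prod_map_ι (Q := form k n) (L.map b)
    rw [List.map_map, List.length_map] at this
    exact this
  rw [twist_apply, ι_mul_monomial hb, smul_mul_assoc, mul_assoc, ι_mul_self, ← Algebra.commutes,
    ← Algebra.smul_def, map_smul, map_smul, hinv, smul_smul, smul_smul, smul_smul]
  congr 1
  have : (-1 : k) ^ L.length * (-1) ^ L.length = 1 := by rw [← mul_pow]; simp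
  rw [pow_add]
  generalize (-1 : k) ^ L.length = e at this
  generalize (-1 : k) ^ L.count i = d
  have hq := hb' i
  field_simp
  linear_combination d * this

/-- The product of the projectors onto the fixed spaces of the twisted conjugations by the basis
vectors in the list `I`. -/
noncomputable def fixedProj (b : Module.Basis (Fin (2 * n + 1)) k (Fin (2 * n + 1) → k))
    (I : List (Fin (2 * n + 1))) : Cliff k n →ₗ[k] Cliff k n :=
  (I.map fun i => ((2 : k)⁻¹ • (1 + twist b i) : Module.End k (Cliff k n))).prod

theorem fixedProj_monomial (hb : ∀ i j, i ≠ j → bil k n (b i) (b j) = 0)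
    (hb' : ∀ i, form k n (b i) ≠ 0) (I L : List (Fin (2 * n + 1))) :
    fixedProj b I (monomial b L) = 0 ∨
      (fixedProj b I (monomial b L) = monomial b L ∧ ∀ i ∈ I, Even (L.count i)) := by
  induction I with
  | nil => right; simp [fixedProj]
  | cons i I ih =>
    have h : fixedProj b (i :: I) (monomial b L) =
      (2 : k)⁻¹ • (fixedProj b I (monomial b L) + twist b i (fixedProj b I (monomial b L))) := by
      simp [fixedProj]
    rw [h]
    rcases ih with h0 | ⟨h1, h2⟩
    · left; simp [h0]
    · rw [h1, twist_monomial hb hb']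
      rcases Nat.even_or_odd (L.count i) with he | ho
      · right
        refine ⟨?_, by simpa using ⟨he, h2⟩⟩
        rw [he.neg_one_pow, one_smul, ← two_smul k, smul_smul, inv_mul_cancel₀ two_ne_zero,
          one_smul]
      · left
        rw [ho.neg_one_pow]; simp

/-- An element of the Clifford algebra that supercommutes with all vectors is a scalar. -/
theorem eq_algebraMap_of_supercommute {c : Cliff k n}
    (h : ∀ v, ιV v * c = CliffordAlgebra.involute c * ιV v) : ∃ r : k, c = algebraMap k _ r := by
  obtain ⟨b, hb, hb'⟩ := exists_orthogonal_basis k n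
  have hfix : ∀ i, twist b i c = c := by
    intro i
    rw [twist_apply, h, mul_assoc, ι_mul_self, ← Algebra.commutes, ← Algebra.smul_def, map_smul,
      CliffordAlgebra.involute_involute, smul_smul, inv_mul_cancel₀ (hb' i), one_smul]
  have hP : ∀ I, fixedProj b I c = c := by
    intro I
    induction I with
    | nil => simp [fixedProj]
    | cons i I ih =>
      have h : fixedProj b (i :: I) c =
        (2 : k)⁻¹ • (fixedProj b I c + twist b i (fixedProj b I c)) := by simp [fixedProj]
      rw [h, ih, hfix, ← two_smul k, smul_smul, inv_mul_cancel₀ two_ne_zero, one_smul]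
  rw [← hP (List.finRange _)]
  have hc : c ∈ Submodule.span k (Set.range (monomial b)) := by rw [span_monomial]; trivial
  have : fixedProj b (List.finRange _) c ∈
      LinearMap.range (Algebra.linearMap k (Cliff k n)) := by
    clear h hfix hP
    induction hc using Submodule.span_induction with
    | mem x hx =>
      obtain ⟨L, rfl⟩ := hx
      rcases fixedProj_monomial hb hb' (List.finRange _) L with h0 | ⟨h1, h2⟩
      · rw [h0]; exact Submodule.zero_mem _
      · rw [h1]
        obtain ⟨r, hr⟩ := monomial_eq_algebraMap hb _ L rfl fun i => h2 i (List.mem_finRange i)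
        exact ⟨r, hr.symm⟩
    | zero => rw [map_zero]; exact Submodule.zero_mem _
    | add x y _ _ hx hy => rw [map_add]; exact Submodule.add_mem _ hx hy
    | smul r x _ hx => rw [map_smul]; exact Submodule.smul_mem _ _ hx
  obtain ⟨r, hr⟩ := this
  exact ⟨r, hr.symm⟩

/-- An even element that commutes with all vectors is a scalar. -/
theorem eq_algebraMap_of_commute {c : Cliff k n} (hc : c ∈ CliffordAlgebra.even (form k n))
    (h : ∀ v, ιV v * c = c * ιV v) : ∃ r : k, c = algebraMap k _ r :=
  eq_algebraMap_of_supercommute fun v => by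
    rw [CliffordAlgebra.involute_eq_of_mem_even hc, h]

theorem commute_of_commute_ι {c : Cliff k n} (h : ∀ v, ιV v * c = c * ιV v) (x : Cliff k n) :
    x * c = c * x := by
  induction x using CliffordAlgebra.induction with
  | algebraMap r => exact Algebra.commutes _ _
  | ι v => exact h v
  | add a b ha hb => rw [add_mul, mul_add, ha, hb]
  | mul a b ha hb => rw [mul_assoc, hb, ← mul_assoc, ha, mul_assoc]

theorem isUnit_ι {v : Fin (2 * n + 1) → k} (hv : form k n v ≠ 0) : IsUnit (ιV v) := by
  have h : IsUnit (ιV v * ιV v) := by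
    rw [ι_mul_self]
    exact (IsUnit.mk0 _ hv).map (algebraMap k (Cliff k n))
  exact ((Commute.refl (ιV v)).isUnit_mul_iff.1 h).1

variable (k n) in
/-- The product of an orthogonal basis is odd, invertible and central. -/
theorem exists_odd_central_unit : ∃ w : (Cliff k n)ˣ,
    (w : Cliff k n) ∈ CliffordAlgebra.evenOdd (form k n) 1 ∧
      ∀ x : Cliff k n, x * w = w * x := by
  obtain ⟨b, hb, hb'⟩ := exists_orthogonal_basis k n
  have hu : IsUnit (monomial b (List.finRange (2 * n + 1))) := by
    refine List.prod_isUnit fun x hx => ?_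
    obtain ⟨i, -, rfl⟩ := List.mem_map.1 hx
    exact isUnit_ι (hb' i)
  have hcomm : ∀ x, x * monomial b (List.finRange (2 * n + 1)) =
      monomial b (List.finRange (2 * n + 1)) * x := by
    refine commute_of_commute_ι fun v => ?_
    rw [← b.sum_repr v, map_sum, Finset.sum_mul, Finset.mul_sum]
    refine Finset.sum_congr rfl fun i _ => ?_
    rw [map_smul, smul_mul_assoc, ι_mul_monomial hb, mul_smul_comm, List.length_finRange,
      List.count_eq_one_of_mem (List.nodup_finRange _) (List.mem_finRange i)]
    rw [show 2 * n + 1 + 1 = 2 * (n + 1) by ring, pow_mul]; simp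
  have hodd : ∀ L : List (Fin (2 * n + 1)),
      monomial b L ∈ CliffordAlgebra.evenOdd (form k n) (L.length : ZMod 2) := by
    intro L
    induction L with
    | nil => simpa using CliffordAlgebra.one_le_evenOdd_zero (form k n) (Submodule.one_le.1 le_rfl)
    | cons i L ih =>
      have h : ((i :: L).length : ZMod 2) = 1 + (L.length : ZMod 2) := by
        rw [List.length_cons, Nat.cast_add, Nat.cast_one, add_comm]
      rw [monomial_cons, h]
      exact CliffordAlgebra.evenOdd_mul_le _ _ _
        (Submodule.mul_mem_mul (CliffordAlgebra.ι_mem_evenOdd_one _ _) ih)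
  refine ⟨hu.unit, ?_, fun x => by simpa using hcomm x⟩
  have := hodd (List.finRange (2 * n + 1))
  rw [List.length_finRange] at this
  have h2 : ((2 * n + 1 : ℕ) : ZMod 2) = 1 := by
    push_cast; rw [show (2 : ZMod 2) = 0 from rfl]; simp
  rwa [h2] at this

/-- An even element that anticommutes with all vectors vanishes, because the space has odd
dimension. -/
theorem eq_zero_of_anticommute {c : Cliff k n} (hc : c ∈ CliffordAlgebra.even (form k n))
    (h : ∀ v, ιV v * c = -(c * ιV v)) : c = 0 := by
  obtain ⟨w, hw, hcen⟩ := exists_odd_central_unit k n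
  have hinv : CliffordAlgebra.involute (c * (w : Cliff k n)) = -(c * w) := by
    rw [map_mul, CliffordAlgebra.involute_eq_of_mem_even hc,
      CliffordAlgebra.involute_eq_of_mem_odd hw, mul_neg]
  obtain ⟨r, hr⟩ := eq_algebraMap_of_supercommute (c := c * (w : Cliff k n)) fun v => by
    rw [hinv, ← mul_assoc, h, neg_mul, mul_assoc, hcen, neg_mul, mul_assoc]
  have : c * (w : Cliff k n) = 0 := by
    rw [hr, AlgHom.commutes] at hinv
    rw [hr]
    have h2 : (2 : k) • algebraMap k (Cliff k n) r = 0 := by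
      rw [two_smul]; nth_rewrite 2 [hinv]; simp
    exact (smul_eq_zero.1 h2).resolve_left two_ne_zero
  simpa using congrArg (· * (↑w⁻¹ : Cliff k n)) this

variable (k n) in
instance finite_exteriorAlgebra : Module.Finite k (ExteriorAlgebra k (Fin (2 * n + 1) → k)) := by
  have h1 : (⨆ i : ℕ, ⋀[k]^i (Fin (2 * n + 1) → k)) = ⊤ :=
    (DirectSum.Decomposition.isInternal
      (fun i : ℕ => ⋀[k]^i (Fin (2 * n + 1) → k))).submodule_iSup_eq_top
  have h2 : (⨆ i : ℕ, ⋀[k]^i (Fin (2 * n + 1) → k)) =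
      ⨆ i : Fin (2 * n + 2), ⋀[k]^(i : ℕ) (Fin (2 * n + 1) → k) := by
    apply le_antisymm
    · refine iSup_le fun i => ?_
      by_cases hi : i < 2 * n + 2
      · exact le_iSup (fun i : Fin (2 * n + 2) => ⋀[k]^(i : ℕ) (Fin (2 * n + 1) → k)) ⟨i, hi⟩
      · have h0 : Module.finrank k (⋀[k]^i (Fin (2 * n + 1) → k)) = 0 := by
          rw [exteriorPower.finrank_eq, Module.finrank_fintype_fun_eq_card, Fintype.card_fin]
          exact Nat.choose_eq_zero_of_lt (by omega)
        rw [Submodule.finrank_eq_zero.1 h0]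
        exact bot_le
    · exact iSup_le fun i => le_iSup (fun i : ℕ => ⋀[k]^i (Fin (2 * n + 1) → k)) i
  refine ⟨?_⟩
  rw [← h1, h2]
  exact Submodule.fg_iSup _ fun i => Module.Finite.iff_fg.1 inferInstance

variable (k n) in
instance finite_cliff : Module.Finite k (Cliff k n) := by
  let _ : Invertible (2 : k) := invertibleOfNonzero two_ne_zero
  exact Module.Finite.equiv (CliffordAlgebra.equivExterior (form k n)).symm

variable (k n) in
instance finite_cliffEven : Module.Finite k (CliffEven k n) :=
  FiniteDimensional.finiteDimensional_submodule
    (Subalgebra.toSubmodule (CliffordAlgebra.even (form k n)))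

end Clifford

/-! ### The general spin group: spinor norm, reflections and lifts of isometries -/

section Group

variable {k : Type*} [Field k] {n : ℕ}

local notation "ιV" => CliffordAlgebra.ι (form k n)

/-- An element of `GSpin_{2n+1}(k)` as an element of the full Clifford algebra. -/
noncomputable def cl (x : GSpin k n) : Cliff k n := (toEven x : Cliff k n)

theorem cl_mem_even (x : GSpin k n) : cl x ∈ CliffordAlgebra.even (form k n) := (toEven x).2

theorem toEven_one : toEven (1 : GSpin k n) = 1 := rfl

theorem toEven_mul (x y : GSpin k n) : toEven (x * y) = toEven x * toEven y := rfl

theorem toEven_mul_inv (x : GSpin k n) : toEven x * toEven x⁻¹ = 1 := by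
  rw [← toEven_mul, mul_inv_cancel, toEven_one]

theorem toEven_inv_mul (x : GSpin k n) : toEven x⁻¹ * toEven x = 1 := by
  rw [← toEven_mul, inv_mul_cancel, toEven_one]

theorem toEven_injective : Function.Injective (toEven : GSpin k n → CliffEven k n) :=
  fun _ _ h => Subtype.ext (Units.ext h)

theorem cl_one : cl (1 : GSpin k n) = 1 := rfl

theorem cl_mul (x y : GSpin k n) : cl (x * y) = cl x * cl y := rfl

theorem cl_mul_inv (x : GSpin k n) : cl x * cl x⁻¹ = 1 := by
  rw [← cl_mul, mul_inv_cancel, cl_one]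

theorem cl_inv_mul (x : GSpin k n) : cl x⁻¹ * cl x = 1 := by
  rw [← cl_mul, inv_mul_cancel, cl_one]

theorem cl_injective : Function.Injective (cl : GSpin k n → Cliff k n) :=
  fun _ _ h => toEven_injective (Subtype.ext h)

theorem isUnit_cl (x : GSpin k n) : IsUnit (cl x) :=
  ⟨⟨cl x, cl x⁻¹, cl_mul_inv x, cl_inv_mul x⟩, rfl⟩

theorem cl_signs_neg_one : cl (signs k n (-1)) = -1 := by
  rw [cl, toEven_signs]; simp

theorem signs_mul_comm (e : ℤˣ) (x : GSpin k n) : signs k n e * x = x * signs k n e := by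
  apply cl_injective
  rw [cl_mul, cl_mul]
  rcases Int.units_eq_one_or e with rfl | rfl
  · rw [map_one, cl_one, one_mul, mul_one]
  · rw [cl_signs_neg_one]; simp

variable [CharZero k]

theorem ι_std (x : GSpin k n) (v : Fin (2 * n + 1) → k) :
    ιV (std k n x v) = cl x * ιV v * cl x⁻¹ := ι_stdLin k n x v

theorem cl_mul_ι (x : GSpin k n) (v : Fin (2 * n + 1) → k) :
    cl x * ιV v = ιV (std k n x v) * cl x := by
  rw [ι_std, mul_assoc, cl_inv_mul, mul_one]

/-- The standard representation is characterised by the commutation relation in the Clifford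
algebra. -/
theorem std_eq_of_cl_mul_ι {x : GSpin k n} {v w : Fin (2 * n + 1) → k}
    (h : cl x * ιV v = ιV w * cl x) : std k n x v = w := by
  apply ι_injective k n
  rw [ι_std, h, mul_assoc, cl_mul_inv, mul_one]

theorem std_signs (e : ℤˣ) : std k n (signs k n e) = 1 := by
  refine LinearMap.ext fun v => std_eq_of_cl_mul_ι ?_
  rcases Int.units_eq_one_or e with rfl | rfl
  · rw [map_one, cl_one]; simp
  · rw [cl_signs_neg_one]; simp

theorem std_inv_apply (x : GSpin k n) (v : Fin (2 * n + 1) → k) :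
    std k n x⁻¹ (std k n x v) = v := by
  rw [← Module.End.mul_apply, ← map_mul, inv_mul_cancel, map_one, Module.End.one_apply]

theorem std_apply_inv (x : GSpin k n) (v : Fin (2 * n + 1) → k) :
    std k n x (std k n x⁻¹ v) = v := by
  rw [← Module.End.mul_apply, ← map_mul, mul_inv_cancel, map_one, Module.End.one_apply]

theorem algebraMap_cliff_injective : Function.Injective (algebraMap k (Cliff k n)) := by
  let _ : Invertible (2 : k) := invertibleOfNonzero two_ne_zero
  intro a b h
  have := congrArg (CliffordAlgebra.equivExterior (form k n)) h
  rw [CliffordAlgebra.equivExterior, CliffordAlgebra.changeFormEquiv_apply,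
    CliffordAlgebra.changeFormEquiv_apply, CliffordAlgebra.changeForm_algebraMap,
    CliffordAlgebra.changeForm_algebraMap] at this
  exact ExteriorAlgebra.algebraMap_leftInverse _ |>.injective this

instance nontrivial_cliff : Nontrivial (Cliff k n) :=
  algebraMap_cliff_injective.nontrivial

theorem form_std (x : GSpin k n) (v : Fin (2 * n + 1) → k) :
    form k n (std k n x v) = form k n v := by
  apply algebraMap_cliff_injective (n := n)
  rw [← ι_mul_self, ι_std]
  calc _ = cl x * ιV v * (cl x⁻¹ * cl x) * ιV v * cl x⁻¹ := by simp only [mul_assoc]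
    _ = _ := by
      rw [cl_inv_mul, mul_one, mul_assoc (cl x), ι_mul_self, ← Algebra.commutes, mul_assoc,
        cl_mul_inv, mul_one]

theorem bil_std (x : GSpin k n) (v w : Fin (2 * n + 1) → k) :
    bil k n (std k n x v) (std k n x w) = bil k n v w := by
  have h := form_add (std k n x v) (std k n x w)
  rw [← map_add, form_std, form_std, form_std, form_add] at h
  exact (add_left_cancel h).symm

/-- An invertible even element with even inverse whose conjugation preserves the space of vectors,
as an element of the general spin group. -/
noncomputable def mkGSpin (y : (Cliff k n)ˣ)
    (hy : (y : Cliff k n) ∈ CliffordAlgebra.even (form k n))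
    (hz : (↑y⁻¹ : Cliff k n) ∈ CliffordAlgebra.even (form k n))
    (h : ∀ v, ∃ w, (y : Cliff k n) * ιV v = ιV w * (y : Cliff k n)) : GSpin k n :=
  ⟨⟨⟨y, hy⟩, ⟨(↑y⁻¹ : Cliff k n), hz⟩, Subtype.ext y.mul_inv, Subtype.ext y.inv_mul⟩, by
    let c : Cliff k n →ₗ[k] Cliff k n := LinearMap.mulLeftRight k (↑y, ↑y⁻¹)
    have hc : ∀ v, c v = (y : Cliff k n) * v * (↑y⁻¹ : Cliff k n) := fun v =>
      by simp [c]
    have hinj : Function.Injective c := fun v w hvw => by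
      rw [hc, hc] at hvw
      exact y.isUnit.mul_right_injective (y⁻¹.isUnit.mul_left_injective hvw)
    have hle : (LinearMap.range ιV).map c ≤ LinearMap.range ιV := by
      rintro _ ⟨_, ⟨v, rfl⟩, rfl⟩
      obtain ⟨w, hw⟩ := h v
      exact ⟨w, by rw [hc, hw, mul_assoc, Units.mul_inv, mul_one]⟩
    have heq := Submodule.eq_of_le_of_finrank_eq hle
      (LinearEquiv.finrank_eq (Submodule.equivMapOfInjective c hinj _).symm)
    intro v
    constructor
    · intro hv
      exact hle ⟨v, hv, hc v⟩
    · intro hv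
      rw [← heq] at hv
      obtain ⟨w, hw, hwv⟩ := hv
      rwa [← hinj (hwv.trans (hc v).symm)]⟩

theorem cl_mkGSpin_inv {y : (Cliff k n)ˣ}
    (hy : (y : Cliff k n) ∈ CliffordAlgebra.even (form k n))
    (hz : (↑y⁻¹ : Cliff k n) ∈ CliffordAlgebra.even (form k n))
    (h : ∀ v, ∃ w, (y : Cliff k n) * ιV v = ιV w * (y : Cliff k n)) :
    cl (mkGSpin y hy hz h)⁻¹ = (↑y⁻¹ : Cliff k n) := rfl

/-- The kernel of the standard representation consists of scalars. -/
theorem cl_eq_algebraMap_of_std_eq_one {x : GSpin k n} (h : std k n x = 1) :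
    ∃ r : k, cl x = algebraMap k _ r :=
  eq_algebraMap_of_commute (cl_mem_even x) fun v => by rw [cl_mul_ι, h]; rfl

theorem std_ne_neg_one (x : GSpin k n) : std k n x ≠ -1 := by
  intro h
  have := eq_zero_of_anticommute (cl_mem_even x) fun v => by
    rw [cl_mul_ι, h]; simp
  exact (isUnit_cl x).ne_zero this

theorem reverse_cl_mul_ι (x : GSpin k n) (v : Fin (2 * n + 1) → k) :
    CliffordAlgebra.reverse (cl x) * ιV (std k n x v) = ιV v * CliffordAlgebra.reverse (cl x) := by
  have := congrArg CliffordAlgebra.reverse (cl_mul_ι x v)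
  rwa [CliffordAlgebra.reverse.map_mul, CliffordAlgebra.reverse.map_mul,
    CliffordAlgebra.reverse_ι, CliffordAlgebra.reverse_ι, eq_comm] at this

theorem exists_spinorNorm (x : GSpin k n) :
    ∃ r : k, CliffordAlgebra.reverse (cl x) * cl x = algebraMap k _ r := by
  refine eq_algebraMap_of_commute
    (Subalgebra.mul_mem _ ?_ (cl_mem_even x)) fun v => ?_
  · exact (CliffordAlgebra.reverse_mem_evenOdd_iff _).2 (cl_mem_even x)
  · rw [← mul_assoc, ← reverse_cl_mul_ι, mul_assoc, mul_assoc, cl_mul_ι]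

/-- The spinor norm `N(x) = x^* x`, where `x ↦ x^*` is the reversal of the Clifford algebra. -/
noncomputable def spinorNorm (x : GSpin k n) : k := (exists_spinorNorm x).choose

theorem reverse_mul_cl (x : GSpin k n) :
    CliffordAlgebra.reverse (cl x) * cl x = algebraMap k _ (spinorNorm x) :=
  (exists_spinorNorm x).choose_spec

theorem spinorNorm_eq {x : GSpin k n} {r : k}
    (h : CliffordAlgebra.reverse (cl x) * cl x = algebraMap k _ r) : spinorNorm x = r :=
  algebraMap_cliff_injective (n := n) (by rw [← reverse_mul_cl, h])

theorem spinorNorm_mul (x y : GSpin k n) :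
    spinorNorm (x * y) = spinorNorm x * spinorNorm y := by
  apply spinorNorm_eq
  rw [cl_mul, CliffordAlgebra.reverse.map_mul, mul_assoc, ← mul_assoc _ (cl x), reverse_mul_cl,
    Algebra.commutes, ← mul_assoc, reverse_mul_cl, map_mul, Algebra.commutes]

theorem spinorNorm_one : spinorNorm (1 : GSpin k n) = 1 := by
  apply spinorNorm_eq
  rw [cl_one, CliffordAlgebra.reverse.map_one, one_mul, map_one]

theorem spinorNorm_ne_zero (x : GSpin k n) : spinorNorm x ≠ 0 := by
  intro h
  have := spinorNorm_mul x x⁻¹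
  rw [mul_inv_cancel, spinorNorm_one, h, zero_mul] at this
  exact one_ne_zero this

theorem spinorNorm_conj (g x : GSpin k n) : spinorNorm (g * x * g⁻¹) = spinorNorm x := by
  have h : spinorNorm g * spinorNorm g⁻¹ = 1 := by
    rw [← spinorNorm_mul, mul_inv_cancel, spinorNorm_one]
  rw [spinorNorm_mul, spinorNorm_mul]
  linear_combination spinorNorm x * h

/-- The reflection in the hyperplane orthogonal to `v` (junk if `v` is isotropic). -/
noncomputable def refl (v : Fin (2 * n + 1) → k) : Module.End k (Fin (2 * n + 1) → k) :=
  1 - ((form k n v)⁻¹ • bil k n v).smulRight v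

theorem refl_apply (v u : Fin (2 * n + 1) → k) :
    refl v u = u - ((form k n v)⁻¹ * bil k n v u) • v := rfl

theorem ι_mul_ι_eq_refl {v : Fin (2 * n + 1) → k} (hv : form k n v ≠ 0)
    (u : Fin (2 * n + 1) → k) : ιV v * ιV u = -(ιV (refl v u) * ιV v) := by
  rw [refl_apply, map_sub, map_smul, sub_mul, smul_mul_assoc, ι_mul_self, Algebra.smul_def,
    ← map_mul (algebraMap k (Cliff k n)),
    mul_right_comm _ _ (form k n v), inv_mul_cancel₀ hv, one_mul, ← ι_mul_add_swap]
  abel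

theorem refl_refl {v : Fin (2 * n + 1) → k} (hv : form k n v ≠ 0)
    (u : Fin (2 * n + 1) → k) : refl v (refl v u) = u := by
  rw [refl_apply, refl_apply, map_sub, map_smul, bil_self, smul_eq_mul, sub_sub, ← add_smul]
  have : (form k n v)⁻¹ * bil k n v u +
      (form k n v)⁻¹ * (bil k n v u - (form k n v)⁻¹ * bil k n v u * (2 * form k n v)) = 0 := by
    field_simp; ring
  rw [this, zero_smul, sub_zero]

theorem bil_refl {v : Fin (2 * n + 1) → k} (hv : form k n v ≠ 0) (u w : Fin (2 * n + 1) → k) :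
    bil k n (refl v u) (refl v w) = bil k n u w := by
  simp only [refl_apply, map_sub, map_smul, LinearMap.sub_apply, LinearMap.smul_apply, bil_self,
    smul_eq_mul, bil_comm u v]
  field_simp; ring

theorem refl_of_bil_eq_zero {v u : Fin (2 * n + 1) → k} (h : bil k n v u = 0) :
    refl v u = u := by
  rw [refl_apply, h, mul_zero, zero_smul, sub_zero]

/-- An anisotropic vector as a unit of the Clifford algebra. -/
noncomputable def unitι (v : Fin (2 * n + 1) → k) (hv : form k n v ≠ 0) : (Cliff k n)ˣ where
  val := ιV v
  inv := (form k n v)⁻¹ • ιV v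
  val_inv := by
    rw [mul_smul_comm, ι_mul_self, Algebra.smul_def, ← map_mul (algebraMap k (Cliff k n)),
      inv_mul_cancel₀ hv, map_one]
  inv_val := by
    rw [smul_mul_assoc, ι_mul_self, Algebra.smul_def, ← map_mul (algebraMap k (Cliff k n)),
      inv_mul_cancel₀ hv, map_one]

theorem even_of_odd_mul_odd {x y : Cliff k n} (hx : x ∈ CliffordAlgebra.evenOdd (form k n) 1)
    (hy : y ∈ CliffordAlgebra.evenOdd (form k n) 1) : x * y ∈ CliffordAlgebra.even (form k n) :=
  CliffordAlgebra.evenOdd_mul_le (form k n) 1 1 (Submodule.mul_mem_mul hx hy)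

theorem unitι_odd (v : Fin (2 * n + 1) → k) (hv : form k n v ≠ 0) :
    (unitι v hv : Cliff k n) ∈ CliffordAlgebra.evenOdd (form k n) 1 :=
  CliffordAlgebra.ι_mem_evenOdd_one _ _

theorem unitι_inv_odd (v : Fin (2 * n + 1) → k) (hv : form k n v ≠ 0) :
    (↑(unitι v hv)⁻¹ : Cliff k n) ∈ CliffordAlgebra.evenOdd (form k n) 1 :=
  Submodule.smul_mem _ _ (CliffordAlgebra.ι_mem_evenOdd_one _ _)

/-- The product of two anisotropic vectors, as an element of the general spin group. -/
noncomputable def pair (v w : Fin (2 * n + 1) → k) (hv : form k n v ≠ 0) (hw : form k n w ≠ 0) :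
    GSpin k n :=
  mkGSpin (unitι v hv * unitι w hw) (even_of_odd_mul_odd (unitι_odd v hv) (unitι_odd w hw))
    (by
      rw [mul_inv_rev]
      exact even_of_odd_mul_odd (unitι_inv_odd w hw) (unitι_inv_odd v hv))
    (fun u => ⟨refl v (refl w u), by
      change ιV v * ιV w * ιV u = _ * (ιV v * ιV w)
      rw [mul_assoc, ι_mul_ι_eq_refl hw, mul_neg, ← mul_assoc, ι_mul_ι_eq_refl hv, neg_mul,
        neg_neg, mul_assoc]⟩)

theorem cl_pair {v w : Fin (2 * n + 1) → k} (hv : form k n v ≠ 0) (hw : form k n w ≠ 0) :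
    cl (pair v w hv hw) = ιV v * ιV w := rfl

theorem cl_pair_inv {v w : Fin (2 * n + 1) → k} (hv : form k n v ≠ 0) (hw : form k n w ≠ 0) :
    cl (pair v w hv hw)⁻¹ = ((form k n w)⁻¹ • ιV w) * ((form k n v)⁻¹ • ιV v) := by
  rw [pair, cl_mkGSpin_inv, mul_inv_rev]
  rfl

/-- Since the Clifford algebra has an odd central unit `w`, an anisotropic vector `v` gives the
element `w v` of the general spin group. Its conjugation action is that of `v`. -/
theorem exists_cl_conj_eq_ι_conj {v : Fin (2 * n + 1) → k} (hv : form k n v ≠ 0) :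
    ∃ h : GSpin k n, ∀ x y : Cliff k n, cl h * x = y * cl h ↔ ιV v * x = y * ιV v := by
  obtain ⟨w, hw, hcen⟩ := exists_odd_central_unit k n
  have hw' : (↑w⁻¹ : Cliff k n) ∈ CliffordAlgebra.evenOdd (form k n) 1 := by
    -- the square of `w` is an even central element, hence a scalar
    obtain ⟨r, hr⟩ := eq_algebraMap_of_commute (c := (w : Cliff k n) * (w : Cliff k n))
      (even_of_odd_mul_odd hw hw)
      fun v => by rw [← mul_assoc, hcen, mul_assoc, hcen]
    have hr0 : r ≠ 0 := by
      rintro rfl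
      rw [map_zero] at hr
      exact (w * w).ne_zero (by rw [Units.val_mul, hr])
    have : (↑w⁻¹ : Cliff k n) = r⁻¹ • (w : Cliff k n) := by
      refine Units.inv_eq_of_mul_eq_one_right ?_
      rw [mul_smul_comm, hr, Algebra.smul_def, ← map_mul (algebraMap k (Cliff k n)),
        inv_mul_cancel₀ hr0, map_one]
    rw [this]
    exact Submodule.smul_mem _ _ hw
  have key : ∀ x y : Cliff k n, (w : Cliff k n) * ιV v * x = y * ((w : Cliff k n) * ιV v) ↔
      ιV v * x = y * ιV v := by
    intro x y
    rw [mul_assoc, ← mul_assoc y, hcen y, mul_assoc]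
    exact w.isUnit.mul_right_inj
  refine ⟨mkGSpin (w * unitι v hv) (even_of_odd_mul_odd hw (unitι_odd v hv)) ?_ ?_, key⟩
  · have : (w * unitι v hv)⁻¹ = (unitι v hv)⁻¹ * w⁻¹ := mul_inv_rev _ _
    rw [this]
    exact even_of_odd_mul_odd (unitι_inv_odd v hv) hw'
  · intro u
    refine ⟨-refl v u, (key _ _).2 ?_⟩
    rw [ι_mul_ι_eq_refl hv, map_neg, neg_mul]

/-- An endomorphism lifts up to sign if it or its negative comes from the general spin group. -/
def LiftsUpToSign (A : Module.End k (Fin (2 * n + 1) → k)) : Prop :=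
  ∃ x : GSpin k n, std k n x = A ∨ std k n x = -A

theorem LiftsUpToSign.mul {A B : Module.End k (Fin (2 * n + 1) → k)} (hA : LiftsUpToSign A)
    (hB : LiftsUpToSign B) : LiftsUpToSign (A * B) := by
  obtain ⟨x, hx⟩ := hA
  obtain ⟨y, hy⟩ := hB
  refine ⟨x * y, ?_⟩
  rw [map_mul]
  rcases hx with hx | hx <;> rcases hy with hy | hy <;> rw [hx, hy]
  · exact Or.inl rfl
  · exact Or.inr (LinearMap.ext fun v => by simp)
  · exact Or.inr (LinearMap.ext fun v => by simp)
  · exact Or.inl (LinearMap.ext fun v => by simp)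

theorem liftsUpToSign_refl {v : Fin (2 * n + 1) → k} (hv : form k n v ≠ 0) :
    LiftsUpToSign (refl v) := by
  obtain ⟨h, hh⟩ := exists_cl_conj_eq_ι_conj hv
  refine ⟨h, Or.inr (LinearMap.ext fun u => std_eq_of_cl_mul_ι ?_)⟩
  rw [hh, ι_mul_ι_eq_refl hv, LinearMap.neg_apply, map_neg, neg_mul]

theorem LiftsUpToSign.of_refl_mul {v : Fin (2 * n + 1) → k} (hv : form k n v ≠ 0)
    {A : Module.End k (Fin (2 * n + 1) → k)} (h : LiftsUpToSign (refl v * A)) :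
    LiftsUpToSign A := by
  have := (liftsUpToSign_refl hv).mul h
  rwa [← mul_assoc, show refl v * refl v = 1 from LinearMap.ext fun u => refl_refl hv u,
    one_mul] at this

/-- Every isometry is a product of reflections, so it lifts to the general spin group up to
sign. -/
theorem liftsUpToSign_of_isometry (A : Module.End k (Fin (2 * n + 1) → k))
    (hA : ∀ v w, bil k n (A v) (A w) = bil k n v w) : LiftsUpToSign A := by
  obtain ⟨b, hb, hb'⟩ := exists_orthogonal_basis k n
  suffices H : ∀ (j : ℕ) (A : Module.End k (Fin (2 * n + 1) → k)),
      (∀ v w, bil k n (A v) (A w) = bil k n v w) →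
      (∀ i : Fin (2 * n + 1), j ≤ i → A (b i) = b i) → LiftsUpToSign A from
    H (2 * n + 1) A hA fun i hi => absurd i.2 (by omega)
  intro j
  induction j with
  | zero =>
    intro A _ h
    refine ⟨1, Or.inl ?_⟩
    rw [map_one]
    exact b.ext fun i => by rw [h i (Nat.zero_le _), Module.End.one_apply]
  | succ j ih =>
    intro A hA h
    by_cases hj : j < 2 * n + 1
    swap
    · exact ih A hA fun i hi => absurd i.2 (by omega)
    set e := b ⟨j, hj⟩ with he
    have hff : ∀ v, form k n (A v) = form k n v := fun v => by
      have := hA v v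
      rw [bil_self, bil_self] at this
      exact mul_left_cancel₀ two_ne_zero this
    have hort : ∀ i : Fin (2 * n + 1), j + 1 ≤ i → bil k n e (b i) = 0 ∧
        bil k n (A e) (b i) = 0 := fun i hi => by
      have h0 : bil k n e (b i) = 0 := hb _ _ (by rintro rfl; simp at hi)
      refine ⟨h0, ?_⟩
      rw [← h i hi, hA, h0]
    have hcase : ∀ i : Fin (2 * n + 1), j ≤ i → i = ⟨j, hj⟩ ∨ j + 1 ≤ i := by
      intro i hi
      rcases Nat.eq_or_lt_of_le hi with h | h
      · left; exact Fin.ext h.symm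
      · right; exact h
    have hQm : form k n (A e - e) = 2 * form k n e - bil k n (A e) e := by
      rw [sub_eq_add_neg, form_add, QuadraticMap.map_neg, hff, map_neg]; ring
    have hQp : form k n (A e + e) = 2 * form k n e + bil k n (A e) e := by
      rw [form_add, hff]; ring
    by_cases hm : form k n (A e - e) = 0
    · have hp : form k n (A e + e) ≠ 0 := by
        intro hp
        apply hb' ⟨j, hj⟩
        rw [hQm] at hm
        rw [hQp] at hp
        have : 4 * form k n e = 0 := by linear_combination hm + hp
        simpa using this
      refine LiftsUpToSign.of_refl_mul hp (LiftsUpToSign.of_refl_mul (hb' ⟨j, hj⟩) (ih _ ?_ ?_))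
      · intro v w
        simp only [Module.End.mul_apply]
        rw [bil_refl (hb' _), bil_refl hp, hA]
      · intro i hi
        simp only [Module.End.mul_apply]
        rcases hcase i hi with rfl | hi
        · have h1 : refl (A e + e) (A e) = -e := by
            have : bil k n (A e + e) (A e) = form k n (A e + e) := by
              rw [map_add, LinearMap.add_apply, bil_self, hff, hQp, bil_comm e]
            rw [refl_apply, this, inv_mul_cancel₀ hp, one_smul]; abel
          have h2 : refl e e = -e := by
            rw [refl_apply, bil_self, mul_left_comm, inv_mul_cancel₀ (hb' _), mul_one, two_smul]
            abel
          rw [← he, h1, map_neg, h2, neg_neg]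
        · rw [h i hi, refl_of_bil_eq_zero (v := A e + e), refl_of_bil_eq_zero (hort i hi).1]
          rw [map_add, LinearMap.add_apply, (hort i hi).1, (hort i hi).2, add_zero]
    · refine LiftsUpToSign.of_refl_mul hm (ih _ ?_ ?_)
      · intro v w
        simp only [Module.End.mul_apply]
        rw [bil_refl hm, hA]
      · intro i hi
        simp only [Module.End.mul_apply]
        rcases hcase i hi with rfl | hi
        · have h1 : refl (A e - e) (A e) = e := by
            have : bil k n (A e - e) (A e) = form k n (A e - e) := by
              rw [map_sub, LinearMap.sub_apply, bil_self, hff, hQm, bil_comm e]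
            rw [refl_apply, this, inv_mul_cancel₀ hm, one_smul]; abel
          rw [← he, h1]
        · rw [h i hi, refl_of_bil_eq_zero]
          rw [map_sub, LinearMap.sub_apply, (hort i hi).1, (hort i hi).2, sub_zero]

end Group

/-! ### The trace of left multiplication and the eigenvalue `-1` -/

section Trace

variable {k : Type*} [Field k] [CharZero k] {n : ℕ}

local notation "ιV" => CliffordAlgebra.ι (form k n)

variable (k n) in
/-- The trace of left multiplication on the Clifford algebra. -/
noncomputable def cliffTrace : Cliff k n →ₗ[k] k :=
  LinearMap.trace k (Cliff k n) ∘ₗ (Algebra.lmul k (Cliff k n)).toLinearMap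

theorem cliffTrace_mul_comm (x y : Cliff k n) : cliffTrace k n (x * y) = cliffTrace k n (y * x) := by
  simp only [cliffTrace, LinearMap.comp_apply, AlgHom.toLinearMap_apply, map_mul]
  exact LinearMap.trace_mul_comm k _ _

theorem cliffTrace_one_ne_zero : cliffTrace k n 1 ≠ 0 := by
  simp only [cliffTrace, LinearMap.comp_apply, AlgHom.toLinearMap_apply, map_one,
    LinearMap.trace_one]
  exact_mod_cast Module.finrank_pos.ne'

theorem cliffTrace_eq_zero_of_isNilpotent {x : Cliff k n} (hx : IsNilpotent x) :
    cliffTrace k n x = 0 :=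
  (LinearMap.isNilpotent_trace_of_isNilpotent (hx.map (Algebra.lmul k (Cliff k n)))).eq_zero

theorem cliffTrace_conj (g x : GSpin k n) :
    cliffTrace k n (cl (g * x * g⁻¹)) = cliffTrace k n (cl x) := by
  rw [cl_mul, cl_mul, cliffTrace_mul_comm, ← mul_assoc, cl_inv_mul, one_mul]

/-- The supercommutator of a vector with a product of `m + 1` vectors is a combination of products
of `m` vectors. -/
theorem supercommutator_mem (v : Fin (2 * n + 1) → k) (m : ℕ) :
    ∀ P ∈ LinearMap.range ιV ^ (m + 1),
      ιV v * P + ((-1) ^ m : k) • (P * ιV v) ∈ LinearMap.range ιV ^ m := by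
  induction m with
  | zero =>
    intro P hP
    rw [zero_add, pow_one] at hP
    obtain ⟨w, rfl⟩ := hP
    rw [pow_zero, pow_zero, one_smul, ι_mul_add_swap]
    exact Submodule.algebraMap_mem _
  | succ m ih =>
    intro P hP
    rw [pow_succ] at hP
    induction hP using Submodule.mul_induction_on' with
    | mem_mul_mem Q hQ w hw =>
      have h1 := Submodule.mul_mem_mul (ih Q hQ) hw
      rw [← pow_succ] at h1
      obtain ⟨w, rfl⟩ := hw
      have h2 : ((-1) ^ m : k) • (Q * (ιV v * ιV w + ιV w * ιV v)) ∈
          LinearMap.range ιV ^ (m + 1) := by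
        rw [ι_mul_add_swap, ← Algebra.commutes, ← Algebra.smul_def]
        exact Submodule.smul_mem _ _ (Submodule.smul_mem _ _ hQ)
      convert Submodule.sub_mem _ h1 h2 using 1
      rw [add_mul, smul_mul_assoc, mul_add, smul_add, pow_succ, mul_neg_one, neg_smul]
      simp only [mul_assoc]
      abel
    | add x _ y _ hx hy =>
      convert Submodule.add_mem _ hx hy using 1
      rw [mul_add, add_mul, smul_add]; abel

/-- If `-1` is not an eigenvalue of `std x`, then every vector `w` satisfies `w x = v x + x v` for
some vector `v`. Hence the trace of `w₁ ⋯ w_{2m} x` reduces to traces of shorter such products, and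
if `x` had trace zero, the trace would vanish on the whole even Clifford algebra. -/
theorem hasEigenvalue_neg_one_of_cliffTrace_eq_zero {x : GSpin k n}
    (hx : cliffTrace k n (cl x) = 0) : Module.End.HasEigenvalue (std k n x) (-1) := by
  by_contra hev
  have hinj : Function.Injective
      ((1 : Module.End k (Fin (2 * n + 1) → k)) + std k n x) := by
    rw [← LinearMap.ker_eq_bot, Submodule.eq_bot_iff]
    intro v hv
    by_contra h0
    refine hev (Module.End.hasEigenvalue_of_hasEigenvector (x := v)
      ⟨Module.End.mem_eigenspace_iff.2 ?_, h0⟩)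
    rw [LinearMap.mem_ker, LinearMap.add_apply, Module.End.one_apply] at hv
    rw [neg_one_smul]
    exact eq_neg_of_add_eq_zero_right hv
  have hsurj := LinearMap.injective_iff_surjective.1 hinj
  have key : ∀ m : ℕ, ∀ P ∈ LinearMap.range ιV ^ (2 * m), cliffTrace k n (P * cl x) = 0 := by
    intro m
    induction m with
    | zero =>
      intro P hP
      rw [mul_zero, pow_zero, Submodule.mem_one] at hP
      obtain ⟨r, rfl⟩ := hP
      rw [← Algebra.smul_def, map_smul, hx, smul_zero]
    | succ m ih =>
      intro P hP
      rw [show 2 * (m + 1) = 2 * m + 1 + 1 by ring, pow_succ] at hP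
      induction hP using Submodule.mul_induction_on' with
      | mem_mul_mem Q hQ w hw =>
        obtain ⟨w, rfl⟩ := hw
        obtain ⟨v, rfl⟩ := hsurj w
        have hw : ιV (((1 : Module.End k (Fin (2 * n + 1) → k)) + std k n x) v) * cl x =
            ιV v * cl x + cl x * ιV v := by
          rw [LinearMap.add_apply, Module.End.one_apply, map_add, add_mul, cl_mul_ι]
        have := ih _ (supercommutator_mem v (2 * m) Q hQ)
        rw [pow_mul, neg_one_sq, one_pow, one_smul, add_mul, map_add] at this
        rw [mul_assoc, hw, mul_add, map_add, ← mul_assoc Q (cl x), cliffTrace_mul_comm _ (ιV v),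
          ← mul_assoc, ← mul_assoc, add_comm]
        exact this
      | add x _ y _ hx hy => rw [add_mul, map_add, hx, hy, add_zero]
  have heven : ∀ P ∈ CliffordAlgebra.even (form k n), cliffTrace k n (P * cl x) = 0 := by
    intro P hP
    have hle : CliffordAlgebra.evenOdd (form k n) 0 ≤
        LinearMap.ker (cliffTrace k n ∘ₗ LinearMap.mulRight k (cl x)) := by
      refine iSup_le ?_
      rintro ⟨j, hj⟩ P hP
      obtain ⟨m, rfl⟩ := (ZMod.natCast_eq_zero_iff_even.1 hj).two_dvd
      exact key m P hP
    exact hle hP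
  apply cliffTrace_one_ne_zero (k := k) (n := n)
  rw [← cl_inv_mul x]
  exact heven _ (cl_mem_even x⁻¹)

end Trace

/-! ### The Jordan decomposition in the general spin group -/

section Jordan

open Polynomial

/-- Evaluating a polynomial at a right multiplication. -/
theorem aeval_mulRight {k A : Type*} [Field k] [Ring A] [Algebra k A] (p : k[X]) (a : A) :
    aeval (LinearMap.mulRight k a) p = LinearMap.mulRight k (aeval a p) := by
  ext x
  rw [aeval_eq_sum_range, aeval_eq_sum_range]
  simp [Finset.mul_sum]

/-- The inverse of a unit in a finite-dimensional algebra is a polynomial in it. -/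
theorem exists_aeval_eq_inv {k A : Type*} [Field k] [Ring A] [Algebra k A] [Module.Finite k A]
    (a : Aˣ) : ∃ p : k[X], aeval (a : A) p = (↑a⁻¹ : A) := by
  let S := Algebra.adjoin k {(a : A)}
  let a' : S := ⟨a, Algebra.self_mem_adjoin_singleton k _⟩
  have hinj : Function.Injective (LinearMap.mulLeft k a') := fun x y hxy => by
    have : (a : A) * (x : A) = (a : A) * (y : A) := congrArg Subtype.val hxy
    exact Subtype.ext (a.isUnit.mul_right_injective this)
  have : Module.Finite k S :=
    FiniteDimensional.finiteDimensional_submodule (Subalgebra.toSubmodule S)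
  obtain ⟨b, hb⟩ := LinearMap.injective_iff_surjective.1 hinj 1
  have hab : (a : A) * (b : A) = 1 := congrArg Subtype.val hb
  have hmem : (b : A) ∈ Algebra.adjoin k {(a : A)} := b.2
  rw [Algebra.adjoin_singleton_eq_range_aeval] at hmem
  obtain ⟨p, hp⟩ := hmem
  exact ⟨p, by rw [Units.inv_eq_of_mul_eq_one_right hab]; exact hp⟩

variable {k : Type*} [Field k] [CharZero k] {n : ℕ}

local notation "ιV" => CliffordAlgebra.ι (form k n)

/-- Conjugation by a unit of the even Clifford algebra, on the full Clifford algebra. -/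
noncomputable def evenConj (a : (CliffEven k n)ˣ) : Module.End k (Cliff k n) :=
  LinearMap.mulLeft k ((a : CliffEven k n) : Cliff k n) *
    LinearMap.mulRight k ((↑a⁻¹ : CliffEven k n) : Cliff k n)

theorem evenConj_apply (a : (CliffEven k n)ˣ) (x : Cliff k n) :
    evenConj a x = (a : CliffEven k n) * x * (↑a⁻¹ : CliffEven k n) := by
  simp [evenConj, mul_assoc]

theorem evenConj_mul (a b : (CliffEven k n)ˣ) : evenConj (a * b) = evenConj a * evenConj b := by
  ext x
  simp [evenConj_apply, mul_assoc]

/-- Conjugation by a semisimple element is semisimple, as the product of the commuting semisimple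
operators of left and right multiplication. -/
theorem isSemisimple_evenConj {a : (CliffEven k n)ˣ}
    (ha : Module.End.IsSemisimple (LinearMap.mulLeft k (a : CliffEven k n))) :
    (evenConj a).IsSemisimple := by
  have hsq := ha.minpoly_squarefree
  set q := minpoly k (LinearMap.mulLeft k (a : CliffEven k n)) with hq
  have hqa : aeval (a : CliffEven k n) q = 0 := by
    have h : aeval (Algebra.lmul k (CliffEven k n) (a : CliffEven k n)) q = 0 := minpoly.aeval _ _
    rw [aeval_algHom_apply] at h
    simpa using LinearMap.congr_fun h 1
  have hqc : aeval ((a : CliffEven k n) : Cliff k n) q = 0 := by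
    have := aeval_algHom_apply (CliffordAlgebra.even (form k n)).val (a : CliffEven k n) q
    rw [hqa, map_zero] at this
    exact this
  have hl : Module.End.IsSemisimple (LinearMap.mulLeft k ((a : CliffEven k n) : Cliff k n)) := by
    refine Module.End.isSemisimple_of_squarefree_aeval_eq_zero hsq ?_
    change aeval (Algebra.lmul k (Cliff k n) _) q = 0
    rw [aeval_algHom_apply, hqc, map_zero]
  have hr : Module.End.IsSemisimple (LinearMap.mulRight k ((a : CliffEven k n) : Cliff k n)) := by
    refine Module.End.isSemisimple_of_squarefree_aeval_eq_zero hsq ?_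
    rw [aeval_mulRight, hqc, LinearMap.mulRight_zero_eq_zero]
  obtain ⟨p, hp⟩ := exists_aeval_eq_inv (k := k) a
  have hp' : aeval ((a : CliffEven k n) : Cliff k n) p = ((↑a⁻¹ : CliffEven k n) : Cliff k n) := by
    have := aeval_algHom_apply (CliffordAlgebra.even (form k n)).val (a : CliffEven k n) p
    rw [hp] at this
    exact this
  have hr' : Module.End.IsSemisimple
      (LinearMap.mulRight k ((↑a⁻¹ : CliffEven k n) : Cliff k n)) := by
    rw [← hp', ← aeval_mulRight]
    exact hr.aeval p
  exact Module.End.IsSemisimple.mul_of_commute (LinearMap.commute_mulLeft_right _ _) hl hr'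

/-- Conjugation by a unipotent element is unipotent. -/
theorem isNilpotent_evenConj_sub_one {u : (CliffEven k n)ˣ}
    (hu : IsNilpotent ((u : CliffEven k n) - 1)) : IsNilpotent (evenConj u - 1) := by
  have hu' : IsNilpotent (((u : CliffEven k n) : Cliff k n) - 1) := by
    have := hu.map (CliffordAlgebra.even (form k n)).val
    simpa using this
  have hv' : IsNilpotent (((↑u⁻¹ : CliffEven k n) : Cliff k n) - 1) := by
    have h2 : (↑u⁻¹ : CliffEven k n) - 1 = -((↑u⁻¹ : CliffEven k n) * ((u : CliffEven k n) - 1)) := by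
      rw [mul_sub, Units.inv_mul, mul_one]; abel
    have hc : Commute (↑u⁻¹ : CliffEven k n) ((u : CliffEven k n) - 1) :=
      (Commute.units_inv_left (Commute.refl (u : CliffEven k n))).sub_right (Commute.one_right _)
    have h3 : IsNilpotent ((↑u⁻¹ : CliffEven k n) - 1) := by
      rw [h2]; exact (hc.isNilpotent_mul_left hu).neg
    have := h3.map (CliffordAlgebra.even (form k n)).val
    simpa using this
  have h1 : IsNilpotent (LinearMap.mulLeft k (((u : CliffEven k n) : Cliff k n) - 1)) := by
    obtain ⟨m, hm⟩ := hu'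
    exact ⟨m, by rw [LinearMap.pow_mulLeft, hm, LinearMap.mulLeft_zero_eq_zero]⟩
  have h2 : IsNilpotent (LinearMap.mulRight k (((↑u⁻¹ : CliffEven k n) : Cliff k n) - 1)) := by
    obtain ⟨m, hm⟩ := hv'
    exact ⟨m, by rw [LinearMap.pow_mulRight, hm, LinearMap.mulRight_zero_eq_zero]⟩
  have h3 : evenConj u - 1 = LinearMap.mulLeft k (((u : CliffEven k n) : Cliff k n) - 1) *
      LinearMap.mulRight k ((↑u⁻¹ : CliffEven k n) : Cliff k n) +
      LinearMap.mulRight k (((↑u⁻¹ : CliffEven k n) : Cliff k n) - 1) := by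
    ext x
    simp [evenConj_apply, sub_mul, mul_sub, mul_assoc]
  have hc1 : Commute (LinearMap.mulLeft k (((u : CliffEven k n) : Cliff k n) - 1))
      (LinearMap.mulRight k ((↑u⁻¹ : CliffEven k n) : Cliff k n)) :=
    LinearMap.commute_mulLeft_right _ _
  have hc2 : Commute (LinearMap.mulRight k ((↑u⁻¹ : CliffEven k n) : Cliff k n))
      (LinearMap.mulRight k (((↑u⁻¹ : CliffEven k n) : Cliff k n) - 1)) := by
    ext x; simp [mul_sub, sub_mul, mul_assoc]
  rw [h3]
  exact Commute.isNilpotent_add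
    ((LinearMap.commute_mulLeft_right _ _).mul_left hc2) (hc1.isNilpotent_mul_right h1) h2

theorem ι_std_eq_evenConj (x : GSpin k n) (v : Fin (2 * n + 1) → k) :
    ιV (std k n x v) = evenConj (x : (CliffEven k n)ˣ) (ιV v) := by
  rw [ι_std, evenConj_apply]; rfl

theorem ι_aeval_std (x : GSpin k n) (p : k[X]) (v : Fin (2 * n + 1) → k) :
    ιV (aeval (std k n x) p v) = aeval (evenConj (x : (CliffEven k n)ˣ)) p (ιV v) := by
  have hpow : ∀ j : ℕ, ∀ v, ιV ((std k n x ^ j) v) =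
      (evenConj (x : (CliffEven k n)ˣ) ^ j) (ιV v) := by
    intro j
    induction j with
    | zero => intro v; rfl
    | succ j ih => intro v; rw [pow_succ, pow_succ, Module.End.mul_apply, ih, ι_std_eq_evenConj,
        Module.End.mul_apply]
  rw [aeval_eq_sum_range, aeval_eq_sum_range]
  simp only [LinearMap.sum_apply, LinearMap.smul_apply, map_sum, map_smul, hpow]

theorem isSemisimple_std {s : GSpin k n} (hs : IsSemisimpleElt s) :
    Module.End.IsSemisimple (std k n s) := by
  have h := isSemisimple_evenConj (a := (s : (CliffEven k n)ˣ)) hs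
  refine Module.End.isSemisimple_of_squarefree_aeval_eq_zero h.minpoly_squarefree
    (LinearMap.ext fun v => ι_injective k n ?_)
  rw [ι_aeval_std, minpoly.aeval]; simp

theorem isNilpotent_std_sub_one {u : GSpin k n} (hu : IsUnipotentElt u) :
    IsNilpotent (std k n u - 1) := by
  obtain ⟨m, hm⟩ := isNilpotent_evenConj_sub_one (u := (u : (CliffEven k n)ˣ)) hu
  refine ⟨m, LinearMap.ext fun v => ι_injective k n ?_⟩
  have := ι_aeval_std u ((X - 1) ^ m) v
  rw [map_pow, map_sub, aeval_X, map_one, map_pow, map_sub, aeval_X, map_one, hm] at this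
  rw [this]; simp

/-- A unipotent element has spinor norm `1`. -/
theorem spinorNorm_of_isUnipotentElt {u : GSpin k n} (hu : IsUnipotentElt u) :
    spinorNorm u = 1 := by
  have hu' : IsNilpotent (cl u - 1) := by
    have := hu.map (CliffordAlgebra.even (form k n)).val
    rw [map_sub, map_one] at this
    exact this
  have hr : IsNilpotent (CliffordAlgebra.reverse (cl u) - 1) := by
    obtain ⟨m, hm⟩ := hu'
    refine ⟨m, ?_⟩
    have hpow : ∀ (j : ℕ) (c : Cliff k n),
        CliffordAlgebra.reverse (c ^ j) = CliffordAlgebra.reverse c ^ j := by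
      intro j c
      induction j with
      | zero => rw [pow_zero, pow_zero, CliffordAlgebra.reverse.map_one]
      | succ j ih => rw [pow_succ, pow_succ', CliffordAlgebra.reverse.map_mul, ih]
    rw [← CliffordAlgebra.reverse.map_one, ← map_sub, ← hpow, hm, map_zero]
  -- since `u^* = N(u) u⁻¹`, both `u - 1` and `u - N(u)` are nilpotent
  have hN := reverse_mul_cl u
  set c := spinorNorm u
  have hrev : CliffordAlgebra.reverse (cl u) = algebraMap k _ c * cl u⁻¹ := by
    rw [← hN, mul_assoc, cl_mul_inv, mul_one]
  have hcomm : Commute (cl u) (CliffordAlgebra.reverse (cl u) - 1) := by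
    have h1 : Commute (cl u) (cl u⁻¹) := by
      rw [Commute, SemiconjBy, cl_mul_inv, cl_inv_mul]
    rw [hrev]
    exact (Commute.mul_right (Algebra.commutes c (cl u)).symm h1).sub_right
      (Commute.one_right _)
  have h2 : IsNilpotent (cl u - algebraMap k _ c) := by
    have : cl u - algebraMap k _ c = -(cl u * (CliffordAlgebra.reverse (cl u) - 1)) := by
      rw [hcomm.eq, sub_mul, hN, one_mul, neg_sub]
    rw [this]
    exact (hcomm.isNilpotent_mul_left hr).neg
  have h3 : IsNilpotent (algebraMap k (Cliff k n) (c - 1)) := by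
    have h4 : algebraMap k (Cliff k n) (c - 1) = (cl u - 1) - (cl u - algebraMap k _ c) := by
      rw [map_sub, map_one]; abel
    rw [h4]
    refine Commute.isNilpotent_sub ?_ hu' h2
    exact ((Commute.refl (cl u)).sub_right (Algebra.commutes c (cl u)).symm).sub_left
      (Commute.one_left _)
  obtain ⟨m, hm⟩ := h3
  rw [← map_pow, map_eq_zero_iff _ algebraMap_cliff_injective] at hm
  exact sub_eq_zero.1 (eq_zero_of_pow_eq_zero hm)

end Jordan

section JordanParts

variable {k : Type*} [Field k] [CharZero k] {n : ℕ}

local notation "ιV" => CliffordAlgebra.ι (form k n)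

/-- Every element of the general spin group has a semisimple part in the group: the semisimple
part `a` of `x` in the even Clifford algebra again preserves the space of vectors, because
conjugation by `a` is the semisimple part of conjugation by `x`, hence a polynomial in it. -/
theorem exists_isSemisimplePart (x : GSpin k n) : ∃ s, IsSemisimplePart x s := by
  obtain ⟨N, hN, S, hS, hNnil, hSss, hsum⟩ :=
    Module.End.exists_isNilpotent_isSemisimple (f := LinearMap.mulLeft k (toEven x))
  have hpoly : ∀ T ∈ Algebra.adjoin k {LinearMap.mulLeft k (toEven x)},
      ∃ a : CliffEven k n, T = LinearMap.mulLeft k a := by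
    intro T hT
    rw [Algebra.adjoin_singleton_eq_range_aeval] at hT
    obtain ⟨p, rfl⟩ := hT
    refine ⟨Polynomial.aeval (toEven x) p, ?_⟩
    exact Polynomial.aeval_algHom_apply (Algebra.lmul k (CliffEven k n)) (toEven x) p
  have hcomm : Commute N S := by
    have h1 := Algebra.commute_of_mem_adjoin_singleton_of_commute hN
      (Commute.refl (LinearMap.mulLeft k (toEven x)))
    exact (Algebra.commute_of_mem_adjoin_singleton_of_commute hS h1.symm)
  obtain ⟨b, rfl⟩ := hpoly N hN
  obtain ⟨a, rfl⟩ := hpoly S hS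
  have hb : IsNilpotent b := by
    obtain ⟨m, hm⟩ := hNnil
    refine ⟨m, ?_⟩
    rw [LinearMap.pow_mulLeft] at hm
    simpa using LinearMap.congr_fun hm 1
  have hxab : toEven x = b + a := by simpa using LinearMap.congr_fun hsum 1
  have hba : Commute b a := by
    have h1 : b * (a * 1) = a * (b * 1) := LinearMap.congr_fun hcomm.eq 1
    rwa [mul_one, mul_one] at h1
  have hau : IsUnit a := by
    have hux : IsUnit (toEven x) := (x : (CliffEven k n)ˣ).isUnit
    have : a = toEven x + -b := by rw [hxab]; abel
    rw [this]
    refine IsNilpotent.isUnit_add_left_of_commute hb.neg hux ?_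
    rw [hxab]
    exact (((Commute.refl b).add_right hba).neg_left)
  obtain ⟨s, rfl⟩ := hau
  let u : (CliffEven k n)ˣ := s⁻¹ * (x : (CliffEven k n)ˣ)
  have hxsu : (x : (CliffEven k n)ˣ) = s * u := by simp [u]
  have hu1 : (u : CliffEven k n) - 1 = (↑s⁻¹ : CliffEven k n) * b := by
    have : (u : CliffEven k n) = (↑s⁻¹ : CliffEven k n) * toEven x := rfl
    rw [this, hxab, mul_add, Units.inv_mul]; abel
  have hsb : Commute (↑s⁻¹ : CliffEven k n) b := (Commute.units_inv_right hba).symm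
  have hunil : IsNilpotent ((u : CliffEven k n) - 1) := by
    rw [hu1]; exact hsb.isNilpotent_mul_left hb
  have hsu : Commute s u := by
    refine Units.ext ?_
    have h1 : Commute (s : CliffEven k n) (toEven x) := by
      rw [hxab]; exact (hba.symm).add_right (Commute.refl _)
    have h2 : Commute (s : CliffEven k n) ((↑s⁻¹ : CliffEven k n) * toEven x) :=
      (Commute.units_inv_right (Commute.refl (s : CliffEven k n))).mul_right h1
    exact h2
  have hcs := isSemisimple_evenConj hSss
  have hcu := isNilpotent_evenConj_sub_one hunil
  have hcsu : Commute (evenConj s) (evenConj u) := by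
    rw [Commute, SemiconjBy, ← evenConj_mul, ← evenConj_mul, hsu.eq]
  have hnil : IsNilpotent (evenConj s * (evenConj u - 1)) :=
    (hcsu.sub_right (Commute.one_right _)).isNilpotent_mul_left hcu
  have hdec : evenConj (x : (CliffEven k n)ˣ) = evenConj s * (evenConj u - 1) + evenConj s := by
    rw [hxsu, evenConj_mul, mul_sub, mul_one, sub_add_cancel]
  obtain ⟨N', hN', S', hS', hN'nil, hS'ss, hsum'⟩ :=
    (evenConj (x : (CliffEven k n)ˣ)).exists_isNilpotent_isSemisimple
  have hcomm' : Commute N' S' := by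
    have h1 := Algebra.commute_of_mem_adjoin_singleton_of_commute hN'
      (Commute.refl (evenConj (x : (CliffEven k n)ˣ)))
    exact (Algebra.commute_of_mem_adjoin_singleton_of_commute hS' h1.symm)
  have hcomm'' : Commute (evenConj s * (evenConj u - 1)) (evenConj s) :=
    (((Commute.refl (evenConj s)).mul_right
      (hcsu.sub_right (Commute.one_right _)))).symm
  have heq := (Module.End.isNilpotent_isSemisimple_unique hN'nil hS'ss hnil hcs hcomm' hcomm''
    (hsum'.symm.trans hdec)).2
  rw [heq, Algebra.adjoin_singleton_eq_range_aeval] at hS'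
  obtain ⟨p, hp⟩ := hS'
  have hvec : ∀ v, ∃ w, ((s : CliffEven k n) : Cliff k n) * ιV v =
      ιV w * ((s : CliffEven k n) : Cliff k n) := by
    intro v
    refine ⟨Polynomial.aeval (std k n x) p v, ?_⟩
    have hinv : ((↑s⁻¹ : CliffEven k n) : Cliff k n) * ((s : CliffEven k n) : Cliff k n) = 1 :=
      congrArg Subtype.val s.inv_mul
    have hp' : Polynomial.aeval (evenConj (x : (CliffEven k n)ˣ)) p = evenConj s := hp
    rw [ι_aeval_std, hp', evenConj_apply, mul_assoc, hinv, mul_one]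
  let sC : (Cliff k n)ˣ := s.map (CliffordAlgebra.even (form k n)).val.toMonoidHom
  let sG : GSpin k n := mkGSpin sC (s : CliffEven k n).2 (↑s⁻¹ : CliffEven k n).2 hvec
  have hsG : (sG : (CliffEven k n)ˣ) = s := Units.ext rfl
  refine ⟨sG, ?_, sG⁻¹ * x, ?_, ?_, (mul_inv_cancel_left _ _).symm⟩
  · exact hSss
  · have : toEven (sG⁻¹ * x) = (u : CliffEven k n) := by
      simp only [toEven, Subgroup.coe_mul, Subgroup.coe_inv, hsG]; rfl
    rw [IsUnipotentElt, this]
    exact hunil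
  · refine Subtype.ext ?_
    simp only [Subgroup.coe_mul, Subgroup.coe_inv, hsG]
    exact hsu.eq

theorem IsSemisimplePart.cliffTrace_eq {x s : GSpin k n} (h : IsSemisimplePart x s) :
    cliffTrace k n (cl x) = cliffTrace k n (cl s) := by
  obtain ⟨-, u, hu, hsu, rfl⟩ := h
  have hu' : IsNilpotent (cl u - 1) := by
    have := hu.map (CliffordAlgebra.even (form k n)).val
    rw [map_sub, map_one] at this
    exact this
  have hc : Commute (cl s) (cl u - 1) := by
    refine Commute.sub_right ?_ (Commute.one_right _)
    rw [Commute, SemiconjBy, ← cl_mul, ← cl_mul, hsu.eq]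
  have : cl (s * u) = cl s + cl s * (cl u - 1) := by rw [cl_mul, mul_sub, mul_one]; abel
  rw [this, map_add, cliffTrace_eq_zero_of_isNilpotent (hc.isNilpotent_mul_left hu'), add_zero]

theorem IsSemisimplePart.spinorNorm_eq {x s : GSpin k n} (h : IsSemisimplePart x s) :
    spinorNorm x = spinorNorm s := by
  obtain ⟨-, u, hu, -, rfl⟩ := h
  rw [spinorNorm_mul, spinorNorm_of_isUnipotentElt hu, mul_one]

theorem IsSemisimplePart.trace_std_eq {x s : GSpin k n} (h : IsSemisimplePart x s) :
    LinearMap.trace k _ (std k n x) = LinearMap.trace k _ (std k n s) := by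
  obtain ⟨-, u, hu, hsu, rfl⟩ := h
  have hc : Commute (std k n s) (std k n u - 1) := by
    refine Commute.sub_right ?_ (Commute.one_right _)
    rw [Commute, SemiconjBy, ← map_mul, ← map_mul, hsu.eq]
  have : std k n (s * u) = std k n s + std k n s * (std k n u - 1) := by
    rw [map_mul, mul_sub, mul_one]; abel
  rw [this, map_add, (LinearMap.isNilpotent_trace_of_isNilpotent
    (hc.isNilpotent_mul_left (isNilpotent_std_sub_one hu))).eq_zero, add_zero]

theorem IsSemisimplePart.hasEigenvalue_std {x s : GSpin k n} (h : IsSemisimplePart x s) {r : k}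
    (hx : Module.End.HasEigenvalue (std k n x) r) : Module.End.HasEigenvalue (std k n s) r := by
  obtain ⟨-, u, hu, hsu, rfl⟩ := h
  obtain ⟨v, hv⟩ := hx.exists_hasEigenvector
  obtain ⟨N, hN⟩ : ∃ N : Module.End k (Fin (2 * n + 1) → k), N = std k n u - 1 := ⟨_, rfl⟩
  have hnil : IsNilpotent N := hN ▸ isNilpotent_std_sub_one hu
  have hcomm : Commute (std k n (s * u)) N := by
    rw [hN]
    refine Commute.sub_right ?_ (Commute.one_right _)
    have h1 : Commute (s * u) u := hsu.mul_left (Commute.refl u)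
    exact h1.map (std k n)
  -- the last nonzero vector among `v, (u - 1) v, (u - 1)² v, …` is fixed by `u`
  classical
  have hex : ∃ m, (N ^ m) v = 0 := by
    obtain ⟨m, hm⟩ := hnil
    exact ⟨m, by rw [hm, LinearMap.zero_apply]⟩
  have hm := Nat.find_spec hex
  have hmin := fun j => Nat.find_min (m := j) hex
  set m := Nat.find hex
  obtain ⟨j, hj⟩ : ∃ j, m = j + 1 := by
    refine Nat.exists_eq_succ_of_ne_zero fun h0 => hv.2 ?_
    rw [h0] at hm
    exact hm
  have hw0 := hmin j (by omega)
  set w := (N ^ j) v with hw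
  have huw : std k n u w = w := by
    rw [hj, pow_succ', Module.End.mul_apply, ← hw, hN, LinearMap.sub_apply,
      Module.End.one_apply] at hm
    exact sub_eq_zero.1 hm
  refine Module.End.hasEigenvalue_of_hasEigenvector (x := w)
    ⟨Module.End.mem_eigenspace_iff.2 ?_, hw0⟩
  have h1 : std k n (s * u) w = r • w := by
    rw [hw, ← Module.End.mul_apply, (hcomm.pow_right j).eq, Module.End.mul_apply,
      hv.apply_eq_smul, map_smul]
  rwa [map_mul, Module.End.mul_apply, huw] at h1

/-- A semisimple element `s` with eigenvalue `-1` on the standard representation is conjugate to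
`-s`: the `-1`-eigenspace contains an anisotropic vector, whose conjugation maps `s` to `-s`. -/
theorem IsSemisimpleElt.isConj_neg {s : GSpin k n} (hs : IsSemisimpleElt s)
    (hev : Module.End.HasEigenvalue (std k n s) (-1)) : IsConj s (signs k n (-1) * s) := by
  set A : Module.End k (Fin (2 * n + 1) → k) := std k n s with hA
  obtain ⟨v, hv, hQ⟩ : ∃ v, A v = -v ∧ form k n v ≠ 0 := by
    by_contra! hiso
    obtain ⟨v, hv⟩ := hev.exists_hasEigenvector
    have hAv : A v = -v := by rw [hv.apply_eq_smul, neg_one_smul]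
    have hortho : ∀ w, A w = -w → bil k n v w = 0 := fun w hw => by
      have := form_add v w
      rw [hiso v hAv, hiso w hw, hiso (v + w) (by rw [map_add, hAv, hw, neg_add])] at this
      simpa using this.symm
    have hss := isSemisimple_std hs
    rw [Module.End.isSemisimple_iff] at hss
    obtain ⟨W, hW, hcompl⟩ := hss (LinearMap.ker (A + 1)) (by
      intro w hw
      have hw' : A w + w = 0 := hw
      change A (A w) + A w = 0
      rw [← map_add, hw', map_zero])
    -- the invariant complement of the eigenspace is the image of `A + 1`
    have hAW : ∀ w ∈ W, (A + 1) w ∈ W := fun w hw => W.add_mem (hW hw) hw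
    have hinj : Function.Injective ((A + 1).restrict hAW) := by
      rw [← LinearMap.ker_eq_bot, Submodule.eq_bot_iff]
      rintro ⟨w, hw⟩ h0
      have h0' : (A + 1) w = 0 := congrArg Subtype.val h0
      exact Subtype.ext ((Submodule.disjoint_def.1 hcompl.disjoint) w h0' hw)
    have hsurj := LinearMap.injective_iff_surjective.1 hinj
    apply hv.2
    refine eq_zero_of_bil_eq_zero fun w => ?_
    obtain ⟨a, ha, c, hc, rfl⟩ := Submodule.mem_sup.1
      (show w ∈ LinearMap.ker (A + 1) ⊔ W by rw [hcompl.sup_eq_top]; trivial)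
    obtain ⟨⟨d, hd⟩, hdc⟩ := hsurj ⟨c, hc⟩
    have hdc' : A d + d = c := congrArg Subtype.val hdc
    have h1 : bil k n v (A d) = -bil k n v d := by
      rw [← bil_std s v d, ← hA, hAv, map_neg, LinearMap.neg_apply, neg_neg]
    rw [map_add, hortho a (eq_neg_of_add_eq_zero_left ha), ← hdc', map_add, h1]
    simp
  obtain ⟨h, hh⟩ := exists_cl_conj_eq_ι_conj hQ
  refine isConj_iff.2 ⟨h, ?_⟩
  rw [mul_inv_eq_iff_eq_mul]
  apply cl_injective
  rw [cl_mul, cl_mul, cl_mul, cl_signs_neg_one, hh]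
  have := cl_mul_ι s v
  rw [← hA, hv, map_neg] at this
  rw [neg_one_mul, neg_mul, this, neg_mul, neg_neg]

theorem toEven_signs_mul (e : ℤˣ) (x : GSpin k n) :
    toEven (signs k n e * x) = ((e : ℤ) : k) • toEven x := by
  rw [toEven_mul, toEven_signs, Algebra.smul_def, map_intCast]

theorem IsSemisimplePart.signs_conj {x s : GSpin k n} (h : IsSemisimplePart x s) (e : ℤˣ)
    (g : GSpin k n) :
    IsSemisimplePart (signs k n e * (g * x * g⁻¹)) (signs k n e * (g * s * g⁻¹)) := by
  obtain ⟨hs, u, hu, hsu, rfl⟩ := h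
  refine ⟨?_, g * u * g⁻¹, ?_, ?_, ?_⟩
  · have h1 : LinearMap.mulLeft k (toEven (signs k n e * (g * s * g⁻¹))) =
        ((e : ℤ) : k) • LinearMap.mulLeft k (toEven (g * s * g⁻¹)) := by
      rw [toEven_signs_mul]; ext x; simp
    rw [IsSemisimpleElt, h1]
    refine Module.End.IsSemisimple_smul _ ?_
    let E : CliffEven k n ≃ₗ[k] CliffEven k n :=
      LinearEquiv.ofBijective (LinearMap.mulLeft k (toEven g))
        (Units.mulLeft_bijective (g : (CliffEven k n)ˣ))
    refine (LinearEquiv.isSemisimple_iff (f := LinearMap.mulLeft k (toEven s)) _ E ?_).1 hs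
    refine LinearMap.ext fun y => ?_
    have hE : ∀ y, E y = toEven g * y := fun y => rfl
    have hg : toEven g⁻¹ * toEven g = 1 := toEven_inv_mul g
    change E (toEven s * y) = toEven (g * s * g⁻¹) * E y
    rw [hE, hE, toEven_mul, toEven_mul, mul_assoc (toEven g * toEven s), ← mul_assoc (toEven g⁻¹),
      hg, one_mul, mul_assoc]
  · have h1 : toEven (g * u * g⁻¹) - 1 = toEven g * (toEven u - 1) * toEven g⁻¹ := by
      rw [toEven_mul, toEven_mul, mul_sub, sub_mul, mul_one, toEven_mul_inv]
    obtain ⟨m, hm⟩ := hu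
    refine ⟨m, ?_⟩
    have hpow : ∀ j : ℕ, (toEven g * (toEven u - 1) * toEven g⁻¹) ^ j =
        toEven g * (toEven u - 1) ^ j * toEven g⁻¹ := by
      intro j
      induction j with
      | zero => rw [pow_zero, pow_zero, mul_one, toEven_mul_inv]
      | succ j ih =>
        rw [pow_succ, ih, pow_succ]
        have hg : toEven g⁻¹ * toEven g = 1 := toEven_inv_mul g
        calc _ = toEven g * (toEven u - 1) ^ j * (toEven g⁻¹ * toEven g) * (toEven u - 1) *
            toEven g⁻¹ := by simp only [mul_assoc]
          _ = _ := by rw [hg, mul_one]; simp only [mul_assoc]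
    rw [h1, hpow, hm, mul_zero, zero_mul]
  · have h1 : Commute (g * s * g⁻¹) (g * u * g⁻¹) := by
      rw [Commute, SemiconjBy]
      simp only [← mul_assoc, inv_mul_cancel_right]
      rw [mul_assoc g s u, hsu.eq, mul_assoc g u s]
    exact Commute.mul_left (signs_mul_comm e _) h1
  · simp only [← mul_assoc, inv_mul_cancel_right]

end JordanParts

/-! ### Laurent polynomial families and weight decompositions -/

section Laurent

variable {k : Type*} [Field k] {W W' : Type*} [AddCommGroup W] [Module k W] [AddCommGroup W']
  [Module k W']

/-- The Laurent polynomial function `t ↦ ∑ t ^ m a_m` with vector coefficients. -/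
noncomputable def weightSum (a : ℤ →₀ W) (t : kˣ) : W := a.sum fun m w => ((t ^ m : kˣ) : k) • w

theorem map_weightSum (φ : W →ₗ[k] W') (a : ℤ →₀ W) (t : kˣ) :
    φ (weightSum a t) = weightSum (Finsupp.mapRange.linearMap φ a) t := by
  rw [weightSum, weightSum, map_finsuppSum, Finsupp.mapRange.linearMap_apply,
    Finsupp.sum_mapRange_index (by intro; simp)]
  simp only [map_smul]

theorem weightSum_single (m : ℤ) (w : W) (t : kˣ) :
    weightSum (Finsupp.single m w) t = ((t ^ m : kˣ) : k) • w :=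
  Finsupp.sum_single_index (by simp)

theorem weightSum_add (a b : ℤ →₀ W) (t : kˣ) :
    weightSum (a + b) t = weightSum a t + weightSum b t :=
  Finsupp.sum_add_index' (by simp) (by simp)

theorem weightSum_smul (r : k) (a : ℤ →₀ W) (t : kˣ) :
    weightSum (r • a) t = r • weightSum a t := by
  rw [weightSum, weightSum, Finsupp.sum_smul_index' (by simp), Finsupp.smul_sum]
  simp only [smul_comm r]

theorem weightSum_mapDomain {g : ℤ → ℤ} (hg : Function.Injective g) (a : ℤ →₀ W) (t : kˣ) :
    weightSum (a.mapDomain g) t = a.sum fun m w => ((t ^ g m : kˣ) : k) • w :=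
  Finsupp.sum_mapDomain_index_inj hg

/-- The functions on `kˣ` given by Laurent polynomials with exponents in `S`. -/
def laurent (k W : Type*) [Field k] [AddCommGroup W] [Module k W] (S : AddSubmonoid ℤ) :
    Submodule k (kˣ → W) :=
  Submodule.span k {g | ∃ m ∈ S, ∃ w : W, g = fun t => ((t ^ m : kˣ) : k) • w}

variable {S : AddSubmonoid ℤ}

theorem mem_laurent_iff {g : kˣ → W} : g ∈ laurent k W S ↔
    ∃ a : ℤ →₀ W, (∀ m ∉ S, a m = 0) ∧ ∀ t, g t = weightSum a t := by
  constructor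
  · intro hg
    induction hg using Submodule.span_induction with
    | mem g hg =>
      obtain ⟨m, hm, w, rfl⟩ := hg
      refine ⟨Finsupp.single m w, fun j hj => ?_, fun t => (weightSum_single _ _ _).symm⟩
      exact Finsupp.single_eq_of_ne (by rintro rfl; exact hj hm)
    | zero => exact ⟨0, by simp, by simp [weightSum]⟩
    | add g h _ _ hg hh =>
      obtain ⟨a, ha, ha'⟩ := hg
      obtain ⟨b, hb, hb'⟩ := hh
      refine ⟨a + b, fun m hm => by simp [ha m hm, hb m hm], fun t => ?_⟩
      rw [weightSum_add, Pi.add_apply, ha', hb']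
    | smul r g _ hg =>
      obtain ⟨a, ha, ha'⟩ := hg
      refine ⟨r • a, fun m hm => by simp [ha m hm], fun t => ?_⟩
      rw [weightSum_smul, Pi.smul_apply, ha']
  · rintro ⟨a, ha, ha'⟩
    have : g = ∑ m ∈ a.support, fun t => ((t ^ m : kˣ) : k) • a m := by
      funext t
      rw [ha', weightSum, Finsupp.sum, Finset.sum_apply]
    rw [this]
    refine Submodule.sum_mem _ fun m hm => Submodule.subset_span ⟨m, ?_, a m, rfl⟩
    by_contra h
    exact Finsupp.mem_support_iff.1 hm (ha m h)

theorem laurent_const (w : W) : (fun _ => w) ∈ laurent k W S :=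
  Submodule.subset_span ⟨0, S.zero_mem, w, by simp⟩

theorem laurent_zpow {m : ℤ} (hm : m ∈ S) (w : W) :
    (fun t : kˣ => ((t ^ m : kˣ) : k) • w) ∈ laurent k W S :=
  Submodule.subset_span ⟨m, hm, w, rfl⟩

theorem laurent_map (φ : W →ₗ[k] W') {g : kˣ → W} (hg : g ∈ laurent k W S) :
    (fun t => φ (g t)) ∈ laurent k W' S := by
  induction hg using Submodule.span_induction with
  | mem g hg =>
    obtain ⟨m, hm, w, rfl⟩ := hg
    simpa using laurent_zpow (k := k) hm (φ w)
  | zero =>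
    have : (fun t => φ ((0 : kˣ → W) t)) = 0 := by funext t; simp
    rw [this]
    exact Submodule.zero_mem _
  | add g h _ _ hg hh => simpa using! Submodule.add_mem _ hg hh
  | smul r g _ hg => simpa using! Submodule.smul_mem _ r hg

theorem laurent_mul {A : Type*} [Ring A] [Algebra k A] {g h : kˣ → A} (hg : g ∈ laurent k A S)
    (hh : h ∈ laurent k A S) : g * h ∈ laurent k A S := by
  have := Submodule.mul_mem_mul hg hh
  rw [laurent, Submodule.span_mul_span] at this
  refine Submodule.span_mono ?_ this
  rintro _ ⟨_, ⟨m, hm, a, rfl⟩, _, ⟨m', hm', b, rfl⟩, rfl⟩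
  refine ⟨m + m', S.add_mem hm hm', a * b, ?_⟩
  funext t
  simp [smul_smul, zpow_add, mul_comm]

variable [CharZero k]

theorem zpow_char_injective :
    Function.Injective fun m : ℤ => (Units.coeHom k).comp (zpowGroupHom m : kˣ →* kˣ) := by
  intro m m' h
  have h2 := DFunLike.congr_fun h (Units.mk0 (2 : k) two_ne_zero)
  simp only [MonoidHom.comp_apply, zpowGroupHom_apply, Units.coeHom_apply, Units.val_zpow_eq_zpow_val,
    Units.val_mk0] at h2
  have h3 : ((2 : ℚ) ^ m : ℚ) = 2 ^ m' := by
    have : (((2 : ℚ) ^ m : ℚ) : k) = ((2 ^ m' : ℚ) : k) := by push_cast; exact h2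
    exact_mod_cast this
  exact zpow_right_injective₀ (by norm_num) (by norm_num) h3

/-- The coefficients of a Laurent polynomial function are unique, because the characters
`t ↦ t ^ m` of `kˣ` are linearly independent. -/
theorem eq_zero_of_weightSum_eq_zero {a : ℤ →₀ W} (h : ∀ t : kˣ, weightSum a t = 0) : a = 0 := by
  have hli := (linearIndependent_monoidHom kˣ k).comp _ zpow_char_injective
  ext m
  rw [Finsupp.coe_zero, Pi.zero_apply, ← Module.forall_dual_apply_eq_zero_iff k]
  intro c
  have h0 : Finsupp.mapRange.linearMap c a = 0 := by
    refine (linearIndependent_iff.1 hli) _ ?_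
    funext t
    have := congrArg c (h t)
    rw [map_weightSum, map_zero, weightSum] at this
    rw [Finsupp.linearCombination_apply, Finsupp.sum, Finset.sum_apply]
    rw [Finsupp.sum] at this
    refine Eq.trans (Finset.sum_congr rfl fun j _ => ?_) this
    simp [mul_comm]
  simpa using DFunLike.congr_fun h0 m

theorem weightSum_injective {a b : ℤ →₀ W} (h : ∀ t : kˣ, weightSum a t = weightSum b t) :
    a = b := by
  rw [← sub_eq_zero]
  refine eq_zero_of_weightSum_eq_zero (k := k) fun t => ?_
  rw [sub_eq_add_neg, ← neg_one_smul k b, weightSum_add, weightSum_smul, h]; simp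

theorem coeff_mem_of_weightSum_mem (T : Submodule k W) {a : ℤ →₀ W}
    (h : ∀ t : kˣ, weightSum a t ∈ T) (m : ℤ) : a m ∈ T := by
  have : Finsupp.mapRange.linearMap T.mkQ a = 0 := by
    refine eq_zero_of_weightSum_eq_zero (k := k) fun t => ?_
    rw [← map_weightSum, Submodule.mkQ_apply, Submodule.Quotient.mk_eq_zero]
    exact h t
  simpa using DFunLike.congr_fun this m

/-- A Laurent monomial with exponent outside `S` is not a Laurent polynomial function with exponents
in `S`, unless its coefficient vanishes. -/
theorem eq_zero_of_zpow_mem_laurent {m : ℤ} (hm : m ∉ S) {w : W}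
    (h : (fun t : kˣ => ((t ^ m : kˣ) : k) • w) ∈ laurent k W S) : w = 0 := by
  obtain ⟨a, ha, ha'⟩ := mem_laurent_iff.1 h
  have : Finsupp.single m w = a :=
    weightSum_injective (k := k) fun t => by rw [weightSum_single, ← ha']
  rw [← Finsupp.single_eq_same (a := m) (b := w), this, ha m hm]

/-- The weight projections of a Laurent polynomial representation of `kˣ`: a family of mutually
orthogonal projections `P m` with `ρ t = ∑ t ^ m P m`. -/
structure IsWeightDecomposition (ρ : kˣ →* Module.End k W) (P : ℤ →₀ Module.End k W) : Prop where
  eq_weightSum : ∀ t, ρ t = weightSum P t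
  mul_eq : ∀ t m, ρ t * P m = ((t ^ m : kˣ) : k) • P m
  eq_mul : ∀ t m, P m * ρ t = ((t ^ m : kˣ) : k) • P m
  idem : ∀ m, P m * P m = P m
  ortho : ∀ m m', m ≠ m' → P m * P m' = 0

theorem exists_isWeightDecomposition (ρ : kˣ →* Module.End k W)
    (hρ : (fun t => ρ t) ∈ laurent k (Module.End k W) ⊤) : ∃ P, IsWeightDecomposition ρ P := by
  obtain ⟨P, -, hP⟩ := mem_laurent_iff.1 hρ
  have h1 : ∀ s m, ρ s * P m = ((s ^ m : kˣ) : k) • P m := by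
    intro s m
    have : Finsupp.mapRange.linearMap (LinearMap.mulLeft k (ρ s)) P =
        Finsupp.onFinset P.support (fun m => ((s ^ m : kˣ) : k) • P m) (by
          intro m hm; rw [Finsupp.mem_support_iff]; rintro h; exact hm (by rw [h, smul_zero])) := by
      refine weightSum_injective (k := k) fun t => ?_
      rw [← map_weightSum, ← hP, LinearMap.mulLeft_apply, ← map_mul, hP, weightSum, weightSum,
        Finsupp.onFinset_sum _ (by simp), Finsupp.sum]
      refine Finset.sum_congr rfl fun j _ => ?_
      rw [mul_zpow, Units.val_mul, mul_comm, mul_smul]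
    simpa using DFunLike.congr_fun this m
  have h2 : ∀ s m, P m * ρ s = ((s ^ m : kˣ) : k) • P m := by
    intro s m
    have : Finsupp.mapRange.linearMap (LinearMap.mulRight k (ρ s)) P =
        Finsupp.onFinset P.support (fun m => ((s ^ m : kˣ) : k) • P m) (by
          intro m hm; rw [Finsupp.mem_support_iff]; rintro h; exact hm (by rw [h, smul_zero])) := by
      refine weightSum_injective (k := k) fun t => ?_
      rw [← map_weightSum, ← hP, LinearMap.mulRight_apply, ← map_mul, hP, weightSum, weightSum,
        Finsupp.onFinset_sum _ (by simp), Finsupp.sum]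
      refine Finset.sum_congr rfl fun j _ => ?_
      rw [mul_zpow, Units.val_mul, mul_smul]
    simpa using DFunLike.congr_fun this m
  have h3 : ∀ m', Finsupp.mapRange.linearMap (LinearMap.mulRight k (P m')) P =
      Finsupp.single m' (P m') := by
    intro m'
    refine weightSum_injective (k := k) fun t => ?_
    rw [← map_weightSum, ← hP, weightSum_single, LinearMap.mulRight_apply, h1]
  refine ⟨P, hP, h1, h2, fun m => ?_, fun m m' hm => ?_⟩
  · simpa using DFunLike.congr_fun (h3 m) m
  · simpa [Finsupp.single_eq_of_ne hm] using DFunLike.congr_fun (h3 m') m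

namespace IsWeightDecomposition

variable {ρ : kˣ →* Module.End k W} {P : ℤ →₀ Module.End k W} (h : IsWeightDecomposition ρ P)
include h

theorem sum_eq_one : ∑ m ∈ P.support, P m = 1 := by
  have := h.eq_weightSum 1
  rw [map_one, weightSum, Finsupp.sum] at this
  simpa using this.symm

theorem apply_eq (t : kˣ) (w : W) : ρ t w = weightSum (P.mapRange (· w) rfl) t := by
  rw [h.eq_weightSum]
  exact map_weightSum (LinearMap.applyₗ w) P t

/-- The weight projections of the image of a vector under a map that shifts weights by `d`. -/
theorem proj_map_eq {W₂ : Type*} [AddCommGroup W₂] [Module k W₂] {ρ₂ : kˣ →* Module.End k W₂}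
    {P₂ : ℤ →₀ Module.End k W₂} (h₂ : IsWeightDecomposition ρ₂ P₂) (φ : W →ₗ[k] W₂) (d : ℤ)
    (hφ : ∀ t w, ρ₂ t (φ w) = ((t ^ d : kˣ) : k) • φ (ρ t w)) (m : ℤ) (w : W) :
    P₂ m (φ w) = φ (P (m - d) w) := by
  have : P₂.mapRange (· (φ w)) rfl =
      (Finsupp.mapRange.linearMap φ (P.mapRange (· w) rfl)).mapDomain (· + d) := by
    refine weightSum_injective (k := k) fun t => ?_
    rw [← h₂.apply_eq, hφ, h.apply_eq, map_weightSum, weightSum_mapDomain (add_left_injective d),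
      weightSum, Finsupp.smul_sum]
    refine Finsupp.sum_congr fun j _ => ?_
    rw [smul_smul, zpow_add, Units.val_mul, mul_comm]
  have h3 := DFunLike.congr_fun this m
  rw [Finsupp.mapRange_apply] at h3
  rw [h3]
  conv_lhs => rw [show m = (m - d) + d by ring]
  rw [Finsupp.mapDomain_apply (add_left_injective d)]
  simp

/-- Anything commuting with the representation commutes with the weight projections. -/
theorem commute_proj {A : Module.End k W} (hA : ∀ t, A * ρ t = ρ t * A) (m : ℤ) :
    A * P m = P m * A := by
  have : Finsupp.mapRange.linearMap (LinearMap.mulLeft k A) P =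
      Finsupp.mapRange.linearMap (LinearMap.mulRight k A) P := by
    refine weightSum_injective (k := k) fun t => ?_
    rw [← map_weightSum, ← map_weightSum, ← h.eq_weightSum]
    exact hA t
  simpa using DFunLike.congr_fun this m

end IsWeightDecomposition

end Laurent

/-! ### The differential of an algebraic representation -/

section Differential

variable {k : Type*} [NontriviallyNormedField k] [CharZero k] {n N : ℕ}

local notation "ιV" => CliffordAlgebra.ι (form k n)

/-- The curve `γ` in the general spin group passes through `1` at time `t₀` with velocity `Y`. The
curve of inverses is required to have velocity `-Y`. -/
structure IsTangent (γ : k → GSpin k n) (t₀ : k) (Y : CliffEven k n) : Prop where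
  eq_one : γ t₀ = 1
  deriv : ∀ c : CliffEven k n →ₗ[k] k, HasDerivAt (fun t => c (toEven (γ t))) (c Y) t₀
  deriv_inv : ∀ c : CliffEven k n →ₗ[k] k, HasDerivAt (fun t => c (toEven (γ t)⁻¹)) (-c Y) t₀

/-- A regular function has a differential at the identity, as a linear form on the even Clifford
algebra which computes the derivative along curves. -/
theorem exists_differential {ψ : GSpin k n → k} (hψ : ψ ∈ regularFunctions k n) :
    ∃ d : CliffEven k n →ₗ[k] k, ∀ (γ : k → GSpin k n) (t₀ : k) (Y : CliffEven k n),
      IsTangent γ t₀ Y → HasDerivAt (fun t => ψ (γ t)) (d Y) t₀ := by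
  induction hψ using Algebra.adjoin_induction with
  | mem ψ hψ =>
    rcases hψ with ⟨c, rfl⟩ | ⟨c, rfl⟩
    · exact ⟨c, fun γ t₀ Y h => h.deriv c⟩
    · exact ⟨-c, fun γ t₀ Y h => h.deriv_inv c⟩
  | algebraMap r => exact ⟨0, fun γ t₀ Y _ => hasDerivAt_const _ _⟩
  | add ψ φ _ _ hψ hφ =>
    obtain ⟨d, hd⟩ := hψ
    obtain ⟨d', hd'⟩ := hφ
    exact ⟨d + d', fun γ t₀ Y h => (hd γ t₀ Y h).add (hd' γ t₀ Y h)⟩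
  | mul ψ φ _ _ hψ hφ =>
    obtain ⟨d, hd⟩ := hψ
    obtain ⟨d', hd'⟩ := hφ
    refine ⟨φ 1 • d + ψ 1 • d', fun γ t₀ Y h => ?_⟩
    have := (hd γ t₀ Y h).mul (hd' γ t₀ Y h)
    rw [h.eq_one] at this
    refine this.congr_deriv ?_
    simp [mul_comm]

/-- The differential at the identity of an algebraic representation. -/
theorem exists_differential_rep {f : Representation k (GSpin k n) (Fin N → k)}
    (hf : IsAlgebraicRep f) : ∃ dF : CliffEven k n →ₗ[k] Module.End k (Fin N → k),
      ∀ (γ : k → GSpin k n) (t₀ : k) (Y : CliffEven k n), IsTangent γ t₀ Y →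
        ∀ L : Module.Dual k (Module.End k (Fin N → k)),
          HasDerivAt (fun t => L (f (γ t))) (L (dF Y)) t₀ := by
  choose d hd using fun i j => exists_differential (hf i j)
  let M : CliffEven k n →ₗ[k] Matrix (Fin N) (Fin N) k :=
    { toFun := fun Y => Matrix.of fun i j => d i j Y
      map_add' := fun X Y => by ext i j; simp
      map_smul' := fun r Y => by ext i j; simp }
  refine ⟨(Matrix.toLin' : _ ≃ₗ[k] _).toLinearMap ∘ₗ M, fun γ t₀ Y h L => ?_⟩
  have hL : ∀ A : Module.End k (Fin N → k), L A = ∑ i, ∑ j, L (Matrix.toLin' (Matrix.single i j 1)) *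
      A (Pi.single j 1) i := by
    intro A
    conv_lhs => rw [← Matrix.toLin'_toMatrix' A, Matrix.matrix_eq_sum_single (LinearMap.toMatrix' A)]
    simp only [map_sum]
    refine Finset.sum_congr rfl fun i _ => Finset.sum_congr rfl fun j _ => ?_
    rw [LinearMap.toMatrix'_apply, ← mul_one (A _ i), ← smul_eq_mul (A _ i),
      ← Matrix.smul_single, map_smul, map_smul, smul_eq_mul, smul_eq_mul, mul_one, mul_comm]
  have h1 : (fun t => L (f (γ t))) = fun t => ∑ i, ∑ j,
      L (Matrix.toLin' (Matrix.single i j 1)) * f (γ t) (Pi.single j 1) i := by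
    funext t; exact hL _
  rw [h1, hL]
  refine HasDerivAt.fun_sum fun i _ => HasDerivAt.fun_sum fun j _ => ?_
  have := (hd i j γ t₀ Y h).const_mul (L (Matrix.toLin' (Matrix.single i j 1)))
  refine this.congr_deriv ?_
  simp [M]

/-- The product of two vectors as an element of the even Clifford algebra. -/
noncomputable def evenMul : (Fin (2 * n + 1) → k) →ₗ[k] (Fin (2 * n + 1) → k) →ₗ[k] CliffEven k n :=
  (CliffordAlgebra.even.ι (form k n)).bilin

theorem evenMul_add_swap (a b : Fin (2 * n + 1) → k) :
    evenMul a b + evenMul b a = bil k n a b • (1 : CliffEven k n) := by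
  refine Subtype.ext ?_
  change ιV a * ιV b + ιV b * ιV a = bil k n a b • (1 : Cliff k n)
  rw [ι_mul_add_swap, Algebra.algebraMap_eq_smul_one]

theorem evenMul_std (x : GSpin k n) (a b : Fin (2 * n + 1) → k) :
    evenMul (std k n x a) (std k n x b) = toEven x * evenMul a b * toEven x⁻¹ := by
  refine Subtype.ext ?_
  change ιV (std k n x a) * ιV (std k n x b) = cl x * (ιV a * ιV b) * cl x⁻¹
  rw [ι_std, ι_std]
  calc _ = cl x * ιV a * (cl x⁻¹ * cl x) * ιV b * cl x⁻¹ := by simp only [mul_assoc]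
    _ = _ := by rw [cl_inv_mul, mul_one]; simp only [mul_assoc]

/-- If `a` is anisotropic, then `Q(a)⁻¹ a b` is the velocity of the curve `t ↦ Q(a)⁻¹ a (a + t b)`. -/
theorem exists_isTangent_evenMul {a : Fin (2 * n + 1) → k} (ha : form k n a ≠ 0)
    (b : Fin (2 * n + 1) → k) :
    ∃ γ : k → GSpin k n, IsTangent γ 0 ((form k n a)⁻¹ • evenMul a b) := by
  classical
  let q : k → k := fun t => form k n a + t * bil k n a b + t * t * form k n b
  have hq : ∀ t, form k n (a + t • b) = q t := fun t => by
    simp only [q]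
    rw [form_add, QuadraticMap.map_smul, map_smul, smul_eq_mul, smul_eq_mul]; ring
  have hq0 : q 0 = form k n a := by simp [q]
  have hqd : HasDerivAt q (bil k n a b) 0 := by
    have h1 : HasDerivAt (fun t : k => t) 1 0 := hasDerivAt_id 0
    have h2 := (((h1.mul_const (bil k n a b)).const_add (form k n a)).add
      ((h1.mul h1).mul_const (form k n b)))
    refine h2.congr_deriv ?_
    simp
  have hev : ∀ᶠ t in nhds (0 : k), q t ≠ 0 :=
    hqd.continuousAt.eventually_ne (by rw [hq0]; exact ha)
  refine ⟨fun t => if h : form k n (a + t • b) ≠ 0 then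
    pair a (a + t • b) ha h * (pair a a ha ha)⁻¹ else 1, ?_, fun c => ?_, fun c => ?_⟩
  · have h : form k n (a + (0 : k) • b) ≠ 0 := by simpa using ha
    rw [dif_pos h]
    have : pair a (a + (0 : k) • b) ha h = pair a a ha ha := by
      apply cl_injective
      rw [cl_pair, cl_pair, zero_smul, add_zero]
    rw [this, mul_inv_cancel]
  · have h1 : HasDerivAt (fun t : k => c 1 + t * c ((form k n a)⁻¹ • evenMul a b))
        (c ((form k n a)⁻¹ • evenMul a b)) 0 := by
      simpa using! ((hasDerivAt_id (0 : k)).mul_const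
        (c ((form k n a)⁻¹ • evenMul a b))).const_add (c 1)
    refine h1.congr_of_eventuallyEq ?_
    filter_upwards [hev] with t ht
    have h : form k n (a + t • b) ≠ 0 := by rwa [hq]
    rw [dif_pos h]
    suffices e : toEven (pair a (a + t • b) ha h * (pair a a ha ha)⁻¹) =
        1 + t • ((form k n a)⁻¹ • evenMul a b) by
      rw [e, map_add, map_smul c t, smul_eq_mul]
    refine Subtype.ext ?_
    change cl _ * cl _ = 1 + t • (form k n a)⁻¹ • (ιV a * ιV b)
    rw [cl_pair, cl_pair_inv, smul_mul_smul_comm, ι_mul_self, Algebra.algebraMap_eq_smul_one,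
      smul_smul, mul_smul_comm, mul_one, map_add, map_smul, mul_add, ι_mul_self, mul_smul_comm,
      Algebra.algebraMap_eq_smul_one, smul_add, smul_smul, smul_smul, smul_smul]
    congr 1
    · rw [show (form k n a)⁻¹ * (form k n a)⁻¹ * form k n a * form k n a = 1 by field_simp, one_smul]
    · congr 1; field_simp
  · have h1 : HasDerivAt (fun t : k => (q t)⁻¹ * (form k n a * c 1 + t * c (evenMul b a)))
        (-c ((form k n a)⁻¹ • evenMul a b)) 0 := by
      have h2 := (hqd.fun_inv (by rw [hq0]; exact ha)).mul (((hasDerivAt_id (0 : k)).mul_const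
        (c (evenMul b a))).const_add (form k n a * c 1))
      refine h2.congr_deriv ?_
      have h3 : c (evenMul a b) + c (evenMul b a) = bil k n a b * c 1 := by
        rw [← map_add, evenMul_add_swap, map_smul, smul_eq_mul]
      rw [hq0, map_smul, smul_eq_mul, eq_sub_of_add_eq h3]
      simp only [id, zero_mul, add_zero, one_mul]
      field_simp
      ring
    refine h1.congr_of_eventuallyEq ?_
    filter_upwards [hev] with t ht
    have h : form k n (a + t • b) ≠ 0 := by rwa [hq]
    rw [dif_pos h]
    suffices e : toEven (pair a (a + t • b) ha h * (pair a a ha ha)⁻¹)⁻¹ =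
        (q t)⁻¹ • (form k n a • (1 : CliffEven k n) + t • evenMul b a) by
      rw [e, map_smul, map_add, map_smul, map_smul, smul_eq_mul, smul_eq_mul, smul_eq_mul]
    refine Subtype.ext ?_
    rw [mul_inv_rev, inv_inv]
    change cl _ * cl _ = (q t)⁻¹ • (form k n a • (1 : Cliff k n) + t • (ιV b * ιV a))
    rw [cl_pair, cl_pair_inv, ι_mul_self, hq, ← Algebra.smul_def, smul_mul_smul_comm, smul_smul,
      map_add, add_mul, ι_mul_self, map_smul, smul_mul_assoc, Algebra.algebraMap_eq_smul_one]
    congr 1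
    field_simp

theorem IsTangent.conj {γ : k → GSpin k n} {t₀ : k} {Y : CliffEven k n} (h : IsTangent γ t₀ Y)
    (x : GSpin k n) :
    IsTangent (fun t => x * γ t * x⁻¹) t₀ (toEven x * Y * toEven x⁻¹) := by
  refine ⟨by rw [h.eq_one, mul_one, mul_inv_cancel], fun c => ?_, fun c => ?_⟩
  · exact h.deriv (c ∘ₗ LinearMap.mulLeftRight k (toEven x, toEven x⁻¹)) |>.congr_deriv
      (by simp) |>.congr_of_eventuallyEq (Filter.Eventually.of_forall fun t => by
        simp [toEven_mul])
  · refine h.deriv_inv (c ∘ₗ LinearMap.mulLeftRight k (toEven x, toEven x⁻¹)) |>.congr_deriv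
      (by simp) |>.congr_of_eventuallyEq (Filter.Eventually.of_forall fun t => ?_)
    change c (toEven (x * γ t * x⁻¹)⁻¹) = _
    rw [mul_inv_rev, mul_inv_rev, inv_inv, ← mul_assoc, toEven_mul, toEven_mul]
    simp

/-- The differential of a representation is equivariant on products of two vectors. -/
theorem differential_evenMul_std {f : Representation k (GSpin k n) (Fin N → k)}
    {dF : CliffEven k n →ₗ[k] Module.End k (Fin N → k)}
    (hdF : ∀ (γ : k → GSpin k n) (t₀ : k) (Y : CliffEven k n), IsTangent γ t₀ Y →
      ∀ L : Module.Dual k (Module.End k (Fin N → k)),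
        HasDerivAt (fun t => L (f (γ t))) (L (dF Y)) t₀)
    (x : GSpin k n) (a b : Fin (2 * n + 1) → k) :
    dF (evenMul (std k n x a) (std k n x b)) = f x * dF (evenMul a b) * f x⁻¹ := by
  have ha : a ∈ Submodule.span k {v | form k n v ≠ 0} := by rw [span_anisotropic]; trivial
  induction ha using Submodule.span_induction with
  | mem a ha =>
    obtain ⟨γ, hγ⟩ := exists_isTangent_evenMul ha b
    have h1 : dF (toEven x * ((form k n a)⁻¹ • evenMul a b) * toEven x⁻¹) =
        f x * dF ((form k n a)⁻¹ • evenMul a b) * f x⁻¹ := by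
      rw [← sub_eq_zero, ← Module.forall_dual_apply_eq_zero_iff k]
      intro L
      rw [map_sub, sub_eq_zero]
      refine (hdF _ _ _ (hγ.conj x) L).unique ?_
      have := hdF _ _ _ hγ (L ∘ₗ LinearMap.mulLeftRight k (f x, f x⁻¹))
      simpa [map_mul] using! this
    rw [mul_smul_comm, smul_mul_assoc, map_smul, map_smul, mul_smul_comm, smul_mul_assoc,
      ← evenMul_std] at h1
    exact smul_right_injective _ (inv_ne_zero ha) h1
  | zero => simp
  | add a a' _ _ h h' =>
    simp only [map_add, LinearMap.add_apply, h, h', mul_add, add_mul]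
  | smul r a _ h =>
    simp only [map_smul, LinearMap.smul_apply, h, mul_smul_comm, smul_mul_assoc]

end Differential

/-! ### The cocharacter attached to a totally isotropic subspace -/

section Cocharacter

variable {k : Type*} [NontriviallyNormedField k] [CharZero k] {n : ℕ} {I : Type*} [DecidableEq I]

local notation "ιV" => CliffordAlgebra.ι (form k n)

theorem IsTangent.mul {γ δ : k → GSpin k n} {t₀ : k} {Y Z : CliffEven k n}
    (hγ : IsTangent γ t₀ Y) (hδ : IsTangent δ t₀ Z) :
    IsTangent (fun t => γ t * δ t) t₀ (Y + Z) := by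
  -- the product rule for the multiplication of the even Clifford algebra, in coordinates
  have key : ∀ (a b : k → CliffEven k n) (A B : CliffEven k n), a t₀ = 1 → b t₀ = 1 →
      (∀ c : CliffEven k n →ₗ[k] k, HasDerivAt (fun t => c (a t)) (c A) t₀) →
      (∀ c : CliffEven k n →ₗ[k] k, HasDerivAt (fun t => c (b t)) (c B) t₀) →
      ∀ c : CliffEven k n →ₗ[k] k, HasDerivAt (fun t => c (a t * b t)) (c (A + B)) t₀ := by
    intro a b A B ha hb hA hB c
    have β := Module.finBasis k (CliffEven k n)
    have hc : ∀ x y : CliffEven k n, c (x * y) = ∑ i, β.coord i x * c (β i * y) := by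
      intro x y
      conv_lhs => rw [← β.sum_repr x, Finset.sum_mul, map_sum]
      exact Finset.sum_congr rfl fun i _ => by
        rw [smul_mul_assoc, map_smul, smul_eq_mul]; rfl
    have h1 : (fun t => c (a t * b t)) = fun t => ∑ i, β.coord i (a t) * c (β i * b t) := by
      funext t; exact hc _ _
    rw [h1]
    have h2 : ∀ i, HasDerivAt (fun t => c (β i * b t)) (c (β i * B)) t₀ := fun i =>
      hB (c ∘ₗ LinearMap.mulLeft k (β i))
    refine (HasDerivAt.fun_sum fun i _ => (hA (β.coord i)).mul (h2 i)).congr_deriv ?_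
    rw [Finset.sum_add_distrib, ha, hb, ← hc, ← hc, mul_one, one_mul, map_add]
  refine ⟨by rw [hγ.eq_one, hδ.eq_one, mul_one], fun c => ?_, fun c => ?_⟩
  · exact key _ _ _ _ (by rw [hγ.eq_one, toEven_one]) (by rw [hδ.eq_one, toEven_one])
      hγ.deriv hδ.deriv c
  · have := key (fun t => toEven (δ t)⁻¹) (fun t => toEven (γ t)⁻¹) (-Z) (-Y)
      (by rw [hδ.eq_one, inv_one, toEven_one]) (by rw [hγ.eq_one, inv_one, toEven_one])
      (fun c => by rw [map_neg]; exact hδ.deriv_inv c)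
      (fun c => by rw [map_neg]; exact hγ.deriv_inv c) c
    refine (this.congr_deriv (by rw [← neg_add_rev, map_neg])).congr_of_eventuallyEq
      (Filter.Eventually.of_forall fun t => ?_)
    change c (toEven (γ t * δ t)⁻¹) = _
    rw [mul_inv_rev, toEven_mul]

/-- Two dual families of isotropic vectors: the bases of two totally isotropic subspaces in duality. -/
structure IsHyperbolic (e f : I → Fin (2 * n + 1) → k) : Prop where
  left : ∀ i j, bil k n (e i) (e j) = 0
  right : ∀ i j, bil k n (f i) (f j) = 0
  dual : ∀ i j, bil k n (e i) (f j) = if i = j then 1 else 0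

open Classical in
/-- The curve in the general spin group underlying a cocharacter (with the junk value `1` at `0`). -/
noncomputable def curve (μ : kˣ →* GSpin k n) (t : k) : GSpin k n :=
  if h : t = 0 then 1 else μ (Units.mk0 t h)

/-- The cocharacter `μ` acts with weight `2` on `e i` and with weight `-2` on `f i`, for `i ∈ s`, and
trivially on the vectors orthogonal to these. -/
structure IsCocharacterOn (e f : I → Fin (2 * n + 1) → k) (s : Finset I) (μ : kˣ →* GSpin k n) :
    Prop where
  std_left : ∀ i ∈ s, ∀ t, std k n (μ t) (e i) = ((t ^ (2 : ℤ) : kˣ) : k) • e i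
  std_right : ∀ i ∈ s, ∀ t, std k n (μ t) (f i) = ((t ^ (-2 : ℤ) : kˣ) : k) • f i
  std_orthogonal : ∀ v, (∀ i ∈ s, bil k n (e i) v = 0 ∧ bil k n (f i) v = 0) →
    ∀ t, std k n (μ t) v = v
  mem_laurent : (fun t => toEven (μ t)) ∈ laurent k (CliffEven k n) ⊤
  isTangent : IsTangent (curve μ) 1 (∑ i ∈ s, (evenMul (e i) (f i) - evenMul (f i) (e i)))

section Single

variable {e f : Fin (2 * n + 1) → k}

theorem isotropic_of_bil_self {v : Fin (2 * n + 1) → k} (h : bil k n v v = 0) : ιV v * ιV v = 0 := by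
  rw [bil_self] at h
  rw [ι_mul_self, (mul_eq_zero.1 h).resolve_left two_ne_zero, map_zero]

/-- The two complementary idempotents `e f` and `f e` given by a hyperbolic pair. -/
theorem hyperbolic_relations (he : bil k n e e = 0) (hf : bil k n f f = 0) (hef : bil k n e f = 1) :
    ιV e * ιV f * ιV e = ιV e ∧ ιV f * ιV e * ιV f = ιV f := by
  have h1 := ι_mul_add_swap (k := k) e f
  rw [hef, map_one] at h1
  constructor
  · rw [mul_assoc, eq_sub_of_add_eq' h1]
    simp [mul_sub, ← mul_assoc, isotropic_of_bil_self he]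
  · rw [mul_assoc, eq_sub_of_add_eq h1]
    simp [mul_sub, ← mul_assoc, isotropic_of_bil_self hf]

/-- The cocharacter `t ↦ t e f + t⁻¹ f e` of a hyperbolic pair: `e f` and `f e` are complementary
idempotents of the Clifford algebra. -/
theorem exists_isCocharacter_single (he : bil k n e e = 0) (hf : bil k n f f = 0)
    (hef : bil k n e f = 1) :
    ∃ μ : kˣ →* GSpin k n, (∀ t, toEven (μ t) =
        ((t : kˣ) : k) • evenMul e f + ((t⁻¹ : kˣ) : k) • evenMul f e) ∧
      (∀ t, std k n (μ t) e = ((t ^ (2 : ℤ) : kˣ) : k) • e) ∧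
      (∀ t, std k n (μ t) f = ((t ^ (-2 : ℤ) : kˣ) : k) • f) ∧
      (∀ v, bil k n e v = 0 → bil k n f v = 0 → ∀ t, std k n (μ t) v = v) := by
  have hQe : form k n e = 0 := by
    rw [bil_self] at he; exact (mul_eq_zero.1 he).resolve_left two_ne_zero
  have hQf : form k n f = 0 := by
    rw [bil_self] at hf; exact (mul_eq_zero.1 hf).resolve_left two_ne_zero
  have hQ : ∀ t : kˣ, form k n ((t : k) • e + ((t⁻¹ : kˣ) : k) • f) = 1 := fun t => by
    rw [form_add, QuadraticMap.map_smul, QuadraticMap.map_smul, hQe, hQf, map_smul, map_smul,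
      LinearMap.smul_apply, hef]
    simp
  have hne : ∀ t : kˣ, form k n ((t : k) • e + ((t⁻¹ : kˣ) : k) • f) ≠ 0 := fun t => by
    rw [hQ]; exact one_ne_zero
  have hE := isotropic_of_bil_self he
  have hF := isotropic_of_bil_self hf
  obtain ⟨hefe, hfef⟩ := hyperbolic_relations he hf hef
  have hpq := ι_mul_add_swap (k := k) e f
  rw [hef, map_one] at hpq
  have hcl : ∀ t, cl (pair _ _ (hne t) (hne 1)) =
      (t : k) • (ιV e * ιV f) + ((t⁻¹ : kˣ) : k) • (ιV f * ιV e) := fun t => by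
    rw [cl_pair]
    simp [add_mul, mul_add, hE, hF]
    abel
  let μ : kˣ →* GSpin k n :=
    { toFun := fun t => pair _ _ (hne t) (hne 1)
      map_one' := by
        apply cl_injective
        rw [hcl, cl_one, ← hpq]; simp
      map_mul' := fun s t => by
        apply cl_injective
        rw [cl_mul, hcl, hcl, hcl]
        have h1 : ιV e * ιV f * (ιV e * ιV f) = ιV e * ιV f := by rw [← mul_assoc, hefe]
        have h2 : ιV f * ιV e * (ιV f * ιV e) = ιV f * ιV e := by rw [← mul_assoc, hfef]
        have h3 : ιV e * ιV f * (ιV f * ιV e) = 0 := by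
          rw [mul_assoc, ← mul_assoc (ιV f), hF]; simp
        have h4 : ιV f * ιV e * (ιV e * ιV f) = 0 := by
          rw [mul_assoc, ← mul_assoc (ιV e), hE]; simp
        simp only [add_mul, mul_add, smul_mul_smul_comm, h1, h2, h3, h4, smul_zero, add_zero,
          zero_add, mul_inv, Units.val_mul] }
  have hμ : ∀ t, cl (μ t) = (t : k) • (ιV e * ιV f) + ((t⁻¹ : kˣ) : k) • (ιV f * ιV e) := hcl
  refine ⟨μ, fun t => Subtype.ext (hμ t), fun t => ?_, fun t => ?_, fun v hev hfv t => ?_⟩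
  · apply std_eq_of_cl_mul_ι
    rw [hμ, add_mul, map_smul, smul_mul_assoc, smul_mul_assoc, hefe, mul_assoc, hE, mul_zero,
      smul_zero, add_zero, smul_mul_assoc, mul_add, mul_smul_comm, mul_smul_comm, ← mul_assoc,
      ← mul_assoc, hE, hefe, zero_mul, smul_zero, zero_add, smul_smul, ← Units.val_mul]
    congr 2
    rw [zpow_two, mul_assoc, mul_inv_cancel, mul_one]
  · apply std_eq_of_cl_mul_ι
    rw [hμ, add_mul, map_smul, smul_mul_assoc, smul_mul_assoc, hfef, mul_assoc, hF, mul_zero,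
      smul_zero, zero_add, smul_mul_assoc, mul_add, mul_smul_comm, mul_smul_comm, ← mul_assoc,
      ← mul_assoc, hF, hfef, zero_mul, smul_zero, add_zero, smul_smul, ← Units.val_mul]
    congr 2
    rw [zpow_neg, zpow_two, mul_inv, mul_assoc, inv_mul_cancel, mul_one]
  · apply std_eq_of_cl_mul_ι
    have h1 := ι_anticomm hev
    have h2 := ι_anticomm hfv
    have h3 : Commute (ιV e * ιV f) (ιV v) := by
      change _ * _ = _ * _
      rw [mul_assoc, h2, mul_neg, ← mul_assoc, h1, neg_mul, neg_neg, mul_assoc]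
    have h4 : Commute (ιV f * ιV e) (ιV v) := by
      change _ * _ = _ * _
      rw [mul_assoc, h1, mul_neg, ← mul_assoc, h2, neg_mul, neg_neg, mul_assoc]
    rw [hμ]
    exact (Commute.add_left (h3.smul_left _) (h4.smul_left _)).eq

end Single

theorem laurent_inv {W : Type*} [AddCommGroup W] [Module k W] {g : kˣ → W}
    (hg : g ∈ laurent k W ⊤) : (fun t => g t⁻¹) ∈ laurent k W ⊤ := by
  induction hg using Submodule.span_induction with
  | mem g hg =>
    obtain ⟨m, hm, w, rfl⟩ := hg
    have := laurent_zpow (k := k) (S := ⊤) (m := -m) trivial w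
    simpa using! this
  | zero => exact Submodule.zero_mem _
  | add g h _ _ hg hh => exact Submodule.add_mem _ hg hh
  | smul r g _ hg => exact Submodule.smul_mem _ r hg

theorem curve_eq_mul {μ ν ξ : kˣ →* GSpin k n} (h : ∀ t, ξ t = μ t * ν t) :
    curve ξ = fun t => curve μ t * curve ν t := by
  funext t
  by_cases ht : t = 0
  · simp only [curve, dif_pos ht, mul_one]
  · simp only [curve, dif_neg ht]; exact h _

theorem isTangent_of_hyperbolic {ν : kˣ →* GSpin k n} {p q : CliffEven k n}
    (hν : ∀ t, toEven (ν t) = ((t : kˣ) : k) • p + ((t⁻¹ : kˣ) : k) • q) :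
    IsTangent (curve ν) 1 (p - q) := by
  have hev : ∀ᶠ t in nhds (1 : k), t ≠ 0 := continuousAt_id.eventually_ne one_ne_zero
  have key : ∀ a b : k, HasDerivAt (fun t : k => t * a + t⁻¹ * b) (a - b) 1 := by
    intro a b
    refine (((hasDerivAt_id (1 : k)).mul_const a).add
      ((hasDerivAt_inv one_ne_zero).mul_const b)).congr_deriv ?_
    simp [sub_eq_add_neg]
  refine ⟨?_, fun c => ?_, fun c => ?_⟩
  · rw [curve, dif_neg one_ne_zero, Units.mk0_one, map_one]
  · rw [map_sub]
    refine (key _ _).congr_of_eventuallyEq ?_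
    filter_upwards [hev] with t ht
    rw [curve, dif_neg ht, hν, map_add, map_smul, map_smul, Units.val_inv_eq_inv_val]
    rfl
  · rw [map_sub, neg_sub]
    refine (key _ _).congr_of_eventuallyEq ?_
    filter_upwards [hev] with t ht
    rw [curve, dif_neg ht, ← map_inv, hν, map_add, map_smul, map_smul, add_comm (_ • c p), inv_inv,
      Units.val_inv_eq_inv_val]
    rfl

/-- A pair of dual totally isotropic families defines a cocharacter of the general spin group. -/
theorem IsHyperbolic.exists_isCocharacterOn {e f : I → Fin (2 * n + 1) → k} (h : IsHyperbolic e f)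
    (s : Finset I) : ∃ μ, IsCocharacterOn e f s μ := by
  induction s using Finset.induction_on with
  | empty =>
    refine ⟨1, by simp, by simp, by simp, laurent_const _, ?_⟩
    have : curve (1 : kˣ →* GSpin k n) = fun _ => 1 := by
      funext t; by_cases ht : t = 0 <;> simp [curve, ht]
    rw [this]
    exact ⟨rfl, fun c => by simpa using! hasDerivAt_const _ _,
      fun c => by simpa using! hasDerivAt_const _ _⟩
  | insert j s hj ih =>
    obtain ⟨μ, hμ⟩ := ih
    obtain ⟨ν, hν, hνe, hνf, hνo⟩ := exists_isCocharacter_single (h.left j j) (h.right j j)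
      (by rw [h.dual, if_pos rfl])
    have hfix : ∀ t, std k n (μ t) (e j) = e j ∧ std k n (μ t) (f j) = f j := fun t =>
      ⟨hμ.std_orthogonal _ (fun i hi => ⟨h.left i j, by
          rw [bil_comm, h.dual, if_neg (by rintro rfl; exact hj hi)]⟩) t,
        hμ.std_orthogonal _ (fun i hi => ⟨by
          rw [h.dual, if_neg (by rintro rfl; exact hj hi)], h.right i j⟩) t⟩
    have hcomm : ∀ s t, Commute (μ s) (ν t) := fun s t => by
      apply cl_injective
      rw [cl_mul, cl_mul]
      have h1 : Commute (cl (μ s)) (ιV (e j)) := by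
        change _ * _ = _ * _
        rw [cl_mul_ι, (hfix s).1]
      have h2 : Commute (cl (μ s)) (ιV (f j)) := by
        change _ * _ = _ * _
        rw [cl_mul_ι, (hfix s).2]
      have h3 : cl (ν t) = ((t : kˣ) : k) • (ιV (e j) * ιV (f j)) +
          ((t⁻¹ : kˣ) : k) • (ιV (f j) * ιV (e j)) := congrArg Subtype.val (hν t)
      rw [h3]
      exact (((h1.mul_right h2).smul_right _).add_right ((h2.mul_right h1).smul_right _)).eq
    obtain ⟨ξ, hξ'⟩ : ∃ ξ : kˣ →* GSpin k n, ∀ t, ξ t = μ t * ν t :=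
      ⟨{ toFun := fun t => μ t * ν t
         map_one' := by rw [map_one, map_one, mul_one]
         map_mul' := fun s t => by
          rw [map_mul, map_mul, mul_assoc, mul_assoc, ← mul_assoc (μ t), (hcomm t s).eq,
            mul_assoc] }, fun t => rfl⟩
    have hξ : ∀ t v, std k n (ξ t) v = std k n (μ t) (std k n (ν t) v) := fun t v => by
      rw [hξ', map_mul]; rfl
    have hνs : ∀ i ∈ s, ∀ t, std k n (ν t) (e i) = e i ∧ std k n (ν t) (f i) = f i := by
      intro i hi t
      have hne : i ≠ j := by rintro rfl; exact hj hi
      exact ⟨hνo _ (h.left _ _) (by rw [bil_comm, h.dual, if_neg hne]) t,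
        hνo _ (by rw [h.dual, if_neg hne.symm]) (h.right _ _) t⟩
    refine ⟨ξ, fun i hi t => ?_, fun i hi t => ?_, fun v hv t => ?_, ?_, ?_⟩
    · rw [hξ]
      rcases Finset.mem_insert.1 hi with rfl | hi
      · rw [hνe, map_smul, (hfix t).1]
      · rw [(hνs i hi t).1, hμ.std_left i hi]
    · rw [hξ]
      rcases Finset.mem_insert.1 hi with rfl | hi
      · rw [hνf, map_smul, (hfix t).2]
      · rw [(hνs i hi t).2, hμ.std_right i hi]
    · rw [hξ, hνo v (hv j (Finset.mem_insert_self _ _)).1 (hv j (Finset.mem_insert_self _ _)).2,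
        hμ.std_orthogonal v fun i hi => hv i (Finset.mem_insert_of_mem hi)]
    · have hmul : (fun t => toEven (ξ t)) = (fun t => toEven (μ t)) * fun t => toEven (ν t) := by
        funext t; rw [hξ']; rfl
      rw [hmul]
      refine laurent_mul hμ.mem_laurent ?_
      have h1 := laurent_zpow (k := k) (S := ⊤) (m := 1) trivial (evenMul (e j) (f j))
      have h2 := laurent_zpow (k := k) (S := ⊤) (m := -1) trivial (evenMul (f j) (e j))
      have := Submodule.add_mem _ h1 h2
      refine (congrArg (· ∈ laurent k (CliffEven k n) ⊤) ?_).mp this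
      funext t
      rw [hν, Pi.add_apply, zpow_one, zpow_neg_one]
    · have hνt := isTangent_of_hyperbolic hν
      rw [curve_eq_mul hξ', Finset.sum_insert hj,
        add_comm (evenMul (e j) (f j) - evenMul (f j) (e j))]
      exact hμ.isTangent.mul hνt

end Cocharacter

/-! ### Parabolic subgroups act with non-negative weights -/

section Parabolic

variable {k : Type*} [NontriviallyNormedField k] [CharZero k] {n N : ℕ} {I : Type*}

local notation "ιV" => CliffordAlgebra.ι (form k n)

/-- The action of a cocharacter on the Clifford algebra by conjugation. -/
noncomputable def conjRep (μ : kˣ →* GSpin k n) : kˣ →* Module.End k (Cliff k n) where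
  toFun t := evenConj (μ t : (CliffEven k n)ˣ)
  map_one' := by
    refine LinearMap.ext fun x => ?_
    rw [map_one, evenConj_apply]; simp
  map_mul' s t := by rw [map_mul, ← evenConj_mul]; rfl

theorem conjRep_apply (μ : kˣ →* GSpin k n) (t : kˣ) (x : Cliff k n) :
    conjRep μ t x = cl (μ t) * x * cl (μ t)⁻¹ := evenConj_apply _ _

theorem conjRep_mul (μ : kˣ →* GSpin k n) (t : kˣ) (x y : Cliff k n) :
    conjRep μ t (x * y) = conjRep μ t x * conjRep μ t y := by
  simp only [conjRep_apply]
  calc _ = cl (μ t) * x * 1 * y * cl (μ t)⁻¹ := by simp only [mul_one, mul_assoc]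
    _ = _ := by rw [← cl_inv_mul (μ t)]; simp only [mul_assoc]

theorem conjRep_ι (μ : kˣ →* GSpin k n) (t : kˣ) (v : Fin (2 * n + 1) → k) :
    conjRep μ t (ιV v) = ιV (std k n (μ t) v) := by rw [conjRep_apply, ι_std]

theorem conjRep_mem_laurent {μ : kˣ →* GSpin k n}
    (hμ : (fun t => toEven (μ t)) ∈ laurent k (CliffEven k n) ⊤) :
    (fun t => conjRep μ t) ∈ laurent k (Module.End k (Cliff k n)) ⊤ := by
  have hinv := laurent_inv hμ
  have h1 := laurent_map ((Algebra.lmul k (Cliff k n)).toLinearMap ∘ₗ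
    (CliffordAlgebra.even (form k n)).val.toLinearMap) hμ
  have h2 := laurent_map ((LinearMap.mul k (Cliff k n)).flip ∘ₗ
    (CliffordAlgebra.even (form k n)).val.toLinearMap) hinv
  have := laurent_mul h1 h2
  refine (congrArg (· ∈ laurent k (Module.End k (Cliff k n)) ⊤) ?_).mp this
  funext t
  refine LinearMap.ext fun x => ?_
  rw [conjRep_apply, ← map_inv]
  change cl (μ t) * (x * cl (μ t⁻¹)) = _
  rw [mul_assoc]

/-- If `x` acts on `V` with non-negative weights for the cocharacter `μ`, then so does its image in
the Clifford algebra. The component of lowest weight of `x` implements an isometry of `V`, so it is a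
multiple of an element of the general spin group, and the spinor norm shows that its weight is
zero. -/
theorem proj_cl_eq_zero_of_neg {μ : kˣ →* GSpin k n} {Φ : ℤ →₀ Module.End k (Cliff k n)}
    (hΦ : IsWeightDecomposition (conjRep μ) Φ) {s : Finset ℤ}
    {π : ℤ → Module.End k (Fin (2 * n + 1) → k)} (hsum : ∀ v, ∑ j ∈ s, π j v = v)
    (hwt : ∀ j ∈ s, ∀ t v, std k n (μ t) (π j v) = ((t ^ j : kˣ) : k) • π j v) {x : GSpin k n}
    (hx : ∀ i ∈ s, ∀ j ∈ s, i < j → ∀ v, π i (std k n x (π j v)) = 0) {d : ℤ} (hd : d < 0) :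
    Φ d (cl x) = 0 := by
  classical
  by_contra hne
  -- the lowest weight that occurs in `x`
  obtain ⟨d₀, ⟨hd₀, hy⟩, hmin⟩ : ∃ d₀ : ℤ, (d₀ < 0 ∧ Φ d₀ (cl x) ≠ 0) ∧
      ∀ m < d₀, Φ m (cl x) = 0 := by
    let T := Φ.support.filter fun m => m < 0 ∧ Φ m (cl x) ≠ 0
    have hT : ∀ m, m ∈ T ↔ m < 0 ∧ Φ m (cl x) ≠ 0 := fun m => by
      simp only [T, Finset.mem_filter, Finsupp.mem_support_iff, and_iff_right_iff_imp]
      rintro ⟨-, h⟩ h0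
      exact h (by rw [h0]; rfl)
    have hTne : T.Nonempty := ⟨d, (hT d).2 ⟨hd, hne⟩⟩
    refine ⟨T.min' hTne, (hT _).1 (T.min'_mem hTne), fun m hm => ?_⟩
    by_contra h
    have hm' := (hT (T.min' hTne)).1 (T.min'_mem hTne)
    exact absurd (T.min'_le m ((hT m).2 ⟨hm.trans hm'.1, h⟩)) (not_le.2 hm)
  set y := Φ d₀ (cl x) with hydef
  have hyeven : y ∈ CliffordAlgebra.even (form k n) := by
    have := coeff_mem_of_weightSum_mem (k := k)
      (T := Subalgebra.toSubmodule (CliffordAlgebra.even (form k n)))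
      (a := Φ.mapRange (· (cl x)) rfl) (fun t => by
        rw [← hΦ.apply_eq, conjRep_apply, ← cl_mul, ← cl_mul]; exact cl_mem_even _) d₀
    rw [Finsupp.mapRange_apply] at this
    exact this
  have hright : ∀ j ∈ s, ∀ m v, Φ m (cl x * ιV (π j v)) = Φ (m - j) (cl x) * ιV (π j v) :=
    fun j hj m v => hΦ.proj_map_eq hΦ (LinearMap.mulRight k (ιV (π j v))) j (fun t w => by
      rw [LinearMap.mulRight_apply, LinearMap.mulRight_apply, conjRep_mul, conjRep_ι, hwt j hj,
        map_smul, mul_smul_comm]) m (cl x)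
  have hleft : ∀ j ∈ s, ∀ m v, Φ m (ιV (π j v) * cl x) = ιV (π j v) * Φ (m - j) (cl x) :=
    fun j hj m v => hΦ.proj_map_eq hΦ (LinearMap.mulLeft k (ιV (π j v))) j (fun t w => by
      rw [LinearMap.mulLeft_apply, LinearMap.mulLeft_apply, conjRep_mul, conjRep_ι, hwt j hj,
        map_smul, smul_mul_assoc]) m (cl x)
  -- the part of weight zero of the action of `x` on `V`
  let A₀ : Module.End k (Fin (2 * n + 1) → k) := ∑ j ∈ s, π j ∘ₗ std k n x ∘ₗ π j
  have hyj : ∀ j ∈ s, ∀ v, y * ιV (π j v) = ιV (π j (std k n x (π j v))) * y := by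
    intro j hj v
    have h1 := hright j hj (d₀ + j) v
    rw [add_sub_cancel_right] at h1
    rw [← h1, cl_mul_ι]
    conv_lhs => rw [← hsum (std k n x (π j v)), map_sum, Finset.sum_mul, map_sum]
    rw [Finset.sum_eq_single_of_mem j hj, hleft j hj, add_sub_cancel_right]
    intro i hi hij
    rcases lt_or_gt_of_ne hij with h | h
    · rw [hx i hi j hj h]; simp
    · rw [hleft i hi, hmin _ (by omega), mul_zero]
  have hyA : ∀ v, y * ιV v = ιV (A₀ v) * y := by
    intro v
    conv_lhs => rw [← hsum v, map_sum, Finset.mul_sum]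
    rw [Finset.sum_congr rfl fun j hj => hyj j hj v, ← Finset.sum_mul, ← map_sum]
    simp [A₀]
  have hform : ∀ v, form k n (A₀ v) = form k n v := by
    intro v
    have h : (form k n v) • y = (form k n (A₀ v)) • y := by
      rw [Algebra.smul_def, Algebra.smul_def, Algebra.commutes, ← ι_mul_self, ← ι_mul_self,
        ← mul_assoc, hyA, mul_assoc, hyA, mul_assoc]
    exact (smul_left_injective k hy h).symm
  obtain ⟨z, hz⟩ := liftsUpToSign_of_isometry A₀ fun v w => by
    have h := form_add (A₀ v) (A₀ w)
    rw [← map_add, hform, hform, hform, form_add] at h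
    exact (add_left_cancel h).symm
  have hzy : cl z⁻¹ * y ∈ CliffordAlgebra.even (form k n) :=
    Subalgebra.mul_mem _ (cl_mem_even _) hyeven
  have hback : y = cl z * (cl z⁻¹ * y) := by rw [← mul_assoc, cl_mul_inv, one_mul]
  obtain ⟨c, hc⟩ : ∃ c, cl z⁻¹ * y = algebraMap k _ c := by
    rcases hz with hz | hz
    · refine eq_algebraMap_of_commute hzy fun v => ?_
      rw [mul_assoc, hyA, ← mul_assoc (cl z⁻¹), cl_mul_ι, ← hz, std_inv_apply, mul_assoc]
    · refine absurd (eq_zero_of_anticommute hzy fun v => ?_) ?_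
      · have h2 : A₀ v = -std k n z v := by rw [hz, LinearMap.neg_apply, neg_neg]
        rw [mul_assoc, hyA, ← mul_assoc (cl z⁻¹), cl_mul_ι, h2, map_neg, std_inv_apply, map_neg, neg_mul,
          neg_mul, neg_neg, mul_assoc]
      · intro h0
        exact hy (by rw [hback, h0, mul_zero])
  rw [hc, ← Algebra.commutes, ← Algebra.smul_def] at hback
  have hc0 : c ≠ 0 := by rintro rfl; exact hy (by rw [hback, zero_smul])
  -- conjugation by `μ 2` multiplies `z` by `2 ^ d₀`, but preserves the spinor norm
  let two : kˣ := Units.mk0 2 two_ne_zero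
  have hconj : cl (μ two * z * (μ two)⁻¹) = ((two ^ d₀ : kˣ) : k) • cl z := by
    have h1 : conjRep μ two y = ((two ^ d₀ : kˣ) : k) • y :=
      LinearMap.congr_fun (hΦ.mul_eq two d₀) (cl x)
    rw [hback, map_smul, smul_comm, conjRep_apply] at h1
    rw [cl_mul, cl_mul]
    exact smul_right_injective _ hc0 h1
  have hN := spinorNorm_eq (x := μ two * z * (μ two)⁻¹)
    (r := ((two ^ d₀ : kˣ) : k) * (((two ^ d₀ : kˣ) : k) * spinorNorm z)) (by
      rw [hconj, map_smul, smul_mul_smul_comm, reverse_mul_cl, Algebra.smul_def,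
        ← map_mul (algebraMap k (Cliff k n)), mul_assoc])
  rw [spinorNorm_conj, ← mul_assoc, eq_comm, mul_eq_right₀ (spinorNorm_ne_zero z), ← Units.val_mul,
    ← zpow_add, Units.val_eq_one] at hN
  have h3 : ((2 : ℚ) ^ (d₀ + d₀) : ℚ) = 2 ^ (0 : ℤ) := by
    have h4 : (2 : k) ^ (d₀ + d₀) = 1 := by
      have := congrArg Units.val hN
      simpa only [Units.val_zpow_eq_zpow_val, two, Units.val_mk0, Units.val_one] using this
    have : (((2 : ℚ) ^ (d₀ + d₀) : ℚ) : k) = ((2 ^ (0 : ℤ) : ℚ) : k) := by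
      push_cast; rw [h4]
    exact_mod_cast this
  have := zpow_right_injective₀ (by norm_num) (by norm_num) h3
  omega

section Hyperbolic

variable [Fintype I] [DecidableEq I] {e f : I → Fin (2 * n + 1) → k}

/-- The stabiliser of the span `U` of the family `e` preserves the flag `U ⊆ U^⊥ ⊆ V`, whose steps have
the weights `2`, `0`, `-2`, so it has non-negative weights on the Clifford algebra. -/
theorem IsHyperbolic.proj_cl_eq_zero (h : IsHyperbolic e f) {μ : kˣ →* GSpin k n}
    (hμ : IsCocharacterOn e f Finset.univ μ) {Φ : ℤ →₀ Module.End k (Cliff k n)}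
    (hΦ : IsWeightDecomposition (conjRep μ) Φ) {x : GSpin k n}
    (hx : ∀ i, std k n x (e i) ∈ Submodule.span k (Set.range e))
    (hx' : ∀ i, std k n x⁻¹ (e i) ∈ Submodule.span k (Set.range e)) {d : ℤ} (hd : d < 0) :
    Φ d (cl x) = 0 := by
  let π₂ : Module.End k (Fin (2 * n + 1) → k) := ∑ i, (bil k n (f i)).smulRight (e i)
  let πm : Module.End k (Fin (2 * n + 1) → k) := ∑ i, (bil k n (e i)).smulRight (f i)
  have hπ₂ : ∀ v, π₂ v = ∑ i, bil k n (f i) v • e i := fun v => by simp [π₂]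
  have hπm : ∀ v, πm v = ∑ i, bil k n (e i) v • f i := fun v => by simp [πm]
  have h2e : ∀ j, π₂ (e j) = e j := fun j => by
    rw [hπ₂]; simp [bil_comm (f _), h.dual]
  have hme : ∀ j, πm (e j) = 0 := fun j => by
    rw [hπm]; simp [h.left]
  have hU2 : ∀ u ∈ Submodule.span k (Set.range e), π₂ u = u := fun u hu => by
    induction hu using Submodule.span_induction with
    | mem u hu => obtain ⟨j, rfl⟩ := hu; exact h2e j
    | zero => simp
    | add u v _ _ hu hv => rw [map_add, hu, hv]
    | smul r u _ hu => rw [map_smul, hu]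
  have hUm : ∀ u ∈ Submodule.span k (Set.range e), πm u = 0 := fun u hu => by
    induction hu using Submodule.span_induction with
    | mem u hu => obtain ⟨j, rfl⟩ := hu; exact hme j
    | zero => simp
    | add u v _ _ hu hv => rw [map_add, hu, hv, add_zero]
    | smul r u _ hu => rw [map_smul, hu, smul_zero]
  have hmem : ∀ v, std k n x (π₂ v) ∈ Submodule.span k (Set.range e) := fun v => by
    rw [hπ₂, map_sum]
    exact Submodule.sum_mem _ fun i _ => by
      rw [map_smul]; exact Submodule.smul_mem _ _ (hx i)
  -- the part of weight zero is orthogonal to both families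
  have h0 : ∀ v i, bil k n (e i) (v - π₂ v - πm v) = 0 ∧ bil k n (f i) (v - π₂ v - πm v) = 0 := by
    intro v i
    simp only [map_sub, hπ₂, hπm, map_sum, map_smul, h.left, h.right, h.dual, bil_comm (f i) (e _)]
    simp
  have h0U : ∀ v, ∀ u ∈ Submodule.span k (Set.range e), bil k n u (v - π₂ v - πm v) = 0 := by
    intro v u hu
    induction hu using Submodule.span_induction with
    | mem u hu => obtain ⟨j, rfl⟩ := hu; exact (h0 v j).1
    | zero => simp
    | add u w _ _ hu hw => rw [map_add, LinearMap.add_apply, hu, hw, add_zero]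
    | smul r u _ hu => rw [map_smul, LinearMap.smul_apply, hu, smul_zero]
  let π : ℤ → Module.End k (Fin (2 * n + 1) → k) := fun j =>
    if j = 2 then π₂ else if j = -2 then πm else 1 - π₂ - πm
  have e2 : π 2 = π₂ := rfl
  have em : π (-2) = πm := rfl
  have e0 : ∀ v, π 0 v = v - π₂ v - πm v := fun v => rfl
  refine proj_cl_eq_zero_of_neg hΦ (s := {2, 0, -2}) (π := π) (fun v => ?_) ?_ ?_ hd
  · rw [Finset.sum_insert (by decide), Finset.sum_insert (by decide), Finset.sum_singleton, e2, em,
      e0]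
    abel
  · intro j hj t v
    simp only [Finset.mem_insert, Finset.mem_singleton] at hj
    rcases hj with rfl | rfl | rfl
    · rw [e2, hπ₂, map_sum, Finset.smul_sum]
      refine Finset.sum_congr rfl fun i _ => ?_
      rw [map_smul, hμ.std_left i (Finset.mem_univ i), smul_comm]
    · rw [zpow_zero, Units.val_one, one_smul]
      exact hμ.std_orthogonal _ (fun i _ => h0 v i) t
    · rw [em, hπm, map_sum, Finset.smul_sum]
      refine Finset.sum_congr rfl fun i _ => ?_
      rw [map_smul, hμ.std_right i (Finset.mem_univ i), smul_comm]
  · intro i hi j hj hij v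
    simp only [Finset.mem_insert, Finset.mem_singleton] at hi hj
    rcases hj with rfl | rfl | rfl
    · rcases hi with rfl | rfl | rfl
      · omega
      · rw [e0, e2, hU2 _ (hmem v), hUm _ (hmem v)]; simp
      · rw [em, e2, hUm _ (hmem v)]
    · rcases hi with rfl | rfl | rfl
      · omega
      · omega
      · rw [em, hπm]
        refine Finset.sum_eq_zero fun i _ => ?_
        rw [← bil_std x⁻¹, std_inv_apply, e0, h0U _ _ (hx' i), zero_smul]
    · rcases hi with rfl | rfl | rfl <;> omega

/-- For `x` in the stabiliser of the span of `e`, the conjugate `μ t x (μ t)⁻¹` is polynomial in `t`,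
without negative powers. -/
theorem IsHyperbolic.conj_mem_laurent (h : IsHyperbolic e f) {μ : kˣ →* GSpin k n}
    (hμ : IsCocharacterOn e f Finset.univ μ) {x : GSpin k n}
    (hx : ∀ i, std k n x (e i) ∈ Submodule.span k (Set.range e))
    (hx' : ∀ i, std k n x⁻¹ (e i) ∈ Submodule.span k (Set.range e)) :
    (fun t => toEven (μ t * x * (μ t)⁻¹)) ∈
      laurent k (CliffEven k n) (AddSubmonoid.nonneg ℤ) := by
  obtain ⟨Φ, hΦ⟩ := exists_isWeightDecomposition _ (conjRep_mem_laurent hμ.mem_laurent)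
  obtain ⟨φ, hφ⟩ := LinearMap.exists_leftInverse_of_injective
    (CliffordAlgebra.even (form k n)).val.toLinearMap (LinearMap.ker_eq_bot.2 Subtype.val_injective)
  have h1 : (fun t => conjRep μ t (cl x)) ∈ laurent k (Cliff k n) (AddSubmonoid.nonneg ℤ) := by
    refine mem_laurent_iff.2 ⟨Φ.mapRange (· (cl x)) rfl, fun m hm => ?_, fun t => hΦ.apply_eq _ _⟩
    rw [Finsupp.mapRange_apply]
    exact h.proj_cl_eq_zero hμ hΦ hx hx' (by simpa using hm)
  refine (congrArg (· ∈ laurent k (CliffEven k n) (AddSubmonoid.nonneg ℤ)) ?_).mp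
    (laurent_map φ h1)
  funext t
  rw [conjRep_apply, ← cl_mul, ← cl_mul]
  exact LinearMap.congr_fun hφ (toEven (μ t * x * (μ t)⁻¹))

theorem IsHyperbolic.regular_conj_mem_laurent (h : IsHyperbolic e f) {μ : kˣ →* GSpin k n}
    (hμ : IsCocharacterOn e f Finset.univ μ) {x : GSpin k n}
    (hx : ∀ i, std k n x (e i) ∈ Submodule.span k (Set.range e))
    (hx' : ∀ i, std k n x⁻¹ (e i) ∈ Submodule.span k (Set.range e)) {ψ : GSpin k n → k}
    (hψ : ψ ∈ regularFunctions k n) :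
    (fun t => ψ (μ t * x * (μ t)⁻¹)) ∈ laurent k k (AddSubmonoid.nonneg ℤ) := by
  induction hψ using Algebra.adjoin_induction with
  | mem ψ hψ =>
    rcases hψ with ⟨c, rfl⟩ | ⟨c, rfl⟩
    · exact laurent_map c (h.conj_mem_laurent hμ hx hx')
    · have := laurent_map c (h.conj_mem_laurent hμ (x := x⁻¹) hx' (by rwa [inv_inv]))
      refine (congrArg (· ∈ laurent k k (AddSubmonoid.nonneg ℤ)) ?_).mp this
      funext t
      have e : (μ t * x * (μ t)⁻¹)⁻¹ = μ t * x⁻¹ * (μ t)⁻¹ := by group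
      rw [← e]
  | algebraMap r => exact laurent_const r
  | add ψ φ _ _ hψ hφ => exact Submodule.add_mem _ hψ hφ
  | mul ψ φ _ _ hψ hφ => exact laurent_mul hψ hφ

end Hyperbolic

theorem end_eq_sum (A : Module.End k (Fin N → k)) :
    A = ∑ i, ∑ j, A (Pi.single j 1) i • Matrix.toLin' (Matrix.single i j (1 : k)) := by
  conv_lhs => rw [← Matrix.toLin'_toMatrix' A, Matrix.matrix_eq_sum_single (LinearMap.toMatrix' A)]
  simp only [map_sum]
  refine Finset.sum_congr rfl fun i _ => Finset.sum_congr rfl fun j _ => ?_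
  rw [LinearMap.toMatrix'_apply, ← mul_one (A _ i), ← smul_eq_mul (A _ i),
    ← Matrix.smul_single, map_smul, smul_eq_mul, mul_one]

theorem rep_mem_laurent {S : AddSubmonoid ℤ} {f : Representation k (GSpin k n) (Fin N → k)}
    {γ : kˣ → GSpin k n}
    (h : ∀ i j, (fun t => f (γ t) (Pi.single j 1) i) ∈ laurent k k S) :
    (fun t => f (γ t)) ∈ laurent k (Module.End k (Fin N → k)) S := by
  have : (fun t => f (γ t)) = ∑ i, ∑ j, fun t => f (γ t) (Pi.single j 1) i •
      Matrix.toLin' (Matrix.single i j (1 : k)) := by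
    funext t
    simp only [Finset.sum_apply]
    exact end_eq_sum _
  rw [this]
  exact Submodule.sum_mem _ fun i _ => Submodule.sum_mem _ fun j _ =>
    laurent_map (LinearMap.toSpanSingleton k _ _) (h i j)

theorem rep_cocharacter_mem_laurent {f : Representation k (GSpin k n) (Fin N → k)}
    (hf : IsAlgebraicRep f) {μ : kˣ →* GSpin k n}
    (hμ : (fun t => toEven (μ t)) ∈ laurent k (CliffEven k n) ⊤) :
    (fun t => f (μ t)) ∈ laurent k (Module.End k (Fin N → k)) ⊤ := by
  refine rep_mem_laurent fun i j => ?_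
  suffices H : ∀ ψ ∈ regularFunctions k n, (fun t => ψ (μ t)) ∈ laurent k k ⊤ from H _ (hf i j)
  intro ψ hψ
  induction hψ using Algebra.adjoin_induction with
  | mem ψ hψ =>
    rcases hψ with ⟨c, rfl⟩ | ⟨c, rfl⟩
    · exact laurent_map c hμ
    · have := laurent_map c (laurent_inv hμ)
      simpa only [map_inv] using this
  | algebraMap r => exact laurent_const r
  | add ψ φ _ _ hψ hφ => exact Submodule.add_mem _ hψ hφ
  | mul ψ φ _ _ hψ hφ => exact laurent_mul hψ hφ

/-- In an algebraic representation, the stabiliser of a totally isotropic subspace does not lower the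
weights of the corresponding cocharacter. -/
theorem IsHyperbolic.proj_mul_mul_proj_eq_zero [Fintype I] [DecidableEq I]
    {e f : I → Fin (2 * n + 1) → k} (h : IsHyperbolic e f) {μ : kˣ →* GSpin k n}
    (hμ : IsCocharacterOn e f Finset.univ μ) {R : Representation k (GSpin k n) (Fin N → k)}
    (hR : IsAlgebraicRep R) {P : ℤ →₀ Module.End k (Fin N → k)}
    (hP : IsWeightDecomposition ((R : GSpin k n →* _).comp μ) P) {x : GSpin k n}
    (hx : ∀ i, std k n x (e i) ∈ Submodule.span k (Set.range e))
    (hx' : ∀ i, std k n x⁻¹ (e i) ∈ Submodule.span k (Set.range e)) {m j : ℤ} (hmj : m < j) :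
    P m * R x * P j = 0 := by
  have h1 := rep_mem_laurent (f := R) (γ := fun t => μ t * x * (μ t)⁻¹) fun i j =>
    h.regular_conj_mem_laurent hμ hx hx' (hR i j)
  have h2 := laurent_map (LinearMap.mulLeftRight k (P m, P j)) h1
  refine eq_zero_of_zpow_mem_laurent (k := k) (S := AddSubmonoid.nonneg ℤ) (m := m - j)
    (by simpa using hmj) ?_
  refine (congrArg (· ∈ laurent k _ (AddSubmonoid.nonneg ℤ)) ?_).mp h2
  funext t
  have h3 : P m * R (μ t) = ((t ^ m : kˣ) : k) • P m := hP.eq_mul t m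
  have h4 : R (μ t)⁻¹ * P j = ((t⁻¹ ^ j : kˣ) : k) • P j := by
    rw [← map_inv]; exact hP.mul_eq t⁻¹ j
  rw [LinearMap.mulLeftRight_apply, map_mul, map_mul]
  calc _ = (P m * R (μ t)) * R x * (R (μ t)⁻¹ * P j) := by simp only [mul_assoc]
    _ = _ := by
      rw [h3, h4, smul_mul_assoc, smul_mul_smul_comm, ← Units.val_mul, inv_zpow, ← zpow_neg,
        ← zpow_add, sub_eq_add_neg]

/-- A totally isotropic subspace has a basis which is part of a hyperbolic family. -/
theorem exists_isHyperbolic (U : Submodule k (Fin (2 * n + 1) → k))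
    (hU : ∀ u ∈ U, ∀ v ∈ U, bil k n u v = 0) :
    ∃ e f : Fin (Module.finrank k U) → Fin (2 * n + 1) → k,
      IsHyperbolic e f ∧ Submodule.span k (Set.range e) = U := by
  let b := Module.finBasis k U
  let e : Fin (Module.finrank k U) → Fin (2 * n + 1) → k := fun i => b i
  have hg : ∀ i, ∃ g : Fin (2 * n + 1) → k, ∀ j, bil k n (e j) g = if j = i then 1 else 0 := by
    intro i
    obtain ⟨c, hc⟩ := LinearMap.exists_extend (b.coord i)
    obtain ⟨g, hg⟩ := (LinearMap.BilinForm.toDual (bil k n) (bil_nondegenerate)).surjective c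
    refine ⟨g, fun j => ?_⟩
    rw [bil_comm, ← LinearMap.BilinForm.toDual_def (bil_nondegenerate), hg]
    have := LinearMap.congr_fun hc (b j)
    rw [LinearMap.comp_apply, Submodule.subtype_apply, b.coord_apply, b.repr_self,
      Finsupp.single_apply] at this
    exact this
  choose g hg using hg
  have hee : ∀ i j, bil k n (e i) (e j) = 0 := fun i j => hU _ (b i).2 _ (b j).2
  refine ⟨e, fun i => g i - ∑ j, ((2 : k)⁻¹ * bil k n (g i) (g j)) • e j, ⟨hee, ?_, ?_⟩, ?_⟩
  · intro i j
    simp only [map_sub, map_sum, map_smul, LinearMap.sub_apply, LinearMap.sum_apply,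
      LinearMap.smul_apply, hee, hg, bil_comm (g _) (e _)]
    simp
    rw [bil_comm (g j) (g i)]
    ring
  · intro i j
    simp [map_sub, hee, hg]
  · have : Set.range e = U.subtype '' Set.range b := by
      rw [← Set.range_comp]; rfl
    rw [this, Submodule.span_image, b.span_eq, Submodule.map_subtype_top]

end Parabolic

/-! ### Stable subspaces and complements -/

section Stable

variable {k : Type*} [Field k] {Γ : Type*} [Group Γ] {V : Type*} [AddCommGroup V] [Module k V]

/-- The subspace `W` is stable under the representation `ρ`. -/
def IsStable (ρ : Representation k Γ V) (W : Submodule k V) : Prop :=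
  ∀ σ, ∀ w ∈ W, ρ σ w ∈ W

variable {ρ : Representation k Γ V}

theorem IsStable.inf {W W' : Submodule k V} (h : IsStable ρ W) (h' : IsStable ρ W') :
    IsStable ρ (W ⊓ W') :=
  fun σ w hw => ⟨h σ w hw.1, h' σ w hw.2⟩

theorem IsStable.ker {A : Module.End k V} (hA : ∀ σ, Commute A (ρ σ)) : IsStable ρ A.ker := by
  intro σ w hw
  rw [LinearMap.mem_ker] at hw ⊢
  rw [← Module.End.mul_apply, (hA σ).eq, Module.End.mul_apply, hw, map_zero]

theorem isSemisimpleRepresentation_iff : ρ.IsSemisimpleRepresentation ↔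
    ∀ W, IsStable ρ W → ∃ W', IsStable ρ W' ∧ IsCompl W W' := by
  have key : ∀ a b : Subrepresentation ρ, IsCompl a b ↔ IsCompl a.toSubmodule b.toSubmodule := by
    intro a b
    have h1 : a ⊓ b = ⊥ ↔ a.toSubmodule ⊓ b.toSubmodule = ⊥ :=
      Subrepresentation.toSubmodule_injective.eq_iff (a := a ⊓ b) (b := ⊥) |>.symm
    have h2 : a ⊔ b = ⊤ ↔ a.toSubmodule ⊔ b.toSubmodule = ⊤ :=
      Subrepresentation.toSubmodule_injective.eq_iff (a := a ⊔ b) (b := ⊤) |>.symm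
    rw [isCompl_iff, isCompl_iff, disjoint_iff, disjoint_iff, codisjoint_iff, codisjoint_iff, h1, h2]
  constructor
  · rintro h W hW
    obtain ⟨W', hW'⟩ := h.exists_isCompl ⟨W, fun σ w hw => hW σ w hw⟩
    exact ⟨W'.toSubmodule, fun σ w hw => W'.apply_mem_toSubmodule σ hw, (key _ _).1 hW'⟩
  · refine fun h => ⟨fun W => ?_⟩
    obtain ⟨W', hW', hc⟩ := h W.toSubmodule fun σ w hw => W.apply_mem_toSubmodule σ hw
    exact ⟨⟨W', fun σ w hw => hW' σ w hw⟩, (key _ _).2 hc⟩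

/-- In a semisimple representation, every stable subspace is the image of an equivariant
projection. -/
theorem exists_equivariant_projection (h : ρ.IsSemisimpleRepresentation) {W : Submodule k V}
    (hW : IsStable ρ W) : ∃ T : Module.End k V, (∀ σ, Commute T (ρ σ)) ∧ (∀ v, T v ∈ W) ∧
      ∀ w ∈ W, T w = w := by
  obtain ⟨W', hW', hc⟩ := isSemisimpleRepresentation_iff.1 h W hW
  refine ⟨W.projection W' hc, fun σ => LinearMap.ext fun v => ?_, fun v => ?_, fun w hw => ?_⟩
  · obtain ⟨a, ha, b, hb, rfl⟩ := Submodule.mem_sup.1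
      (hc.sup_eq_top ▸ Submodule.mem_top : v ∈ W ⊔ W')
    simp only [Module.End.mul_apply, map_add]
    rw [Submodule.projection_apply_of_mem_left hc ha, Submodule.projection_apply_of_mem_right hc hb,
      Submodule.projection_apply_of_mem_left hc (hW σ a ha),
      Submodule.projection_apply_of_mem_right hc (hW' σ b hb), map_zero]
  · exact Submodule.projection_apply_mem hc v
  · exact Submodule.projection_apply_of_mem_left hc hw

/-- A minimal non-zero stable subspace. -/
structure IsMinimalStable (ρ : Representation k Γ V) (U : Submodule k V) : Prop where
  stable : IsStable ρ U
  ne_bot : U ≠ ⊥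
  eq_bot_or_eq : ∀ W, IsStable ρ W → W ≤ U → W = ⊥ ∨ W = U

variable [FiniteDimensional k V]

theorem exists_isMinimalStable {W : Submodule k V} (hW : IsStable ρ W) (hne : W ≠ ⊥) :
    ∃ U ≤ W, IsMinimalStable ρ U := by
  induction hd : Module.finrank k W using Nat.strong_induction_on generalizing W with
  | _ d ih =>
    by_cases hmin : ∀ W', IsStable ρ W' → W' ≤ W → W' = ⊥ ∨ W' = W
    · exact ⟨W, le_rfl, hW, hne, hmin⟩
    · push Not at hmin
      obtain ⟨W', hW', hle, hne', hneq⟩ := hmin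
      obtain ⟨U, hU, hU'⟩ := ih _ (hd ▸ Submodule.finrank_lt_finrank_of_lt
        (lt_of_le_of_ne hle hneq)) hW' hne' rfl
      exact ⟨U, hU.trans hle, hU'⟩

/-- A representation is semisimple as soon as its minimal stable subspaces have stable
complements. -/
theorem isSemisimpleRepresentation_of_minimal
    (h : ∀ U, IsMinimalStable ρ U → ∃ U', IsStable ρ U' ∧ IsCompl U U') :
    ρ.IsSemisimpleRepresentation := by
  refine isSemisimpleRepresentation_iff.2 fun W hW => ?_
  induction hd : Module.finrank k W using Nat.strong_induction_on generalizing W with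
  | _ d ih =>
    by_cases hne : W = ⊥
    · exact ⟨⊤, fun _ _ _ => trivial, by rw [hne]; exact isCompl_bot_top⟩
    obtain ⟨U, hUW, hU⟩ := exists_isMinimalStable hW hne
    obtain ⟨T, hT, hUT⟩ := h U hU
    have hlt : W ⊓ T < W := by
      refine lt_of_le_of_ne inf_le_left fun h => hU.ne_bot ?_
      rw [← hUT.inf_eq_bot]
      exact (inf_eq_left.2 (hUW.trans (inf_eq_left.1 h))).symm
    obtain ⟨K, hK, hKc⟩ := ih _ (hd ▸ Submodule.finrank_lt_finrank_of_lt hlt) (W ⊓ T)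
      (hW.inf hT) rfl
    refine ⟨K ⊓ T, hK.inf hT, ?_⟩
    rw [isCompl_iff, disjoint_iff, codisjoint_iff]
    constructor
    · rw [inf_comm K T, ← inf_assoc, hKc.inf_eq_bot]
    · have h1 : (W ⊓ T) ⊔ (K ⊓ T) = T := by
        rw [← sup_inf_assoc_of_le K (inf_le_right : W ⊓ T ≤ T), hKc.sup_eq_top, top_inf_eq]
      rw [eq_top_iff, ← hUT.sup_eq_top]
      refine sup_le (hUW.trans le_sup_left) ?_
      exact h1.symm.le.trans (sup_le_sup inf_le_left le_rfl)

/-- Schur's lemma: an equivariant endomorphism acts as a scalar on a minimal stable subspace. -/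
theorem IsMinimalStable.exists_eq_smul [IsAlgClosed k] {U : Submodule k V}
    (hU : IsMinimalStable ρ U) {X : Module.End k V} (hX : ∀ σ, Commute X (ρ σ))
    (hXU : ∀ u ∈ U, X u ∈ U) : ∃ c : k, ∀ u ∈ U, X u = c • u := by
  have : Nontrivial U := Submodule.nontrivial_iff_ne_bot.2 hU.ne_bot
  obtain ⟨c, hc⟩ := Module.End.exists_eigenvalue (X.restrict hXU)
  obtain ⟨u, hu⟩ := hc.exists_hasEigenvector
  have hu' : X u = c • (u : V) := congrArg Subtype.val hu.apply_eq_smul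
  have hst : IsStable ρ (U ⊓ (X - c • (1 : Module.End k V)).ker) :=
    hU.stable.inf (IsStable.ker fun σ => (hX σ).sub_left ((Commute.one_left _).smul_left c))
  rcases hU.eq_bot_or_eq _ hst inf_le_left with h | h
  · have hmem : (u : V) ∈ U ⊓ (X - c • (1 : Module.End k V)).ker :=
      ⟨u.2, by simp [LinearMap.mem_ker, hu']⟩
    rw [h, Submodule.mem_bot] at hmem
    exact absurd (Subtype.ext hmem) hu.2
  · refine ⟨c, fun v hv => ?_⟩
    have : v ∈ (X - c • (1 : Module.End k V)).ker := (inf_eq_left.1 h) hv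
    rw [LinearMap.mem_ker, LinearMap.sub_apply, sub_eq_zero] at this
    exact this

end Stable

/-! ### Sums of weight projections -/

section WeightSums

variable {k : Type*} [Field k] [CharZero k] {W : Type*} [AddCommGroup W] [Module k W]
  {ρ : kˣ →* Module.End k W} {P : ℤ →₀ Module.End k W}

namespace IsWeightDecomposition

theorem sum_mul_proj (h : IsWeightDecomposition ρ P) (A : Finset ℤ) {j : ℤ} (hj : j ∈ A) :
    (∑ m ∈ A, P m) * P j = P j := by
  rw [Finset.sum_mul, Finset.sum_eq_single_of_mem j hj fun m _ hm => h.ortho m j hm, h.idem]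

theorem sum_idem (h : IsWeightDecomposition ρ P) (A : Finset ℤ) :
    (∑ m ∈ A, P m) * (∑ m ∈ A, P m) = ∑ m ∈ A, P m := by
  conv_lhs => rw [Finset.mul_sum]
  exact Finset.sum_congr rfl fun j hj => h.sum_mul_proj A hj

/-- If `x` does not lower weights, then it preserves the sum of the weight spaces for an upward closed
set of weights. -/
theorem sum_mul_sum_eq (h : IsWeightDecomposition ρ P) {A : Finset ℤ}
    (hA : ∀ m ∈ P.support, ∀ j ∈ A, j ≤ m → m ∈ A) (hAP : A ⊆ P.support) {x : Module.End k W}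
    (hx : ∀ m j, m < j → P m * x * P j = 0) :
    (∑ m ∈ A, P m) * x * (∑ m ∈ A, P m) = x * ∑ m ∈ A, P m := by
  classical
  have h0 : (∑ m ∈ P.support \ A, P m) * x * (∑ m ∈ A, P m) = 0 := by
    rw [Finset.sum_mul, Finset.sum_mul]
    refine Finset.sum_eq_zero fun m hm => ?_
    rw [Finset.mul_sum]
    refine Finset.sum_eq_zero fun j hj => hx m j ?_
    rw [Finset.mem_sdiff] at hm
    by_contra hlt
    exact hm.2 (hA m hm.1 j hj (not_lt.1 hlt))
  have h1 : (∑ m ∈ P.support \ A, P m) + ∑ m ∈ A, P m = 1 := by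
    rw [Finset.sum_sdiff hAP, h.sum_eq_one]
  rw [eq_sub_of_add_eq h1, sub_mul, sub_mul, one_mul, sub_eq_zero] at h0
  exact h0.symm

theorem commute_sum (h : IsWeightDecomposition ρ P) {x : Module.End k W}
    (hx : ∀ t, x * ρ t = ρ t * x) (A : Finset ℤ) : Commute x (∑ m ∈ A, P m) :=
  Commute.sum_right _ _ _ fun m _ => h.commute_proj hx m

/-- An endomorphism of weight `d` maps the weight space `j` to the weight space `d + j`. -/
theorem proj_mul_mul_proj_eq_zero_of_weight (h : IsWeightDecomposition ρ P) {x : Module.End k W}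
    {d : ℤ} (hx : ∀ t, ρ t * x = ((t ^ d : kˣ) : k) • (x * ρ t)) {m j : ℤ} (hmj : m ≠ d + j) :
    P m * x * P j = 0 := by
  by_contra hne
  refine hmj (zpow_char_injective (k := k) (MonoidHom.ext fun t => ?_))
  have h1 : P m * (ρ t * x) * P j = ((t ^ m : kˣ) : k) • (P m * x * P j) := by
    rw [← mul_assoc, h.eq_mul, smul_mul_assoc, smul_mul_assoc]
  rw [hx, mul_smul_comm, smul_mul_assoc, ← mul_assoc, mul_assoc, h.mul_eq, mul_smul_comm,
    smul_smul, ← Units.val_mul, ← zpow_add] at h1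
  exact (smul_left_injective k hne h1).symm

variable [FiniteDimensional k W]

/-- For a non-trivial representation of `kˣ`, there is an upward closed set of weights such that the
trace of the differential on the sum of the weight spaces is not zero. -/
theorem exists_trace_ne_zero (h : IsWeightDecomposition ρ P) (hρ : ρ ≠ 1) :
    ∃ A ⊆ P.support, (∀ m ∈ P.support, ∀ j ∈ A, j ≤ m → m ∈ A) ∧
      ∑ m ∈ A, (m : k) * LinearMap.trace k W (P m) ≠ 0 := by
  classical
  have htr : ∀ m, LinearMap.trace k W (P m) = (Module.finrank k (P m).range : k) := fun m =>
    (LinearMap.IsIdempotentElem.isProj_range _ (h.idem m)).trace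
  have hpos : ∀ m ∈ P.support, 0 < Module.finrank k (P m).range := by
    intro m hm
    rw [Module.finrank_pos_iff, Submodule.nontrivial_iff_ne_bot, Ne, LinearMap.range_eq_bot]
    exact Finsupp.mem_support_iff.1 hm
  have hcast : ∀ A : Finset ℤ, ∑ m ∈ A, (m : k) * LinearMap.trace k W (P m) =
      ((∑ m ∈ A, m * (Module.finrank k (P m).range : ℤ) : ℤ) : k) := by
    intro A
    push_cast
    exact Finset.sum_congr rfl fun m _ => by rw [htr]
  simp only [hcast, Int.cast_ne_zero]
  by_cases hp : ∃ m ∈ P.support, 0 < m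
  · obtain ⟨m₀, hm₀, hm₀'⟩ := hp
    refine ⟨P.support.filter (0 < ·), Finset.filter_subset _ _, fun m hm j hj hjm => ?_,
      (Finset.sum_pos (fun m hm => ?_) ⟨m₀, Finset.mem_filter.2 ⟨hm₀, hm₀'⟩⟩).ne'⟩
    · exact Finset.mem_filter.2 ⟨hm, (Finset.mem_filter.1 hj).2.trans_le hjm⟩
    · have := Finset.mem_filter.1 hm
      exact mul_pos this.2 (by exact_mod_cast hpos m this.1)
  · push Not at hp
    obtain ⟨m₀, hm₀, hm₀'⟩ : ∃ m ∈ P.support, m < 0 := by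
      by_contra! hq
      refine hρ (MonoidHom.ext fun t => ?_)
      rw [h.eq_weightSum, MonoidHom.one_apply, ← h.sum_eq_one]
      refine Finset.sum_congr rfl fun m hm => ?_
      rw [le_antisymm (hp m hm) (hq m hm)]; simp
    refine ⟨P.support, le_rfl, fun m hm _ _ _ => hm, (Finset.sum_neg' (fun m hm => ?_)
      ⟨m₀, hm₀, ?_⟩).ne⟩
    · exact mul_nonpos_of_nonpos_of_nonneg (hp m hm) (Int.natCast_nonneg _)
    · exact mul_neg_of_neg_of_pos hm₀' (by exact_mod_cast hpos m₀ hm₀)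

end IsWeightDecomposition

/-- Two projections with the same image have the same trace against every endomorphism preserving the
image. -/
theorem trace_mul_eq_of_projections {T E x : Module.End k W} (hTE : T * E = E) (hET : E * T = T)
    (hE : E * E = E) (hx : E * x * E = x * E) :
    LinearMap.trace k W (T * x) = LinearMap.trace k W (E * x) := by
  calc LinearMap.trace k W (T * x) = LinearMap.trace k W (E * (T * x)) := by rw [← mul_assoc, hET]
    _ = LinearMap.trace k W (T * (E * x * E)) := by rw [LinearMap.trace_mul_comm, mul_assoc, hx]
    _ = LinearMap.trace k W (E * x * E) := by rw [← mul_assoc, ← mul_assoc, hTE]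
    _ = LinearMap.trace k W (E * x) := by rw [LinearMap.trace_mul_comm, ← mul_assoc, hE]

end WeightSums

/-! ### Semisimplicity of the standard representation -/

section TraceForm

variable {k : Type*} [NontriviallyNormedField k] [CharZero k] {n N : ℕ}

local notation "ιV" => CliffordAlgebra.ι (form k n)

/-- The skew-symmetric form `(a, b) ↦ tr (T ∘ dF (a b - b a))` on `V` attached to a linear map `dF`
from the even Clifford algebra to the endomorphisms of a space, and an endomorphism `T` of it. -/
noncomputable def traceForm (dF : CliffEven k n →ₗ[k] Module.End k (Fin N → k))
    (T : Module.End k (Fin N → k)) : LinearMap.BilinForm k (Fin (2 * n + 1) → k) :=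
  ((evenMul : _ →ₗ[k] _ →ₗ[k] CliffEven k n) - LinearMap.flip evenMul).compr₂
    (LinearMap.trace k (Fin N → k) ∘ₗ LinearMap.mulLeft k T ∘ₗ dF)

variable {dF : CliffEven k n →ₗ[k] Module.End k (Fin N → k)}

theorem traceForm_apply (T : Module.End k (Fin N → k)) (a b : Fin (2 * n + 1) → k) :
    traceForm dF T a b =
      LinearMap.trace k (Fin N → k) (T * dF (evenMul a b - evenMul b a)) := rfl

theorem traceForm_swap (T : Module.End k (Fin N → k)) (a b : Fin (2 * n + 1) → k) :
    traceForm dF T a b = -traceForm dF T b a := by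
  rw [traceForm_apply, traceForm_apply, ← neg_sub (evenMul b a) (evenMul a b)]
  exact map_neg (LinearMap.trace k (Fin N → k) ∘ₗ LinearMap.mulLeft k T ∘ₗ dF) _

theorem traceForm_self (T : Module.End k (Fin N → k)) (a : Fin (2 * n + 1) → k) :
    traceForm dF T a a = 0 := by
  rw [traceForm_apply, sub_self, map_zero, mul_zero, map_zero]

variable {R : Representation k (GSpin k n) (Fin N → k)}
  (hdF : ∀ (x : GSpin k n) (a b : Fin (2 * n + 1) → k),
    dF (evenMul (std k n x a) (std k n x b)) = R x * dF (evenMul a b) * R x⁻¹)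
include hdF

theorem differential_bracket_std (x : GSpin k n) (a b : Fin (2 * n + 1) → k) :
    dF (evenMul (std k n x a) (std k n x b) - evenMul (std k n x b) (std k n x a)) =
      R x * dF (evenMul a b - evenMul b a) * R x⁻¹ := by
  rw [map_sub, hdF, hdF, map_sub, mul_sub, sub_mul]

theorem traceForm_std {T : Module.End k (Fin N → k)} {x : GSpin k n} (hT : Commute T (R x))
    (a b : Fin (2 * n + 1) → k) :
    traceForm dF T (std k n x a) (std k n x b) = traceForm dF T a b := by
  have hx : R x⁻¹ * R x = 1 := by rw [← map_mul, inv_mul_cancel, map_one]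
  rw [traceForm_apply, traceForm_apply, differential_bracket_std hdF]
  generalize dF (evenMul a b - evenMul b a) = A
  calc _ = LinearMap.trace k (Fin N → k) (R x * (T * A) * R x⁻¹) := by
        rw [← mul_assoc, ← mul_assoc, hT.eq, ← mul_assoc]
    _ = _ := by rw [LinearMap.trace_mul_comm, ← mul_assoc, hx, one_mul]

variable {μ : kˣ →* GSpin k n} {P : ℤ →₀ Module.End k (Fin N → k)}
  (hP : IsWeightDecomposition ((R : GSpin k n →* _).comp μ) P)

theorem differential_bracket_weight {a b : Fin (2 * n + 1) → k} {i j : ℤ}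
    (ha : ∀ t, std k n (μ t) a = ((t ^ i : kˣ) : k) • a)
    (hb : ∀ t, std k n (μ t) b = ((t ^ j : kˣ) : k) • b) (t : kˣ) :
    R (μ t) * dF (evenMul a b - evenMul b a) =
      ((t ^ (i + j) : kˣ) : k) • (dF (evenMul a b - evenMul b a) * R (μ t)) := by
  have h := differential_bracket_std hdF (μ t) a b
  have hx : R (μ t)⁻¹ * R (μ t) = 1 := by rw [← map_mul, inv_mul_cancel, map_one]
  rw [ha, hb] at h
  simp only [map_smul, LinearMap.smul_apply, smul_smul] at h
  rw [mul_comm (((t ^ j : kˣ) : k)), ← smul_sub, map_smul, ← Units.val_mul, ← zpow_add] at h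
  rw [← smul_mul_assoc, h, mul_assoc, hx, mul_one]

include hP

variable {T : Module.End k (Fin N → k)} {A : Finset ℤ}

/-- On vectors of non-negative total weight, the trace form of a projection with image `⨁_{m ∈ A} W_m`
does not depend on the projection. -/
theorem traceForm_eq_of_weight (hA : ∀ m ∈ P.support, ∀ j ∈ A, j ≤ m → m ∈ A) (hAP : A ⊆ P.support)
    (hTE : T * ∑ m ∈ A, P m = ∑ m ∈ A, P m) (hET : (∑ m ∈ A, P m) * T = T)
    {a b : Fin (2 * n + 1) → k} {i j : ℤ}
    (ha : ∀ t, std k n (μ t) a = ((t ^ i : kˣ) : k) • a)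
    (hb : ∀ t, std k n (μ t) b = ((t ^ j : kˣ) : k) • b) (hij : 0 ≤ i + j) :
    traceForm dF T a b = traceForm dF (∑ m ∈ A, P m) a b := by
  rw [traceForm_apply, traceForm_apply]
  exact trace_mul_eq_of_projections hTE hET (hP.sum_idem A)
    (hP.sum_mul_sum_eq hA hAP fun m l hml => hP.proj_mul_mul_proj_eq_zero_of_weight
      (differential_bracket_weight hdF ha hb) (by omega))

theorem traceForm_eq_zero_of_weight {a b : Fin (2 * n + 1) → k} {i j : ℤ}
    (ha : ∀ t, std k n (μ t) a = ((t ^ i : kˣ) : k) • a)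
    (hb : ∀ t, std k n (μ t) b = ((t ^ j : kˣ) : k) • b) (hij : i + j ≠ 0) :
    traceForm dF (∑ m ∈ A, P m) a b = 0 := by
  have hc : ∀ t, Commute (∑ m ∈ A, P m) (R (μ t)) := fun t =>
    (hP.commute_sum (fun s => by
      rw [← map_mul, mul_comm t s, map_mul]) A : Commute (R.comp μ t) _).symm
  by_contra hne
  refine hij (zpow_char_injective (k := k) (MonoidHom.ext fun t => ?_))
  have h := traceForm_std hdF (hc t) a b
  rw [ha, hb, map_smul, map_smul, LinearMap.smul_apply, smul_smul, mul_comm (((t ^ j : kˣ) : k)),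
    ← Units.val_mul, ← zpow_add, smul_eq_mul, mul_eq_right₀ hne] at h
  simpa using h

/-- The trace form vanishes on pairs of vectors fixed by the cocharacter: an anisotropic such vector
gives an element of the general spin group commuting with the cocharacter, and acting on the vector by
`1` and by `-1` on its orthogonal complement. -/
theorem traceForm_eq_zero_of_anisotropic {a b : Fin (2 * n + 1) → k}
    (ha : ∀ t, std k n (μ t) a = a) (hQ : form k n a ≠ 0) :
    traceForm dF (∑ m ∈ A, P m) a b = 0 := by
  obtain ⟨h, hh⟩ := exists_cl_conj_eq_ι_conj hQ
  have hcomm : ∀ t, Commute h (μ t) := fun t => by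
    apply cl_injective
    rw [cl_mul, cl_mul, hh, cl_mul_ι, ha]
  have hstd : ∀ u, std k n h u = -refl a u := fun u => std_eq_of_cl_mul_ι (by
    rw [hh, ι_mul_ι_eq_refl hQ, map_neg, neg_mul])
  have hc : Commute (∑ m ∈ A, P m) (R h) := (hP.commute_sum (fun t => by
    change R h * R (μ t) = R (μ t) * R h
    rw [← map_mul, (hcomm t).eq, map_mul]) A).symm
  have key := traceForm_std hdF hc a b
  have h1 : std k n h a = a := by
    rw [hstd, refl_apply, bil_self, mul_left_comm, inv_mul_cancel₀ hQ, mul_one, two_smul]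
    abel
  rw [h1, hstd, refl_apply, map_neg, map_sub, map_smul, traceForm_self, smul_zero, sub_zero,
    neg_eq_self] at key
  exact key

variable {I : Type*} [Fintype I] [DecidableEq I] {e f : I → Fin (2 * n + 1) → k}

/-- Vectors orthogonal to both families are fixed by the cocharacter. An isotropic one is handled by
adding a multiple of an anisotropic one. -/
theorem IsHyperbolic.traceForm_eq_zero_of_orthogonal (h : IsHyperbolic e f)
    (hμ : IsCocharacterOn e f Finset.univ μ) {a b : Fin (2 * n + 1) → k}
    (ha : ∀ i, bil k n (e i) a = 0 ∧ bil k n (f i) a = 0) :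
    traceForm dF (∑ m ∈ A, P m) a b = 0 := by
  have hfix : ∀ u, (∀ i, bil k n (e i) u = 0 ∧ bil k n (f i) u = 0) → form k n u ≠ 0 →
      ∀ v, traceForm dF (∑ m ∈ A, P m) u v = 0 := fun u hu hQ v =>
    traceForm_eq_zero_of_anisotropic hdF hP (hμ.std_orthogonal u fun i _ => hu i) hQ
  by_cases hex : ∃ u, (∀ i, bil k n (e i) u = 0 ∧ bil k n (f i) u = 0) ∧ form k n u ≠ 0
  · obtain ⟨u, hu, hQ⟩ := hex
    have hadd : ∀ s : k, ∀ i, bil k n (e i) (a + s • u) = 0 ∧ bil k n (f i) (a + s • u) = 0 :=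
      fun s i => by simp [(ha i).1, (ha i).2, (hu i).1, (hu i).2]
    -- one of `a`, `a + u`, `a - u` is anisotropic
    have hcase : ∃ s : k, form k n (a + s • u) ≠ 0 := by
      by_contra! hall
      have h0 := hall 0
      have h1 := hall 1
      have h2 := hall (-1)
      rw [zero_smul, add_zero] at h0
      rw [form_add, QuadraticMap.map_smul, map_smul, h0, smul_eq_mul, smul_eq_mul] at h1 h2
      refine hQ ?_
      have : 2 * form k n u = 0 := by linear_combination h1 + h2
      simpa using this
    obtain ⟨s, hs⟩ := hcase
    have := hfix _ (hadd s) hs b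
    rw [map_add, LinearMap.add_apply, map_smul, LinearMap.smul_apply, hfix u hu hQ, smul_zero,
      add_zero] at this
    exact this
  · push Not at hex
    have ha0 : a = 0 := by
      refine eq_zero_of_bil_eq_zero fun v => ?_
      let v₀ := v - (∑ i, bil k n (f i) v • e i) - ∑ i, bil k n (e i) v • f i
      have hv₀ : ∀ i, bil k n (e i) v₀ = 0 ∧ bil k n (f i) v₀ = 0 := by
        intro i
        simp only [v₀, map_sub, map_sum, map_smul, h.left, h.right, h.dual, bil_comm (f i) (e _)]
        simp
      have h1 : bil k n a v₀ = 0 := by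
        have h2 := hex (a + v₀) fun i => by
          simp [(ha i).1, (ha i).2, (hv₀ i).1, (hv₀ i).2]
        rw [form_add, hex a ha, hex v₀ hv₀] at h2
        simpa using h2
      have h2 : v = v₀ + (∑ i, bil k n (f i) v • e i) + ∑ i, bil k n (e i) v • f i := by
        simp only [v₀]; abel
      rw [bil_comm] at h1
      rw [bil_comm, h2]
      simp [h1, (ha _).1, (ha _).2]
    rw [ha0, map_zero, LinearMap.zero_apply]

/-- The weights of the cocharacter on the orthogonal complement of the span of `e` are non-negative.
There `T` may be replaced by the sum of weight projections, whose trace form is invariant under the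
cocharacter and so pairs only opposite weights; what remains are the vectors of weight zero. -/
theorem IsHyperbolic.traceForm_eq_zero (h : IsHyperbolic e f)
    (hμ : IsCocharacterOn e f Finset.univ μ)
    (hA : ∀ m ∈ P.support, ∀ j ∈ A, j ≤ m → m ∈ A) (hAP : A ⊆ P.support)
    (hTE : T * ∑ m ∈ A, P m = ∑ m ∈ A, P m) (hET : (∑ m ∈ A, P m) * T = T)
    {a b : Fin (2 * n + 1) → k} (ha : ∀ i, bil k n (e i) a = 0) (hb : ∀ i, bil k n (e i) b = 0) :
    traceForm dF T a b = 0 := by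
  have hdec : ∀ u, (∀ i, bil k n (e i) u = 0) → ∃ u₀, (∀ i, bil k n (e i) u₀ = 0 ∧
      bil k n (f i) u₀ = 0) ∧ u = u₀ + ∑ i, bil k n (f i) u • e i := by
    intro u hu
    refine ⟨u - ∑ i, bil k n (f i) u • e i, fun i => ?_, (sub_add_cancel _ _).symm⟩
    simp only [map_sub, map_sum, map_smul, h.left, h.dual, bil_comm (f i) (e _), hu]
    simp
  obtain ⟨a₀, ha₀, haeq⟩ := hdec a ha
  obtain ⟨b₀, hb₀, hbeq⟩ := hdec b hb
  have w0 : ∀ u, (∀ i, bil k n (e i) u = 0 ∧ bil k n (f i) u = 0) →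
      ∀ t, std k n (μ t) u = ((t ^ (0 : ℤ) : kˣ) : k) • u := fun u hu t => by
    rw [hμ.std_orthogonal u fun i _ => hu i]; simp
  have w2 : ∀ i t, std k n (μ t) (e i) = ((t ^ (2 : ℤ) : kˣ) : k) • e i := fun i =>
    hμ.std_left i (Finset.mem_univ i)
  have h00 : traceForm dF T a₀ b₀ = 0 := by
    rw [traceForm_eq_of_weight hdF hP hA hAP hTE hET (w0 _ ha₀) (w0 _ hb₀) (by norm_num)]
    exact h.traceForm_eq_zero_of_orthogonal hdF hP hμ ha₀
  have h20 : ∀ i u, (∀ i, bil k n (e i) u = 0 ∧ bil k n (f i) u = 0) →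
      traceForm dF T (e i) u = 0 := fun i u hu => by
    rw [traceForm_eq_of_weight hdF hP hA hAP hTE hET (w2 i) (w0 _ hu) (by norm_num)]
    exact traceForm_eq_zero_of_weight hdF hP (w2 i) (w0 _ hu) (by norm_num)
  have h22 : ∀ i j, traceForm dF T (e i) (e j) = 0 := fun i j => by
    rw [traceForm_eq_of_weight hdF hP hA hAP hTE hET (w2 i) (w2 j) (by norm_num)]
    exact traceForm_eq_zero_of_weight hdF hP (w2 i) (w2 j) (by norm_num)
  have h02 : ∀ i, traceForm dF T a₀ (e i) = 0 := fun i => by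
    rw [traceForm_swap, h20 i _ ha₀, neg_zero]
  rw [haeq, hbeq]
  simp only [map_add, map_sum, map_smul, LinearMap.add_apply, LinearMap.sum_apply,
    LinearMap.smul_apply, h00, h02, h22, h20 _ _ hb₀]
  simp

end TraceForm

section Std

variable {k : Type*} [NontriviallyNormedField k] [CharZero k] {n N : ℕ} {Γ : Type*} [Group Γ]

theorem bil_isRefl : (bil k n).IsRefl := fun v w h => by rw [bil_comm, h]

theorem isStable_orthogonal {ρ : Representation k Γ (Fin (2 * n + 1) → k)}
    (hρ : ∀ σ v w, bil k n (ρ σ v) (ρ σ w) = bil k n v w) {U : Submodule k (Fin (2 * n + 1) → k)}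
    (hU : IsStable ρ U) : IsStable ρ ((bil k n).orthogonal U) := by
  intro σ w hw u hu
  have h : ρ σ (ρ σ⁻¹ u) = u := by
    rw [← Module.End.mul_apply, ← map_mul, mul_inv_cancel, map_one, Module.End.one_apply]
  change bil k n u (ρ σ w) = 0
  rw [← h, hρ]
  exact hw _ (hU _ u hu)

/-- An invariant skew-symmetric form which vanishes on `U^⊥`, but not on `U × V`, splits the minimal
stable totally isotropic subspace `U`. With respect to `bil` the form is given by an
endomorphism `X`; it acts on `U` as a scalar `c`, and `X (X + c)` maps `V` to `U`. -/
theorem exists_stable_complement_of_form [IsAlgClosed k]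
    {ρ : Representation k Γ (Fin (2 * n + 1) → k)}
    (hρ : ∀ σ v w, bil k n (ρ σ v) (ρ σ w) = bil k n v w) {U : Submodule k (Fin (2 * n + 1) → k)}
    (hU : IsMinimalStable ρ U) (hiso : U ≤ (bil k n).orthogonal U)
    {β : LinearMap.BilinForm k (Fin (2 * n + 1) → k)}
    (hβ : ∀ σ v w, β (ρ σ v) (ρ σ w) = β v w) (hskew : ∀ v w, β v w = -β w v)
    (h0 : ∀ v ∈ (bil k n).orthogonal U, ∀ w ∈ (bil k n).orthogonal U, β v w = 0)
    (hne : ∃ u ∈ U, ∃ v, β u v ≠ 0) : ∃ U', IsStable ρ U' ∧ IsCompl U U' := by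
  let X : Module.End k (Fin (2 * n + 1) → k) :=
    (LinearMap.BilinForm.toDual (bil k n) bil_nondegenerate).symm.toLinearMap ∘ₗ β
  have hX : ∀ v w, bil k n (X v) w = β v w := fun v w => by
    rw [← LinearMap.BilinForm.toDual_def bil_nondegenerate]
    exact LinearMap.congr_fun (LinearEquiv.apply_symm_apply _ (β v)) w
  have hXskew : ∀ v w, bil k n (X v) w = -bil k n v (X w) := fun v w => by
    rw [hX, hskew, bil_comm v, hX]
  have hcancel : ∀ v w, (∀ u, bil k n v u = bil k n w u) → v = w := fun v w h => by
    rw [← sub_eq_zero]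
    exact eq_zero_of_bil_eq_zero fun u => by rw [map_sub, LinearMap.sub_apply, h, sub_self]
  have hXρ : ∀ σ, Commute X (ρ σ) := fun σ => LinearMap.ext fun v => hcancel _ _ fun u => by
    have h : ρ σ (ρ σ⁻¹ u) = u := by
      rw [← Module.End.mul_apply, ← map_mul, mul_inv_cancel, map_one, Module.End.one_apply]
    change bil k n (X (ρ σ v)) u = bil k n (ρ σ (X v)) u
    rw [← h, hX, hβ, hρ, hX]
  have hXorth : ∀ v ∈ (bil k n).orthogonal U, X v ∈ U := fun v hv => by
    rw [← LinearMap.BilinForm.orthogonal_orthogonal bil_nondegenerate bil_isRefl U]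
    intro w hw
    change bil k n w (X v) = 0
    rw [bil_comm, hX]
    exact h0 v hv w hw
  obtain ⟨c, hc⟩ := hU.exists_eq_smul hXρ fun u hu => hXorth u (hiso hu)
  have hc0 : c ≠ 0 := by
    rintro rfl
    obtain ⟨u, hu, v, huv⟩ := hne
    apply huv
    rw [← hX, hc u hu, zero_smul, map_zero, LinearMap.zero_apply]
  let R : Module.End k (Fin (2 * n + 1) → k) := X * (X + c • (1 : Module.End k _))
  have hRU : ∀ v, R v ∈ U := fun v => hXorth _ fun u hu => by
    change bil k n u (X v + c • v) = 0
    rw [bil_comm, map_add, LinearMap.add_apply, hXskew, hc u hu, map_smul, map_smul,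
      LinearMap.smul_apply, neg_add_cancel]
  have hRu : ∀ u ∈ U, R u = (2 * c * c) • u := fun u hu => by
    change X (X u + c • u) = _
    rw [hc u hu, map_add, map_smul, hc u hu, smul_smul, ← add_smul]
    congr 1; ring
  have h2c : 2 * c * c ≠ 0 := mul_ne_zero (mul_ne_zero two_ne_zero hc0) hc0
  refine ⟨R.ker, IsStable.ker fun σ => (hXρ σ).mul_left
    ((hXρ σ).add_left ((Commute.one_left _).smul_left c)), ?_⟩
  rw [isCompl_iff, Submodule.disjoint_def, codisjoint_iff, eq_top_iff]
  constructor
  · intro u hu hu'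
    rw [LinearMap.mem_ker, hRu u hu] at hu'
    exact (smul_eq_zero.1 hu').resolve_left h2c
  · intro v _
    have h : v = (2 * c * c)⁻¹ • R v + (v - (2 * c * c)⁻¹ • R v) := by abel
    rw [h]
    refine Submodule.add_mem_sup (Submodule.smul_mem _ _ (hRU v)) ?_
    rw [LinearMap.mem_ker, map_sub, map_smul, hRu _ (hRU v), smul_smul, inv_mul_cancel₀ h2c,
      one_smul, sub_self]

/-- The trace of the differential of the cocharacter on a sum of weight spaces. -/
theorem trace_sum_proj_mul_differential {R : Representation k (GSpin k n) (Fin N → k)}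
    {dF : CliffEven k n →ₗ[k] Module.End k (Fin N → k)}
    (hdF : ∀ (γ : k → GSpin k n) (t₀ : k) (Y : CliffEven k n), IsTangent γ t₀ Y →
      ∀ L : Module.Dual k (Module.End k (Fin N → k)),
        HasDerivAt (fun t => L (R (γ t))) (L (dF Y)) t₀)
    {μ : kˣ →* GSpin k n} {Y : CliffEven k n} (hμ : IsTangent (curve μ) 1 Y)
    {P : ℤ →₀ Module.End k (Fin N → k)}
    (hP : IsWeightDecomposition ((R : GSpin k n →* _).comp μ) P) (A : Finset ℤ) :
    LinearMap.trace k (Fin N → k) ((∑ m ∈ A, P m) * dF Y) =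
      ∑ m ∈ A, (m : k) * LinearMap.trace k (Fin N → k) (P m) := by
  have h1 := hdF _ _ _ hμ (LinearMap.trace k (Fin N → k) ∘ₗ LinearMap.mulLeft k (∑ m ∈ A, P m))
  have h2 : HasDerivAt (fun t : k => ∑ m ∈ A, t ^ m * LinearMap.trace k (Fin N → k) (P m))
      (∑ m ∈ A, (m : k) * LinearMap.trace k (Fin N → k) (P m)) 1 := by
    refine HasDerivAt.fun_sum fun m _ => ?_
    refine ((hasDerivAt_zpow m (1 : k) (Or.inl one_ne_zero)).mul_const _).congr_deriv ?_
    rw [one_zpow, mul_one]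
  refine h1.unique (h2.congr_of_eventuallyEq ?_)
  have hev : ∀ᶠ t in nhds (1 : k), t ≠ 0 := continuousAt_id.eventually_ne one_ne_zero
  filter_upwards [hev] with t ht
  rw [curve, dif_neg ht, LinearMap.comp_apply, LinearMap.mulLeft_apply, Finset.sum_mul, map_sum]
  refine Finset.sum_congr rfl fun m _ => ?_
  have h3 : P m * R (μ (Units.mk0 t ht)) = ((Units.mk0 t ht ^ m : kˣ) : k) • P m := hP.eq_mul _ m
  rw [h3, map_smul, smul_eq_mul, Units.val_zpow_eq_zpow_val, Units.val_mk0]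

/-- A minimal stable subspace of `V` which is totally isotropic has a stable complement, if some
faithful algebraic representation of the general spin group is semisimple on `Γ`. -/
theorem exists_stable_complement_of_isotropic [IsAlgClosed k] {r : Γ →* GSpin k n}
    {R : Representation k (GSpin k n) (Fin N → k)} (hR : IsAlgebraicRep R)
    (hinj : Function.Injective R)
    (hss : Representation.IsSemisimpleRepresentation (R.comp r))
    {U : Submodule k (Fin (2 * n + 1) → k)}
    (hU : IsMinimalStable ((std k n).comp r) U) (hiso : U ≤ (bil k n).orthogonal U) :
    ∃ U', IsStable ((std k n).comp r) U' ∧ IsCompl U U' := by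
  classical
  obtain ⟨e, f, hef, hspan⟩ := exists_isHyperbolic U fun u hu v hv => hiso hv u hu
  obtain ⟨μ, hμ⟩ := hef.exists_isCocharacterOn Finset.univ
  obtain ⟨dF, hdF⟩ := exists_differential_rep hR
  have hdF' := fun x a b => differential_evenMul_std hdF x a b
  obtain ⟨P, hP⟩ := exists_isWeightDecomposition ((R : GSpin k n →* _).comp μ)
    (rep_cocharacter_mem_laurent hR hμ.mem_laurent)
  have hρ : (R : GSpin k n →* _).comp μ ≠ 1 := by
    intro h
    obtain ⟨i⟩ : Nonempty (Fin (Module.finrank k U)) := by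
      by_contra hemp
      rw [not_nonempty_iff] at hemp
      refine hU.ne_bot ?_
      rw [← hspan, Set.range_eq_empty, Submodule.span_empty]
    have h1 : μ (Units.mk0 2 two_ne_zero) = 1 := hinj (by
      rw [map_one]; exact DFunLike.congr_fun h _)
    have h2 := hμ.std_left i (Finset.mem_univ i) (Units.mk0 2 two_ne_zero)
    rw [h1, map_one, Module.End.one_apply] at h2
    have h3 := congrArg (fun v => bil k n v (f i)) h2
    simp only [map_smul, LinearMap.smul_apply, hef.dual, if_pos, smul_eq_mul, mul_one] at h3
    norm_num at h3
  obtain ⟨A, hAP, hA, htr⟩ := hP.exists_trace_ne_zero hρ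
  have hmem : ∀ σ i, std k n (r σ) (e i) ∈ Submodule.span k (Set.range e) := fun σ i => by
    rw [hspan]
    refine hU.stable σ _ ?_
    rw [← hspan]
    exact Submodule.subset_span ⟨i, rfl⟩
  have hEst : IsStable (R.comp r) (∑ m ∈ A, P m).range := by
    rintro σ _ ⟨w, rfl⟩
    have h := hP.sum_mul_sum_eq hA hAP (x := R (r σ)) fun m j hmj =>
      hef.proj_mul_mul_proj_eq_zero hμ hR hP (hmem σ)
        (fun i => by rw [← map_inv]; exact hmem σ⁻¹ i) hmj
    have h' := LinearMap.congr_fun h w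
    exact ⟨_, h'⟩
  obtain ⟨T, hTρ, hTmem, hTid⟩ := exists_equivariant_projection hss hEst
  have hTE : T * ∑ m ∈ A, P m = ∑ m ∈ A, P m :=
    LinearMap.ext fun w => hTid _ ⟨w, rfl⟩
  have hET : (∑ m ∈ A, P m) * T = T := LinearMap.ext fun w => by
    obtain ⟨w', hw'⟩ := hTmem w
    rw [Module.End.mul_apply, ← hw', ← Module.End.mul_apply, hP.sum_idem]
  have horth : ∀ v ∈ (bil k n).orthogonal U, ∀ i, bil k n (e i) v = 0 := fun v hv i =>
    hv (e i) (hspan ▸ Submodule.subset_span ⟨i, rfl⟩)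
  refine exists_stable_complement_of_form (ρ := (std k n).comp r)
    (fun σ v w => bil_std (r σ) v w) hU hiso (β := traceForm dF T)
    (fun σ v w => traceForm_std hdF' (x := r σ) (hTρ σ) v w) (traceForm_swap T)
    (fun v hv w hw => hef.traceForm_eq_zero hdF' hP hμ hA hAP hTE hET (horth v hv) (horth w hw)) ?_
  by_contra! hall
  apply htr
  rw [← trace_sum_proj_mul_differential hdF hμ.isTangent hP A, map_sum, Finset.mul_sum, map_sum]
  refine Finset.sum_eq_zero fun i _ => ?_
  rw [← traceForm_apply, ← traceForm_eq_of_weight hdF' hP hA hAP hTE hET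
    (hμ.std_left i (Finset.mem_univ i)) (hμ.std_right i (Finset.mem_univ i)) (by norm_num)]
  exact hall _ (hspan ▸ Submodule.subset_span ⟨i, rfl⟩) _

/-- If some faithful algebraic representation of the general spin group is semisimple on `Γ`, then so
is the standard representation. -/
theorem isSemisimple_std_comp [IsAlgClosed k] {r : Γ →* GSpin k n}
    {R : Representation k (GSpin k n) (Fin N → k)} (hR : IsAlgebraicRep R)
    (hinj : Function.Injective R)
    (hss : Representation.IsSemisimpleRepresentation (R.comp r)) :
    Representation.IsSemisimpleRepresentation ((std k n).comp r) := by
  refine isSemisimpleRepresentation_of_minimal fun U hU => ?_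
  have hst := isStable_orthogonal (ρ := (std k n).comp r) (fun σ v w => bil_std (r σ) v w) hU.stable
  rcases hU.eq_bot_or_eq _ (hU.stable.inf hst) inf_le_left with h | h
  · exact ⟨_, hst, (LinearMap.BilinForm.isCompl_orthogonal_iff_disjoint bil_isRefl).2
      (disjoint_iff.2 h)⟩
  · exact exists_stable_complement_of_isotropic hR hinj hss hU (inf_eq_left.1 h)

end Std

/-! ### Semisimple representations are determined by their traces -/

section Traces

open Module

variable {k R : Type*} [Field k] [CharZero k] [Ring R] [Algebra k R]

/-- The trace of a ring element on a module. -/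
noncomputable def moduleTrace (k : Type*) {R : Type*} [Field k] [Ring R] [Algebra k R] (M : Type*)
    [AddCommGroup M] [Module k M] [Module R M] [IsScalarTower k R M] (r : R) : k :=
  LinearMap.trace k M (Algebra.lsmul k k M r)

variable {M N : Type*} [AddCommGroup M] [Module k M] [Module R M] [IsScalarTower k R M]
  [AddCommGroup N] [Module k N] [Module R N] [IsScalarTower k R N]

theorem moduleTrace_congr (e : M ≃ₗ[R] N) (r : R) : moduleTrace k M r = moduleTrace k N r := by
  rw [moduleTrace, moduleTrace, ← LinearMap.trace_conj' _ (e.restrictScalars k)]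
  congr 1
  ext x
  simp [LinearEquiv.conj_apply]

variable [FiniteDimensional k M] [FiniteDimensional k N]

theorem moduleTrace_of_isCompl {K C : Submodule R M} (h : IsCompl K C) (r : R) :
    moduleTrace k M r = moduleTrace k K r + moduleTrace k C r := by
  have : FiniteDimensional k K := inferInstanceAs (FiniteDimensional k (K.restrictScalars k))
  have : FiniteDimensional k C := inferInstanceAs (FiniteDimensional k (C.restrictScalars k))
  rw [← moduleTrace_congr (Submodule.prodEquivOfIsCompl K C h) r]
  exact LinearMap.trace_prodMap' (R := k) (Algebra.lsmul k k K r) (Algebra.lsmul k k C r)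

/-- Two semisimple modules with the same traces, without non-zero maps between them, vanish: by
Jacobson's density theorem some element acts as the identity on the first and as zero on the
second. -/
theorem finrank_eq_zero_of_moduleTrace_eq [IsSemisimpleModule R M] [IsSemisimpleModule R N]
    (htr : ∀ r : R, moduleTrace k M r = moduleTrace k N r) (h : ∀ φ : M →ₗ[R] N, φ = 0) :
    finrank k M = 0 := by
  have h' : ∀ ψ : N →ₗ[R] M, ψ = 0 := by
    intro ψ
    obtain ⟨s, hs⟩ := IsSemisimpleModule.lifting_property ψ.rangeRestrict
      ψ.surjective_rangeRestrict LinearMap.id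
    obtain ⟨t, ht⟩ := IsSemisimpleModule.extension_property ψ.range.subtype
      ψ.range.subtype_injective s
    rw [h t, LinearMap.zero_comp] at ht
    rw [← ht, LinearMap.comp_zero] at hs
    ext x
    have := LinearMap.congr_fun hs (ψ.rangeRestrict x)
    exact (congrArg Subtype.val this).symm
  have hprod : IsSemisimpleModule R (M × N) := by
    rw [← Submodule.topEquiv.isSemisimpleModule_iff, ← LinearMap.sup_range_inl_inr]
    exact .sup (.range _) (.range _)
  let f : End (End R (M × N)) (M × N) :=
    { toFun := fun x => (x.1, 0)
      map_add' := fun x y => by simp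
      map_smul' := fun g x => by
        have h1 : (g (x.1, 0)).2 = 0 :=
          LinearMap.congr_fun (h (LinearMap.snd R M N ∘ₗ g ∘ₗ LinearMap.inl R M N)) x.1
        have h2 : (g (0, x.2)).1 = 0 :=
          LinearMap.congr_fun (h' (LinearMap.fst R M N ∘ₗ g ∘ₗ LinearMap.inr R M N)) x.2
        have h3 : g x = g (x.1, 0) + g (0, x.2) := by rw [← map_add]; simp
        change ((g x).1, (0 : N)) = g (x.1, 0)
        refine Prod.ext ?_ h1.symm
        rw [h3, Prod.fst_add, h2, add_zero] }
  let b := finBasis k (M × N)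
  classical
  obtain ⟨r, hr⟩ := jacobson_density f (Finset.univ.image b)
  have hr' : ∀ x : M × N, r • x = (x.1, 0) := by
    intro x
    have : Algebra.lsmul k k (M × N) r = LinearMap.prodMap (LinearMap.id : M →ₗ[k] M) 0 :=
      b.ext fun i => (hr (b i) (Finset.mem_image_of_mem _ (Finset.mem_univ i))).symm
    exact LinearMap.congr_fun this x
  have hM : moduleTrace k M r = finrank k M := by
    have : Algebra.lsmul k k M r = LinearMap.id :=
      LinearMap.ext fun x => congrArg Prod.fst (hr' (x, 0))
    rw [moduleTrace, this, LinearMap.trace_id]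
  have hN : moduleTrace k N r = 0 := by
    have : Algebra.lsmul k k N r = 0 :=
      LinearMap.ext fun x => congrArg Prod.snd (hr' (0, x))
    rw [moduleTrace, this, map_zero]
  have := htr r
  rw [hM, hN] at this
  exact_mod_cast this

/-- Semisimple modules with the same trace function are isomorphic: unless both are zero, there is a
non-zero homomorphism between them, and its image splits off from both. -/
theorem nonempty_linearEquiv_of_moduleTrace_eq [IsSemisimpleModule R M] [IsSemisimpleModule R N]
    (htr : ∀ r : R, moduleTrace k M r = moduleTrace k N r) : Nonempty (M ≃ₗ[R] N) := by
  induction hd : finrank k M using Nat.strong_induction_on generalizing M N with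
  | _ d ih =>
    by_cases h : ∀ φ : M →ₗ[R] N, φ = 0
    · have h0 := finrank_eq_zero_of_moduleTrace_eq htr h
      have h1 : (finrank k M : k) = finrank k N := by
        have := htr 1
        rwa [moduleTrace, moduleTrace, map_one (Algebra.lsmul k k M),
          map_one (Algebra.lsmul k k N), LinearMap.trace_one, LinearMap.trace_one] at this
      have h2 : finrank k N = 0 := by rw [← h0]; exact_mod_cast h1.symm
      have := finrank_zero_iff.1 h0
      have := finrank_zero_iff.1 h2
      exact ⟨0⟩
    · push Not at h
      obtain ⟨φ, hφ⟩ := h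
      obtain ⟨C, hC⟩ := exists_isCompl φ.ker
      obtain ⟨D, hD⟩ := exists_isCompl φ.range
      have e : C ≃ₗ[R] φ.range :=
        (Submodule.quotientEquivOfIsCompl _ C hC).symm ≪≫ₗ φ.quotKerEquivRange
      have : FiniteDimensional k φ.ker :=
        inferInstanceAs (FiniteDimensional k (φ.ker.restrictScalars k))
      have : FiniteDimensional k D :=
        inferInstanceAs (FiniteDimensional k (D.restrictScalars k))
      have htr' : ∀ r : R, moduleTrace k φ.ker r = moduleTrace k D r := by
        intro r
        have := htr r
        rw [moduleTrace_of_isCompl hC, moduleTrace_of_isCompl hD, moduleTrace_congr e,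
          add_comm] at this
        exact add_left_cancel this
      have hlt : finrank k φ.ker < d := by
        rw [← hd]
        refine Submodule.finrank_lt (s := φ.ker.restrictScalars k) fun htop => hφ ?_
        ext x
        have : x ∈ φ.ker.restrictScalars k := by rw [htop]; trivial
        exact this
      obtain ⟨e'⟩ := ih _ hlt htr' rfl
      exact ⟨(Submodule.prodEquivOfIsCompl _ _ hC).symm ≪≫ₗ (e'.prodCongr e) ≪≫ₗ
        LinearEquiv.prodComm R _ _ ≪≫ₗ Submodule.prodEquivOfIsCompl _ _ hD⟩

/-- Semisimple representations in characteristic zero with the same character are isomorphic. -/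
theorem exists_intertwiner_of_trace_eq {Γ V : Type*} [Group Γ] [AddCommGroup V] [Module k V]
    [FiniteDimensional k V] {ρ₁ ρ₂ : Representation k Γ V} (h₁ : ρ₁.IsSemisimpleRepresentation)
    (h₂ : ρ₂.IsSemisimpleRepresentation)
    (htr : ∀ σ, LinearMap.trace k V (ρ₁ σ) = LinearMap.trace k V (ρ₂ σ)) :
    ∃ A : V ≃ₗ[k] V, ∀ σ v, A (ρ₁ σ v) = ρ₂ σ (A v) := by
  have := Representation.isSemisimpleRepresentation_iff_isSemisimpleModule_asModule ρ₁ |>.1 h₁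
  have := Representation.isSemisimpleRepresentation_iff_isSemisimpleModule_asModule ρ₂ |>.1 h₂
  have htr' : ∀ ρ : Representation k Γ V, ∀ r : MonoidAlgebra k Γ,
      moduleTrace k ρ.asModule r = LinearMap.trace k V (ρ.asAlgebraHom r) := fun ρ r => rfl
  obtain ⟨e⟩ := nonempty_linearEquiv_of_moduleTrace_eq (k := k) (R := MonoidAlgebra k Γ)
    (M := ρ₁.asModule) (N := ρ₂.asModule) fun r => by
      rw [htr', htr']
      induction r using MonoidAlgebra.induction_linear with
      | zero => simp
      | add x y hx hy => rw [map_add, map_add, map_add, map_add, hx, hy]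
      | single σ a =>
        rw [Representation.asAlgebraHom_single, Representation.asAlgebraHom_single, map_smul,
          map_smul, htr]
  let A : V ≃ₗ[k] V := ρ₁.asModuleEquiv.symm ≪≫ₗ e.restrictScalars k ≪≫ₗ ρ₂.asModuleEquiv
  refine ⟨A, fun σ v => ?_⟩
  have h := e.map_smul (MonoidAlgebra.single σ (1 : k)) (ρ₁.asModuleEquiv.symm v)
  rw [Representation.single_smul, Representation.single_smul, one_smul, one_smul] at h
  exact h

end Traces

/-! ### Square roots and orthogonal intertwiners -/

section SquareRoot

open Polynomial

variable {k : Type*} [Field k] [CharZero k] [IsAlgClosed k]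

/-- The polynomial interpolates square roots of the eigenvalues of `S`. -/
theorem exists_polynomial_sq_sub_isNilpotent {V : Type*} [AddCommGroup V] [Module k V]
    [FiniteDimensional k V] (S : Module.End k V) :
    ∃ q : k[X], IsNilpotent (aeval S (q ^ 2 - X)) := by
  classical
  choose w hw using fun a : k => IsAlgClosed.exists_pow_nat_eq a zero_lt_two
  let m := minpoly k S
  let q := Lagrange.interpolate m.roots.toFinset id w
  refine ⟨q, Multiset.card m.roots, ?_⟩
  rw [← map_pow]
  have hdvd : m ∣ (q ^ 2 - X) ^ Multiset.card m.roots := by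
    have hm : m = (m.roots.map fun a => X - C a).prod :=
      (IsAlgClosed.splits m).eq_prod_roots_of_monic
        (minpoly.monic (Algebra.IsIntegral.isIntegral S))
    conv_lhs => rw [hm]
    rw [← Multiset.prod_replicate, ← Multiset.map_const']
    refine Multiset.prod_dvd_prod_of_dvd _ _ fun a ha => ?_
    have hq : eval a q = w a := Lagrange.eval_interpolate_at_node (v := id) (i := a) w
      (Set.injOn_id _) (Multiset.mem_toFinset.2 ha)
    rw [dvd_iff_isRoot, IsRoot.def, eval_sub, eval_pow, eval_X, hq, hw, sub_self]
  obtain ⟨g, hg⟩ := hdvd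
  rw [hg, map_mul, minpoly.aeval, zero_mul]

/-- An invertible endomorphism has a square root which is a polynomial in it: a square root up to a
nilpotent error is improved by Newton iteration in the algebra generated by the endomorphism. -/
theorem exists_polynomial_sqrt {V : Type*} [AddCommGroup V] [Module k V]
    [FiniteDimensional k V] (S : (Module.End k V)ˣ) :
    ∃ p : k[X], aeval (S : Module.End k V) p * aeval (S : Module.End k V) p = S := by
  obtain ⟨q, hq⟩ := exists_polynomial_sq_sub_isNilpotent (S : Module.End k V)
  let B := Algebra.adjoin k {(S : Module.End k V)}
  let s : B := ⟨S, Algebra.self_mem_adjoin_singleton k _⟩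
  obtain ⟨g, hg⟩ := exists_aeval_eq_inv (k := k) S
  have hcoe : ∀ p : k[X], ((aeval s p : B) : Module.End k V) = aeval (S : Module.End k V) p :=
    fun p => (aeval_algHom_apply B.val s p).symm
  have hs : IsUnit s := by
    refine IsUnit.of_mul_eq_one (aeval s g) (Subtype.ext ?_)
    change (S : Module.End k V) * ((aeval s g : B) : Module.End k V) = 1
    rw [hcoe, hg, Units.mul_inv]
  let x : B := aeval s q
  have hnil : IsNilpotent (x ^ 2 - s) := by
    obtain ⟨j, hj⟩ := hq
    refine ⟨j, Subtype.ext ?_⟩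
    have h : x ^ 2 - s = aeval s (q ^ 2 - X) := by simp [x]
    rw [h]
    change ((aeval s (q ^ 2 - X) : B) : Module.End k V) ^ j = 0
    rw [hcoe, hj]
  have hx : IsUnit x := by
    have : IsUnit (x ^ 2) := by
      have h := hnil.isUnit_add_left_of_commute hs (Commute.all _ _)
      rwa [add_sub_cancel] at h
    exact (isUnit_pow_iff two_ne_zero).1 this
  obtain ⟨y, ⟨-, hy⟩, -⟩ := existsUnique_nilpotent_sub_and_aeval_eq_zero
    (P := (X ^ 2 - C s : B[X])) (x := x) (by simpa using hnil) (by
      have h2 : IsUnit (2 : B) := by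
        have := (IsUnit.mk0 (2 : k) two_ne_zero).map (algebraMap k B)
        rwa [map_ofNat] at this
      simpa [one_add_one_eq_two] using h2.mul hx)
  have hmem : (y : Module.End k V) ∈ Algebra.adjoin k {(S : Module.End k V)} := y.2
  rw [Algebra.adjoin_singleton_eq_range_aeval] at hmem
  obtain ⟨p, hp⟩ := hmem
  refine ⟨p, ?_⟩
  have hy' : y ^ 2 = s := by simpa [sub_eq_zero] using hy
  have := congrArg (Subtype.val : B → Module.End k V) hy'
  rw [pow_two] at this
  have hp' : aeval (S : Module.End k V) p = y := hp
  rw [hp']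
  exact this

end SquareRoot

section Orthogonal

open Polynomial

variable {k : Type*} [NontriviallyNormedField k] [CharZero k] [IsAlgClosed k] {n : ℕ}
  {Γ : Type*} [Group Γ]

/-- Isomorphic orthogonal representations are isomorphic by an isometry: an intertwiner is corrected by
a square root of `A^* A`. -/
theorem exists_isometry_intertwiner {ρ₁ ρ₂ : Representation k Γ (Fin (2 * n + 1) → k)}
    (h₁ : ∀ σ v w, bil k n (ρ₁ σ v) (ρ₁ σ w) = bil k n v w)
    (h₂ : ∀ σ v w, bil k n (ρ₂ σ v) (ρ₂ σ w) = bil k n v w)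
    (A : (Fin (2 * n + 1) → k) ≃ₗ[k] (Fin (2 * n + 1) → k))
    (hA : ∀ σ v, A (ρ₁ σ v) = ρ₂ σ (A v)) :
    ∃ O : Module.End k (Fin (2 * n + 1) → k), (∀ v w, bil k n (O v) (O w) = bil k n v w) ∧
      ∀ σ v, O (ρ₁ σ v) = ρ₂ σ (O v) := by
  let S : Module.End k (Fin (2 * n + 1) → k) :=
    (LinearMap.BilinForm.toDual (bil k n) bil_nondegenerate).symm.toLinearMap ∘ₗ
      ((bil k n).compl₁₂ A.toLinearMap A.toLinearMap)
  have hS : ∀ v w, bil k n (S v) w = bil k n (A v) (A w) := fun v w => by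
    rw [← LinearMap.BilinForm.toDual_def bil_nondegenerate]
    exact LinearMap.congr_fun (LinearEquiv.apply_symm_apply _ _) w
  have hcancel : ∀ v w, (∀ u, bil k n v u = bil k n w u) → v = w := fun v w h => by
    rw [← sub_eq_zero]
    exact eq_zero_of_bil_eq_zero fun u => by rw [map_sub, LinearMap.sub_apply, h, sub_self]
  have hSinj : Function.Injective S := by
    rw [← LinearMap.ker_eq_bot, Submodule.eq_bot_iff]
    intro v hv
    rw [LinearMap.mem_ker] at hv
    have : A v = 0 := eq_zero_of_bil_eq_zero fun w => by
      rw [← A.apply_symm_apply w, ← hS, hv, map_zero, LinearMap.zero_apply]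
    exact (map_eq_zero_iff A A.injective).1 this
  have hSu : IsUnit S := (Module.End.isUnit_iff S).2
    ⟨hSinj, LinearMap.surjective_of_injective hSinj⟩
  have hSρ : ∀ σ, Commute S (ρ₁ σ) := fun σ => LinearMap.ext fun v => hcancel _ _ fun u => by
    have h : ρ₁ σ (ρ₁ σ⁻¹ u) = u := by
      rw [← Module.End.mul_apply, ← map_mul, mul_inv_cancel, map_one, Module.End.one_apply]
    change bil k n (S (ρ₁ σ v)) u = bil k n (ρ₁ σ (S v)) u
    rw [← h, hS, h₁, hS, hA, hA, h₂]
  obtain ⟨p, hp⟩ := exists_polynomial_sqrt hSu.unit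
  rw [IsUnit.unit_spec] at hp
  obtain ⟨B, hBdef⟩ : ∃ B, B = aeval S p := ⟨_, rfl⟩
  rw [← hBdef] at hp
  have hBρ : ∀ σ, Commute B (ρ₁ σ) := fun σ => by
    rw [hBdef]
    exact Algebra.commute_of_mem_adjoin_singleton_of_commute
      (aeval_mem_adjoin_singleton k S) (hSρ σ).symm |>.symm
  have hBself : ∀ v w, bil k n (B v) w = bil k n v (B w) := by
    have hpow : ∀ j : ℕ, ∀ v w, bil k n ((S ^ j) v) w = bil k n v ((S ^ j) w) := by
      intro j
      induction j with
      | zero => intro v w; rfl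
      | succ j ih =>
        intro v w
        rw [pow_succ, Module.End.mul_apply, ih, hS, ← (Commute.pow_self S j).eq.symm,
          Module.End.mul_apply, bil_comm v, hS, bil_comm]
    intro v w
    rw [hBdef, aeval_eq_sum_range]
    simp [hpow]
  have hBu : IsUnit B := by
    have h : IsUnit (B * B) := hp ▸ hSu
    exact (Commute.isUnit_mul_iff (Commute.refl B)).1 h |>.1
  obtain ⟨b, rfl⟩ := hBu
  have hb : ∀ v, (b : Module.End k (Fin (2 * n + 1) → k))
      ((↑b⁻¹ : Module.End k (Fin (2 * n + 1) → k)) v) = v := fun v => by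
    rw [← Module.End.mul_apply, Units.mul_inv, Module.End.one_apply]
  refine ⟨A.toLinearMap ∘ₗ (↑b⁻¹ : Module.End k (Fin (2 * n + 1) → k)), fun v w => ?_,
    fun σ v => ?_⟩
  · change bil k n (A _) (A _) = _
    rw [← hS, ← hp, Module.End.mul_apply, hBself, hb, hb]
  · change A ((↑b⁻¹ : Module.End k (Fin (2 * n + 1) → k)) (ρ₁ σ v)) =
      ρ₂ σ (A ((↑b⁻¹ : Module.End k (Fin (2 * n + 1) → k)) v))
    rw [← hA]
    congr 1
    exact LinearMap.congr_fun ((hBρ σ).units_inv_left).eq v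

/-- Two homomorphisms to the general spin group with semisimple standard representations of equal
traces become equal in the special orthogonal group after conjugation. -/
theorem exists_std_conj_eq {r₁ r₂ : Γ →* GSpin k n}
    (h₁ : Representation.IsSemisimpleRepresentation ((std k n).comp r₁))
    (h₂ : Representation.IsSemisimpleRepresentation ((std k n).comp r₂))
    (htr : ∀ σ, LinearMap.trace k _ (std k n (r₁ σ)) = LinearMap.trace k _ (std k n (r₂ σ))) :
    ∃ g : GSpin k n, ∀ σ, std k n (r₂ σ) = std k n (g * r₁ σ * g⁻¹) := by
  obtain ⟨A, hA⟩ := exists_intertwiner_of_trace_eq h₁ h₂ htr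
  obtain ⟨O, hO, hOρ⟩ := exists_isometry_intertwiner (ρ₁ := (std k n).comp r₁)
    (ρ₂ := (std k n).comp r₂) (fun σ => bil_std (r₁ σ)) (fun σ => bil_std (r₂ σ)) A hA
  obtain ⟨g, hg⟩ := liftsUpToSign_of_isometry O hO
  have hg' : ∀ σ v, std k n g (std k n (r₁ σ) v) = std k n (r₂ σ) (std k n g v) := by
    intro σ v
    have h3 : O (std k n (r₁ σ) v) = std k n (r₂ σ) (O v) := hOρ σ v
    rcases hg with hg | hg
    · rw [hg, h3]
    · rw [hg, LinearMap.neg_apply, LinearMap.neg_apply, h3, map_neg]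
  refine ⟨g, fun σ => LinearMap.ext fun v => ?_⟩
  rw [map_mul, map_mul, Module.End.mul_apply, Module.End.mul_apply, hg', std_apply_inv]

end Orthogonal

/-! ### Twists by signs -/

section Twist

variable {k : Type*} [Field k] [CharZero k] {n : ℕ}

local notation "ιV" => CliffordAlgebra.ι (form k n)

theorem signs_neg_one_ne_one : signs k n (-1) ≠ 1 := by
  intro h
  have h1 := congrArg cl h
  rw [cl_signs_neg_one, cl_one] at h1
  have h2 : (2 : k) • (1 : Cliff k n) = 0 := by
    rw [two_smul]; nth_rewrite 1 [← h1]; simp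
  exact one_ne_zero ((smul_eq_zero.1 h2).resolve_left two_ne_zero)

theorem signs_injective : Function.Injective (signs k n) := by
  refine (injective_iff_map_eq_one _).2 fun e he => ?_
  rcases Int.units_eq_one_or e with rfl | rfl
  · rfl
  · exact absurd he signs_neg_one_ne_one

/-- Elements with the same image under the standard representation and the same spinor norm agree up
to sign. -/
theorem exists_eq_signs_mul {x y : GSpin k n} (hstd : std k n x = std k n y)
    (hN : spinorNorm x = spinorNorm y) : ∃ e : ℤˣ, x = signs k n e * y := by
  have hy : spinorNorm y * spinorNorm y⁻¹ = 1 := by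
    rw [← spinorNorm_mul, mul_inv_cancel, spinorNorm_one]
  have h1 : std k n (x * y⁻¹) = 1 := by
    rw [map_mul, hstd, ← map_mul, mul_inv_cancel, map_one]
  have h2 : spinorNorm (x * y⁻¹) = 1 := by rw [spinorNorm_mul, hN, hy]
  obtain ⟨c, hc⟩ := cl_eq_algebraMap_of_std_eq_one h1
  have h3 : spinorNorm (x * y⁻¹) = c * c := spinorNorm_eq (by
    rw [hc, CliffordAlgebra.reverse.commutes, ← map_mul])
  rw [h2, eq_comm, mul_self_eq_one_iff] at h3
  suffices H : ∃ e : ℤˣ, x * y⁻¹ = signs k n e by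
    obtain ⟨e, he⟩ := H
    exact ⟨e, by rw [← he, inv_mul_cancel_right]⟩
  rcases h3 with rfl | rfl
  · exact ⟨1, cl_injective (by rw [hc, map_one, map_one, cl_one])⟩
  · exact ⟨-1, cl_injective (by rw [hc, map_neg, map_one, cl_signs_neg_one])⟩

theorem trace_std_conj (c x : GSpin k n) :
    LinearMap.trace k _ (std k n (c * x * c⁻¹)) = LinearMap.trace k _ (std k n x) := by
  have hc : std k n c⁻¹ * std k n c = 1 := by
    rw [← map_mul (std k n), inv_mul_cancel, map_one (std k n)]
  rw [map_mul (std k n), map_mul (std k n), LinearMap.trace_mul_comm, ← mul_assoc, hc, one_mul]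

variable {Γ : Type*} [Group Γ]

/-- The sign relating two homomorphisms to the general spin group which agree up to sign is a
character. -/
theorem exists_signs_hom {r₁ r₂ : Γ →* GSpin k n}
    (h : ∀ σ, ∃ e : ℤˣ, r₂ σ = signs k n e * r₁ σ) :
    ∃ η : Γ →* ℤˣ, ∀ σ, r₂ σ = signs k n (η σ) * r₁ σ := by
  choose η hη using h
  have huniq : ∀ (e : ℤˣ) σ, r₂ σ = signs k n e * r₁ σ → η σ = e := fun e σ he =>
    signs_injective (mul_right_cancel ((hη σ).symm.trans he))
  refine ⟨⟨⟨η, huniq 1 1 (by simp)⟩, fun σ τ => huniq _ _ ?_⟩, hη⟩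
  have hcomm : Commute (r₁ σ) (signs k n (η τ)) := (signs_mul_comm _ _).symm
  rw [map_mul, map_mul, map_mul, hη, hη]
  exact hcomm.mul_mul_mul_comm _ _

end Twist

section Semisimple

variable {k : Type*} [Field k] [CharZero k] {Γ : Type*} [Group Γ] {V : Type*} [AddCommGroup V]
  [Module k V]

/-- Twisting a representation by a sign character through a commuting involution preserves
semisimplicity. -/
theorem isSemisimpleRepresentation_of_sign_twist {ρ ρ' : Representation k Γ V}
    (h : ρ.IsSemisimpleRepresentation) {z : Module.End k V} (hz : z * z = 1)
    (hzρ : ∀ σ, Commute z (ρ σ)) (hρ' : ∀ σ, ρ' σ = ρ σ ∨ ρ' σ = z * ρ σ) :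
    ρ'.IsSemisimpleRepresentation := by
  have hzz : ∀ v, z (z v) = v := fun v => LinearMap.congr_fun hz v
  have hc : ∀ σ {A : Module.End k V}, Commute A z → Commute A (ρ σ) → Commute A (ρ' σ) := by
    intro σ A hAz hA
    rcases hρ' σ with h | h <;> rw [h]
    · exact hA
    · exact hAz.mul_right hA
  have hc' : ∀ σ, Commute z (ρ' σ) := fun σ => hc σ (Commute.refl z) (hzρ σ)
  -- a stable subspace on which `z` is a scalar is stable for both representations
  have hstab : ∀ W, IsStable ρ' W → (∃ c : k, c * c = 1 ∧ ∀ w ∈ W, z w = c • w) → IsStable ρ W := by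
    rintro W hW ⟨c, hcc, hcW⟩ σ w hw
    have h1 := hW σ w hw
    rcases hρ' σ with h | h
    · rwa [h] at h1
    · rw [h, Module.End.mul_apply] at h1
      have h2 := hcW _ h1
      rw [hzz] at h2
      have h3 := W.smul_mem c h1
      rwa [← h2] at h3
  refine isSemisimpleRepresentation_iff.2 fun W hW => ?_
  -- the projections onto the eigenspaces of `z`
  let p : Module.End k V := (2 : k)⁻¹ • (1 + z)
  let q : Module.End k V := (2 : k)⁻¹ • (1 - z)
  have hpq : ∀ v, p v + q v = v := fun v => by
    change (2 : k)⁻¹ • (v + z v) + (2 : k)⁻¹ • (v - z v) = v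
    rw [← smul_add, add_add_sub_cancel, ← two_smul k, smul_smul, inv_mul_cancel₀ two_ne_zero,
      one_smul]
  have hp : ∀ v, z v = v → p v = v ∧ q v = 0 := fun v hv => by
    constructor
    · change (2 : k)⁻¹ • (v + z v) = v
      rw [hv, ← two_smul k, smul_smul, inv_mul_cancel₀ two_ne_zero, one_smul]
    · change (2 : k)⁻¹ • (v - z v) = 0
      rw [hv, sub_self, smul_zero]
  have hpz : Commute p z := ((Commute.one_left z).add_left (Commute.refl z)).smul_left _
  have hqz : Commute q z := ((Commute.one_left z).sub_left (Commute.refl z)).smul_left _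
  have hzp : ∀ v, z (p v) = p v := fun v => by
    change z ((2 : k)⁻¹ • (v + z v)) = (2 : k)⁻¹ • (v + z v)
    rw [map_smul, map_add, hzz, add_comm]
  have hzq : ∀ v, z (q v) = -q v := fun v => by
    change z ((2 : k)⁻¹ • (v - z v)) = -((2 : k)⁻¹ • (v - z v))
    rw [map_smul, map_sub, hzz, ← smul_neg, neg_sub]
  have hcp : ∀ σ, Commute p (ρ σ) := fun σ =>
    ((Commute.one_left _).add_left (hzρ σ)).smul_left _
  have hcq : ∀ σ, Commute q (ρ σ) := fun σ =>
    ((Commute.one_left _).sub_left (hzρ σ)).smul_left _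
  have hcq' : ∀ σ, Commute q (ρ' σ) := fun σ => hc σ hqz (hcq σ)
  let W₁ := W ⊓ (z - 1 : Module.End k V).ker
  have hW₁z : ∀ w ∈ W₁, z w = w := fun w hw => by
    have : (z - 1 : Module.End k V) w = 0 := hw.2
    rwa [LinearMap.sub_apply, sub_eq_zero] at this
  have hW₁ : IsStable ρ W₁ := hstab W₁
    (hW.inf (IsStable.ker fun σ => (hc' σ).sub_left (Commute.one_left _)))
    ⟨1, one_mul 1, fun w hw => by rw [one_smul, hW₁z w hw]⟩
  have hW₂ : IsStable ρ (W.map q) := by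
    refine hstab _ ?_ ⟨-1, by ring, ?_⟩
    · rintro σ _ ⟨w, hw, rfl⟩
      exact ⟨ρ' σ w, hW σ w hw, LinearMap.congr_fun (hcq' σ).eq w⟩
    · rintro _ ⟨w, -, rfl⟩
      rw [hzq, neg_one_smul]
  obtain ⟨T₁, hT₁, hT₁m, hT₁i⟩ := exists_equivariant_projection h hW₁
  obtain ⟨T₂, hT₂, hT₂m, hT₂i⟩ := exists_equivariant_projection h hW₂
  -- the projections onto `W₁` and `W₂` along the eigenspaces of `z`
  have hS₁ : ∀ σ, Commute (T₁ * p) (ρ' σ) := fun σ => by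
    refine hc σ (LinearMap.ext fun v => ?_) ((hT₁ σ).mul_left (hcp σ))
    change T₁ (p (z v)) = z (T₁ (p v))
    rw [hW₁z _ (hT₁m _)]
    congr 1
    rw [← Module.End.mul_apply, hpz.eq, Module.End.mul_apply, hzp]
  have hS₂ : ∀ σ, Commute (T₂ * q) (ρ' σ) := fun σ => by
    refine hc σ (LinearMap.ext fun v => ?_) ((hT₂ σ).mul_left (hcq σ))
    change T₂ (q (z v)) = z (T₂ (q v))
    obtain ⟨w, -, hw⟩ := hT₂m (q v)
    rw [← hw, hzq, hw, ← map_neg, ← hzq, ← Module.End.mul_apply q, hqz.eq, Module.End.mul_apply]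
  refine ⟨(T₁ * p).ker ⊓ (T₂ * q).ker, (IsStable.ker hS₁).inf (IsStable.ker hS₂), ?_⟩
  rw [isCompl_iff, Submodule.disjoint_def, codisjoint_iff, eq_top_iff]
  constructor
  · rintro w hw ⟨h1, h2⟩
    rw [SetLike.mem_coe, LinearMap.mem_ker, Module.End.mul_apply] at h1 h2
    rw [hT₂i _ ⟨w, hw, rfl⟩] at h2
    have h3 : p w = w := by
      have := hpq w
      rwa [h2, add_zero] at this
    have h4 : w ∈ W₁ := ⟨hw, by
      change z w - w = 0
      rw [← h3, hzp, sub_self]⟩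
    rwa [h3, hT₁i w h4] at h1
  · intro v _
    obtain ⟨w, hw, hwv⟩ := hT₂m (q v)
    have ha := hT₁m (p (v - w))
    have haz := hp _ (hW₁z _ ha)
    have hv : v = (w + T₁ (p (v - w))) + (v - w - T₁ (p (v - w))) := by abel
    rw [hv]
    refine Submodule.add_mem_sup (W.add_mem hw ha.1) ⟨?_, ?_⟩
    · change T₁ (p (v - w - T₁ (p (v - w)))) = 0
      rw [map_sub p, haz.1, map_sub, hT₁i _ ha, sub_self]
    · change T₂ (q (v - w - T₁ (p (v - w)))) = 0
      rw [map_sub q, haz.2, sub_zero, map_sub, map_sub, hT₂i (q w) ⟨w, hw, rfl⟩, hwv, sub_self]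

theorem isSemisimpleRepresentation_congr {ρ ρ' : Representation k Γ V}
    (h : ρ.IsSemisimpleRepresentation) (e : V ≃ₗ[k] V) (he : ∀ σ v, e (ρ σ v) = ρ' σ (e v)) :
    ρ'.IsSemisimpleRepresentation := by
  refine isSemisimpleRepresentation_iff.2 fun W hW => ?_
  obtain ⟨C, hC, hWC⟩ := isSemisimpleRepresentation_iff.1 h (W.comap e.toLinearMap)
    fun σ w hw => by
      change e (ρ σ w) ∈ W
      rw [he]
      exact hW σ _ hw
  refine ⟨C.map e.toLinearMap, ?_, ?_⟩
  · rintro σ _ ⟨c, hc, rfl⟩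
    exact ⟨ρ σ c, hC σ c hc, he σ c⟩
  · have := (Submodule.orderIsoMapComap e).isCompl_iff.1 hWC
    have h2 : Submodule.orderIsoMapComap e (W.comap e.toLinearMap) = W :=
      Submodule.map_comap_eq_of_surjective e.surjective W
    rw [h2] at this
    exact this

/-- Conjugation and twisting by signs do not affect whether a given representation of the group
becomes semisimple on `Γ`. -/
theorem isSemisimple_comp_of_eq_signs {G : Type*} [Group G] {s : ℤˣ →* G}
    (hs : ∀ e x, s e * x = x * s e) {r₁ r₂ : Γ →* G} {R : Representation k G V}
    (h : Representation.IsSemisimpleRepresentation (R.comp r₁)) {g : G} {η : Γ → ℤˣ}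
    (hη : ∀ σ, r₂ σ = s (η σ) * (g * r₁ σ * g⁻¹)) :
    Representation.IsSemisimpleRepresentation (R.comp r₂) := by
  let e : V ≃ₗ[k] V := LinearEquiv.ofLinearMap (R g) (R g⁻¹)
    (by change R g * R g⁻¹ = 1; rw [← map_mul, mul_inv_cancel, map_one])
    (by change R g⁻¹ * R g = 1; rw [← map_mul, inv_mul_cancel, map_one])
  have h' := isSemisimpleRepresentation_congr h (ρ' := (R.comp (MulAut.conj g).toMonoidHom).comp r₁)
    e fun σ v => by
      change R g (R (r₁ σ) v) = R (g * r₁ σ * g⁻¹) (R g v)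
      rw [← Module.End.mul_apply, ← Module.End.mul_apply, ← map_mul, ← map_mul,
        inv_mul_cancel_right]
  refine isSemisimpleRepresentation_of_sign_twist h' (z := R (s (-1))) ?_ (fun σ => ?_)
    fun σ => ?_
  · have hss : s (-1) * s (-1) = 1 := (map_mul s (-1) (-1)).symm.trans (map_one _)
    rw [← map_mul R, hss, map_one]
  · have hcc : Commute (s (-1)) (g * r₁ σ * g⁻¹) := hs _ _
    exact hcc.map R
  · change R (r₂ σ) = R (g * r₁ σ * g⁻¹) ∨ R (r₂ σ) = R _ * R (g * r₁ σ * g⁻¹)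
    rw [hη]
    rcases Int.units_eq_one_or (η σ) with h | h <;> rw [h]
    · left; rw [map_one, one_mul]
    · right; rw [map_mul]

end Semisimple

section Local

variable {k : Type*} [NontriviallyNormedField k] [CharZero k] [IsAlgClosed k] {n : ℕ}
  {Γ : Type*} [Group Γ]

/-- Homomorphisms with elementwise conjugate semisimple parts agree up to conjugation and signs. -/
theorem exists_eq_signs_conj {r₁ r₂ : Γ →* GSpin k n}
    (h₁ : Representation.IsSemisimpleRepresentation ((std k n).comp r₁))
    (h₂ : Representation.IsSemisimpleRepresentation ((std k n).comp r₂))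
    (h : ∀ σ, ∃ s₁ s₂, IsSemisimplePart (r₁ σ) s₁ ∧ IsSemisimplePart (r₂ σ) s₂ ∧ IsConj s₁ s₂) :
    ∃ (g : GSpin k n) (η : Γ →* ℤˣ), ∀ σ, r₂ σ = signs k n (η σ) * (g * r₁ σ * g⁻¹) := by
  obtain ⟨g, hg⟩ := exists_std_conj_eq h₁ h₂ fun σ => by
    obtain ⟨s₁, s₂, hs₁, hs₂, hc⟩ := h σ
    obtain ⟨c, rfl⟩ := isConj_iff.1 hc
    rw [hs₁.trace_std_eq, hs₂.trace_std_eq, trace_std_conj]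
  obtain ⟨η, hη⟩ := exists_signs_hom (r₁ := (MulAut.conj g).toMonoidHom.comp r₁) (r₂ := r₂)
    fun σ => exists_eq_signs_mul (hg σ) (by
      obtain ⟨s₁, s₂, hs₁, hs₂, hc⟩ := h σ
      obtain ⟨c, rfl⟩ := isConj_iff.1 hc
      change _ = spinorNorm (g * r₁ σ * g⁻¹)
      rw [spinorNorm_conj, hs₁.spinorNorm_eq, hs₂.spinorNorm_eq, spinorNorm_conj])
  exact ⟨g, η, hη⟩

/-- If the semisimple parts of `x` and of a conjugate of `-x` are conjugate, then `-1` is an eigenvalue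
of `x` on `V`. -/
theorem hasEigenvalue_of_isConj_neg {x y g s₁ s₂ : GSpin k n}
    (hy : y = signs k n (-1) * (g * x * g⁻¹)) (hs₁ : IsSemisimplePart x s₁)
    (hs₂ : IsSemisimplePart y s₂) (hc : IsConj s₁ s₂) :
    Module.End.HasEigenvalue (std k n x) (-1) := by
  apply hasEigenvalue_neg_one_of_cliffTrace_eq_zero
  obtain ⟨c, rfl⟩ := isConj_iff.1 hc
  have h1 : cliffTrace k n (cl y) = cliffTrace k n (cl x) := by
    rw [hs₂.cliffTrace_eq, cliffTrace_conj, hs₁.cliffTrace_eq]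
  have h2 : cliffTrace k n (cl y) = -cliffTrace k n (cl x) := by
    rw [hy, cl_mul, cl_signs_neg_one, neg_mul, one_mul, map_neg, cliffTrace_conj]
  rw [h1, eq_neg_iff_add_eq_zero, ← two_mul] at h2
  simpa using h2

/-- If `x` has eigenvalue `-1` on `V`, then the semisimple parts of `x` and of a conjugate of `-x` are
conjugate. -/
theorem exists_isConj_of_eq_signs {x y g : GSpin k n} {e : ℤˣ}
    (hy : y = signs k n e * (g * x * g⁻¹))
    (he : e ≠ 1 → Module.End.HasEigenvalue (std k n x) (-1)) :
    ∃ s₁ s₂, IsSemisimplePart x s₁ ∧ IsSemisimplePart y s₂ ∧ IsConj s₁ s₂ := by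
  obtain ⟨s, hs⟩ := exists_isSemisimplePart x
  refine ⟨s, _, hs, hy ▸ hs.signs_conj e g, ?_⟩
  have hconj : IsConj (signs k n e * s) (signs k n e * (g * s * g⁻¹)) := isConj_iff.2 ⟨g, by
    rw [← mul_assoc, ← signs_mul_comm, mul_assoc, mul_assoc, ← mul_assoc g]⟩
  refine IsConj.trans ?_ hconj
  rcases Int.units_eq_one_or e with rfl | rfl
  · rw [map_one, one_mul]
  · exact hs.1.isConj_neg (hs.hasEigenvalue_std (he (by decide)))

/-- If the standard representation is irreducible, no non-trivial sign twist is a conjugate: the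
conjugating element is scalar in the standard representation, hence central. -/
theorem eq_one_of_isIrreducible {r : Γ →* GSpin k n}
    (h : Representation.IsIrreducible ((std k n).comp r)) {g : GSpin k n} {η : Γ → ℤˣ}
    (hη : ∀ σ, r σ * signs k n (η σ) = g * r σ * g⁻¹) (σ : Γ) : η σ = 1 := by
  have hcomm : ∀ σ, Commute (std k n g) (((std k n).comp r) σ) := fun σ => by
    have h1 : g * r σ = signs k n (η σ) * (r σ * g) := by
      rw [← mul_assoc, signs_mul_comm, hη, inv_mul_cancel_right]
    change std k n g * std k n (r σ) = std k n (r σ) * std k n g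
    rw [← map_mul, h1, map_mul, std_signs, one_mul, map_mul]
  have hmin : IsMinimalStable ((std k n).comp r) ⊤ := by
    refine ⟨fun _ _ _ => trivial, top_ne_bot, fun W hW _ => ?_⟩
    let W' : Subrepresentation ((std k n).comp r) := ⟨W, fun σ w hw => hW σ w hw⟩
    rcases h.eq_bot_or_eq_top W' with h | h
    · exact Or.inl (congrArg Subrepresentation.toSubmodule h)
    · exact Or.inr (congrArg Subrepresentation.toSubmodule h)
  obtain ⟨c, hc⟩ := hmin.exists_eq_smul hcomm fun _ _ => trivial
  obtain ⟨v, hv⟩ : ∃ v : Fin (2 * n + 1) → k, form k n v ≠ 0 := by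
    obtain ⟨b, -, hb⟩ := exists_orthogonal_basis k n
    exact ⟨_, hb 0⟩
  have hcc : c * c = 1 := by
    have h1 := form_std g v
    rw [hc v trivial, QuadraticMap.map_smul, smul_eq_mul] at h1
    exact (mul_eq_right₀ hv).1 h1
  rcases mul_self_eq_one_iff.1 hcc with rfl | rfl
  · obtain ⟨d, hd⟩ := cl_eq_algebraMap_of_std_eq_one (x := g)
      (LinearMap.ext fun v => by rw [hc v trivial, one_smul]; rfl)
    have hcen : g * r σ = r σ * g := cl_injective (by
      rw [cl_mul, cl_mul, hd, Algebra.commutes])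
    have h1 := hη σ
    rw [hcen, mul_inv_cancel_right, mul_eq_left] at h1
    exact signs_injective (h1.trans (map_one _).symm)
  · exact absurd (LinearMap.ext fun v => by rw [hc v trivial, neg_one_smul]; rfl)
      (std_ne_neg_one g)

end Local

/-! ### Continuity and quadratic extensions -/

section Topology

variable {k : Type*} [Field k] [CharZero k] [TopologicalSpace k] [IsTopologicalRing k] {n : ℕ}

theorem continuous_coordinate (c : CliffEven k n →ₗ[k] k) :
    Continuous fun x : GSpin k n => c (toEven x) := by
  let _ : TopologicalSpace (CliffEven k n) := moduleTopology k (CliffEven k n)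
  have : IsModuleTopology k (CliffEven k n) := ⟨rfl⟩
  have hc : Continuous c := IsModuleTopology.continuous_of_linearMap c
  exact hc.comp continuous_induced_dom

variable [T2Space k] {Γ : Type*} [Group Γ] [TopologicalSpace Γ] [IsTopologicalGroup Γ]

/-- The topology of the general spin group is induced from the even Clifford algebra, whose linear
functionals are continuous and separate points. -/
theorem isClosed_setOf_eq_signs_conj {r₁ r₂ : Γ → GSpin k n} (h₁ : Continuous r₁)
    (h₂ : Continuous r₂) (g : GSpin k n) (e : ℤˣ) :
    IsClosed {σ | r₂ σ = signs k n e * (g * r₁ σ * g⁻¹)} := by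
  have : {σ | r₂ σ = signs k n e * (g * r₁ σ * g⁻¹)} = ⋂ c : CliffEven k n →ₗ[k] k,
      {σ | c (toEven (r₂ σ)) = (((e : ℤ) : k) • c ∘ₗ LinearMap.mulLeftRight k
        (toEven g, toEven g⁻¹)) (toEven (r₁ σ))} := by
    ext σ
    rw [Set.mem_iInter]
    have hr : ∀ c : CliffEven k n →ₗ[k] k, (((e : ℤ) : k) • c ∘ₗ LinearMap.mulLeftRight k
        (toEven g, toEven g⁻¹)) (toEven (r₁ σ)) =
        c (toEven (signs k n e * (g * r₁ σ * g⁻¹))) := fun c => by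
      rw [toEven_signs_mul, map_smul]
      rfl
    simp only [Set.mem_ofPred_eq, hr]
    refine ⟨fun h c => by rw [h], fun h => toEven_injective ?_⟩
    rw [← sub_eq_zero, ← Module.forall_dual_apply_eq_zero_iff k]
    intro c
    rw [map_sub, h c, sub_self]
  rw [this]
  exact isClosed_iInter fun c => isClosed_eq ((continuous_coordinate c).comp h₂)
    ((continuous_coordinate _).comp h₁)

/-- The signs vary continuously, because each of the two fibres of `η` is closed. -/
theorem continuous_of_eq_signs_conj {r₁ r₂ : Γ → GSpin k n} (h₁ : Continuous r₁)
    (h₂ : Continuous r₂) {g : GSpin k n} {η : Γ → ℤˣ}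
    (hη : ∀ σ, r₂ σ = signs k n (η σ) * (g * r₁ σ * g⁻¹)) : Continuous η := by
  have hset : ∀ e, η ⁻¹' {e} = {σ | r₂ σ = signs k n e * (g * r₁ σ * g⁻¹)} := fun e => by
    ext σ
    refine ⟨fun h => ?_, fun h => ?_⟩
    · rw [Set.mem_preimage, Set.mem_singleton_iff] at h
      rw [← h]; exact hη σ
    · exact signs_injective (mul_right_cancel ((hη σ).symm.trans h))
  refine continuous_discrete_rng.2 fun e => ?_
  have hcompl : η ⁻¹' {e} = (η ⁻¹' {-e})ᶜ := by
    ext σ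
    rcases Int.units_eq_one_or e with rfl | rfl <;>
      rcases Int.units_eq_one_or (η σ) with h | h <;> simp [h]
  rw [hcompl, isOpen_compl_iff, hset]
  exact isClosed_setOf_eq_signs_conj h₁ h₂ g (-e)

end Topology

section Quadratic

variable {F : Type*} [Field F] [CharZero F]

/-- A non-trivial continuous sign character of the Galois group is the character of a quadratic
extension, the fixed field of its kernel. -/
theorem exists_eq_quadraticCharacter {η : AbsGal F →* ℤˣ} (hη : Continuous η) (hne : η ≠ 1) :
    ∃ E : IntermediateField F (AlgebraicClosure F), Module.finrank F E = 2 ∧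
      ∀ σ, η σ = quadraticCharacter E σ := by
  have hclosed : IsClosed (η.ker : Set (AbsGal F)) :=
    isClosed_singleton.preimage hη
  let H : ClosedSubgroup (AbsGal F) := ⟨η.ker, hclosed⟩
  have hfix : (IntermediateField.fixedField (H : Subgroup (AbsGal F))).fixingSubgroup = η.ker :=
    InfiniteGalois.fixingSubgroup_fixedField H
  refine ⟨IntermediateField.fixedField (H : Subgroup (AbsGal F)), ?_, fun σ => ?_⟩
  · rw [IntermediateField.finrank_eq_fixingSubgroup_index, hfix, Subgroup.index_ker]
    have htop : η.range = ⊤ := by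
      obtain ⟨σ, hσ⟩ : ∃ σ, η σ ≠ 1 := by
        by_contra! h
        exact hne (MonoidHom.ext h)
      have hσ' : η σ = -1 := (Int.units_eq_one_or _).resolve_left hσ
      rw [eq_top_iff]
      intro e _
      rcases Int.units_eq_one_or e with rfl | rfl
      · exact one_mem _
      · exact ⟨σ, hσ'⟩
    rw [htop, Subgroup.card_top, Nat.card_eq_fintype_card]
    rfl
  · rw [quadraticCharacter, hfix]
    split_ifs with h
    · exact h
    · exact (Int.units_eq_one_or _).resolve_left h

theorem finrank_eq_one_of_quadraticCharacter_eq_one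
    {E : IntermediateField F (AlgebraicClosure F)} (h : ∀ σ, quadraticCharacter E σ = 1) :
    Module.finrank F E = 1 := by
  rw [IntermediateField.finrank_eq_fixingSubgroup_index]
  have : E.fixingSubgroup = ⊤ := by
    rw [eq_top_iff]
    intro σ _
    by_contra hσ
    have := h σ
    rw [quadraticCharacter, if_neg hσ] at this
    exact absurd this (by decide)
  rw [this, Subgroup.index_top]

end Quadratic

end OddGSpin

theorem mainTheorem9 (F : Type*) [Field F] [NumberField F] (ℓ : ℕ) [Fact ℓ.Prime] (n : ℕ)
    (r₁ r₂ : GaloisRep F ℓ n) (hr₁ : r₁.IsSemisimple) :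
    (r₁.LocallyConjugate r₂ ↔
      ∃ (g : GSpin (PadicAlgCl ℓ) n) (η : AbsGal F →ₜ* ℤˣ),
        (∀ σ, r₂ σ = signs (PadicAlgCl ℓ) n (η σ) * (g * r₁ σ * g⁻¹)) ∧
        (η ≠ 1 → ∃ E : IntermediateField F (AlgebraicClosure F),
          Module.finrank F E = 2 ∧ (∀ σ, η σ = quadraticCharacter E σ) ∧ r₁.BadPosition E)) ∧
    (Representation.IsIrreducible
        ((std (PadicAlgCl ℓ) n).comp (r₁ : AbsGal F →* GSpin (PadicAlgCl ℓ) n)) →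
      ∀ E : IntermediateField F (AlgebraicClosure F), Module.finrank F E = 2 →
        ¬ ∃ g : GSpin (PadicAlgCl ℓ) n, ∀ σ,
          r₁ σ * signs (PadicAlgCl ℓ) n (quadraticCharacter E σ) = g * r₁ σ * g⁻¹) := by
  refine ⟨⟨?_, ?_⟩, ?_⟩
  · rintro ⟨⟨N₁, f₁, hf₁, hinj₁, hss₁⟩, ⟨N₂, f₂, hf₂, hinj₂, hss₂⟩, hloc⟩
    obtain ⟨g, η, hη⟩ := exists_eq_signs_conj (isSemisimple_std_comp hf₁ hinj₁ hss₁)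
      (isSemisimple_std_comp hf₂ hinj₂ hss₂) hloc
    have hcont : Continuous η :=
      continuous_of_eq_signs_conj (map_continuous r₁) (map_continuous r₂) hη
    refine ⟨g, ⟨η, hcont⟩, hη, fun hne => ?_⟩
    obtain ⟨E, hE, hEη⟩ := exists_eq_quadraticCharacter hcont fun h => hne (by
      ext σ
      exact congrArg Units.val (DFunLike.congr_fun h σ))
    refine ⟨E, hE, hEη, fun σ hσ => ?_⟩
    have hησ : η σ = -1 := by rw [hEη, quadraticCharacter, if_neg hσ]
    obtain ⟨s₁, s₂, hs₁, hs₂, hc⟩ := hloc σ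
    have h2 := hη σ
    rw [hησ] at h2
    exact hasEigenvalue_of_isConj_neg h2 hs₁ hs₂ hc
  · rintro ⟨g, η, hη, hbad⟩
    refine ⟨hr₁, ?_, fun σ => ?_⟩
    · obtain ⟨N, f, hf, hinj, hss⟩ := hr₁
      exact ⟨N, f, hf, hinj, isSemisimple_comp_of_eq_signs signs_mul_comm hss hη⟩
    · refine exists_isConj_of_eq_signs (hη σ) fun hne => ?_
      obtain ⟨E, -, hE, hEbad⟩ := hbad (by rintro rfl; exact hne rfl)
      refine hEbad σ fun hσ => hne ?_
      rw [hE, quadraticCharacter, if_pos hσ]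
  · rintro hirr E hE ⟨g, hg⟩
    have := finrank_eq_one_of_quadraticCharacter_eq_one
      (eq_one_of_isIrreducible (r := (r₁ : AbsGal F →* GSpin (PadicAlgCl ℓ) n)) hirr hg)
    omega
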